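/- Let $n \ge 1$ be an integer, let $t, s, \alpha \in \mathbb{C}$ with $|t| < 1$ and $s^2 = t$ (we write $\sqrt t = s$), and let $\lambda = (\lambda_1 \ge \lambda_2 \ge \dots \ge \lambda_{2n} \ge 0)$ be a partition with at most $2n$ nonzero parts, written with exactly $2n$ parts (zeros allowed). Let $m_i(\lambda)$ be the number of $k \in \{1,\dots,2n\}$ with $\lambda_k = i$, and put $$\phi_r(t) = \prod_{j=1}^r (1-t^j), \qquad v_\lambda(t) = \prod_{i \ge 0} \prod_{j=1}^{m_i(\lambda)} \frac{1-t^j}{1-t}.$$ Let $P_\lambda$ be the Hall–Littlewood polynomial $$P_\lambda(z_1,\dots,z_{2n};t) = \frac{1}{v_\lambda(t)} \sum_{w \in S_{2n}} w\Big( z_1^{\lambda_1}\cdots z_{2n}^{\lambda_{2n}} \prod_{1 \le i<j \le 2n} \frac{z_i - t z_j}{z_i - z_j} \Big),$$ where $w$ acts on the subscripts of the variables. For $m\ge 0$ let $$\tilde\Delta_K^{(m)}(x;a,b,c,d;t) = \frac{1}{2^m m!} \prod_{i=1}^m \frac{1-x_i^{\pm 2}}{(1-a x_i^{\pm 1})(1-b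 x_i^{\pm 1})(1-c x_i^{\pm 1})(1-d x_i^{\pm 1})} \prod_{1 \le i<j \le m} \frac{1-x_i^{\pm 1}x_j^{\pm 1}}{1-t x_i^{\pm 1}x_j^{\pm 1}},$$ where a factor containing $\pm$ signs denotes the product over all choices of the signs, and write $\tilde\Delta_K^{(m)}(\pm t, \pm\sqrt t)$ for $\tilde\Delta_K^{(m)}(x;t,-t,\sqrt t,-\sqrt t;t)$. Integrals are over the torus $|x_1| = \dots = |x_{n-1}| = 1$ with $dT = \prod_{j=1}^{n-1} \frac{dx_j}{2\pi\sqrt{-1}\,x_j}$ (for $n=1$ the integral is evaluation of the integrand, there being no variables). Then both integrands below are integrable, $\int \tilde\Delta_K^{(n-1)}(\pm t,\pm\sqrt t)\,dT \ne 0$, and $$\frac{1-\alpha^2}{\int \tilde\Delta_K^{(n-1)}(\pm t,\pm\sqrt t)\,dT} \int P_\lambda(x_1^{\pm 1},\dots,x_{n-1}^{\pm 1},1,-1;t)\, \tilde\Delta_K^{(n-1)}(\pm t,\pm\sqrt t) \prod_{i=1}^{n-1}(1-\alpha x_i^{\pm 1})\,dT$$ $$= \frac{\phi_{2n}(t)}{v_\lambda(t)(1-t)^{2n}}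 \Big[ (-\alpha)^{\#\{k \,:\, \lambda_k \text{ odd}\}} - (-\alpha)^{\#\{k \,:\, \lambda_k \text{ even}\}} \Big],$$ where both counts run over $1 \le k \le 2n$, so that zero parts count as even parts. -/

import Mathlib

open Finset MvPolynomial

/-! ## Hall–Littlewood polynomials

A partition with at most `m` nonzero parts is a weakly decreasing function `lam : Fin m → ℕ`
(zero parts allowed, the coordinate `i : Fin m` being the part number `i + 1`). -/

section HallLittlewood

variable {m : ℕ}

/-- The polynomial `φ_r(t) = (1 - t)(1 - t²)⋯(1 - t^r)`. -/
def phiFactor (r : ℕ) (t : ℂ) : ℂ := ∏ j ∈ Icc 1 r, (1 - t ^ j)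

/-- The multiplicity `m_i(λ)`, the number of indices `k` with `λ_k = i` (also for `i = 0`). -/
def partMult (lam : Fin m → ℕ) (i : ℕ) : ℕ := #{k | lam k = i}

/-- `v_λ(t) = ∏_{i ≥ 0} ∏_{j = 1}^{m_i(λ)} (1 - t^j) / (1 - t)`; only the values `i` taken by the
parts (zero included) contribute. -/
noncomputable def vFactor (lam : Fin m → ℕ) (t : ℂ) : ℂ :=
  ∏ i ∈ univ.image lam, ∏ j ∈ Icc 1 (partMult lam i), (1 - t ^ j) / (1 - t)

/-- The number of odd parts of `λ`. -/
def numOddParts (lam : Fin m → ℕ) : ℕ := #{k | Odd (lam k)}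

/-- The number of even parts among the `m` parts of `λ`, zero parts included. -/
def numEvenParts (lam : Fin m → ℕ) : ℕ := #{k | Even (lam k)}

/-- The term `w (x^λ ∏_{i < j} (x_i - t x_j) / (x_i - x_j))` attached to a permutation `w`, which
acts on the subscripts of the variables, with values in a field `K` containing `ℂ`. -/
noncomputable def hlTerm {K : Type*} [Field K] [Algebra ℂ K] (lam : Fin m → ℕ) (t : ℂ)
    (x : Fin m → K) (w : Equiv.Perm (Fin m)) : K :=
  (∏ i, x (w i) ^ lam i) *
    ∏ i, ∏ j ∈ Ioi i, (x (w i) - algebraMap ℂ K t * x (w j)) / (x (w i) - x (w j))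

/-- The antisymmetric numerator of the symmetrization. -/
noncomputable def hlNumer {K : Type*} [CommRing K] [Algebra ℂ K] (lam : Fin m → ℕ) (t : ℂ)
    (x : Fin m → K) : K :=
  ∑ w : Equiv.Perm (Fin m), ((Equiv.Perm.sign w : ℤ) : K) *
    ((∏ i, x (w i) ^ lam i) * ∏ i, ∏ j ∈ Ioi i, (x (w i) - algebraMap ℂ K t * x (w j)))

theorem hlTerm_sum_mul {K : Type*} [Field K] [Algebra ℂ K] (lam : Fin m → ℕ) (t : ℂ)
    (x : Fin m → K) (hx : Function.Injective x) :
    (∑ w, hlTerm lam t x w) * (∏ i, ∏ j ∈ Ioi i, (x i - x j)) = hlNumer lam t x := by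
  rw [hlNumer, Finset.sum_mul]
  refine Finset.sum_congr rfl fun w _ => ?_
  have h1 : ∏ i, ∏ j ∈ Ioi i, (x (w i) - x (w j)) =
      ((Equiv.Perm.sign w : ℤ) : K) * ∏ i, ∏ j ∈ Ioi i, (x i - x j) :=
    w.prod_Ioi_comp_eq_sign_mul_prod (f := fun i j => x i - x j) fun i j => (neg_sub _ _).symm
  have h2 : ∏ i, ∏ j ∈ Ioi i, (x (w i) - x (w j)) ≠ 0 := by
    refine Finset.prod_ne_zero_iff.2 fun i _ => Finset.prod_ne_zero_iff.2 fun j hj => ?_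
    rw [sub_ne_zero]
    exact fun h => (Finset.mem_Ioi.1 hj).ne (w.injective (hx h))
  have h3 : ((Equiv.Perm.sign w : ℤ) : K) * ((Equiv.Perm.sign w : ℤ) : K) = 1 := by
    rw [← Int.cast_mul, ← Units.val_mul, Int.units_mul_self]; simp
  have h4 : ∏ i, ∏ j ∈ Ioi i, (x i - x j) =
      ((Equiv.Perm.sign w : ℤ) : K) * ∏ i, ∏ j ∈ Ioi i, (x (w i) - x (w j)) := by
    rw [h1, ← mul_assoc, h3, one_mul]
  rw [hlTerm, h4]
  simp only [Finset.prod_div_distrib]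
  field_simp

theorem X_sub_X_isRelPrime {i j k l : Fin m} (hij : i < j) (hkl : k < l) (h : (i, j) ≠ (k, l)) :
    IsRelPrime (X i - X j : MvPolynomial (Fin m) ℂ) (X k - X l) := by
  have hirr : Irreducible (X i - X j : MvPolynomial (Fin m) ℂ) := by
    have hc : coeff (Finsupp.single i 1) (X i - X j : MvPolynomial (Fin m) ℂ) = 1 := by
      simp [coeff_X, Finsupp.single_left_inj, hij.ne']
    apply irreducible_of_totalDegree_eq_one
    · apply le_antisymm
      · exact (totalDegree_sub _ _).trans (by simp)
      · have := le_totalDegree (p := (X i - X j : MvPolynomial (Fin m) ℂ))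
          (s := Finsupp.single i 1) (by rw [mem_support_iff, hc]; exact one_ne_zero)
        simpa using this
    · intro r hr
      have := hr (Finsupp.single i 1)
      rw [hc] at this
      exact isUnit_of_dvd_one this
  rw [hirr.isRelPrime_iff_not_dvd]
  rintro ⟨q, hq⟩
  by_cases hk : k = i ∨ k = j
  · have hl : l ≠ i ∧ l ≠ j := by
      constructor
      · rintro rfl
        rcases hk with rfl | rfl
        · exact lt_irrefl _ hkl
        · exact lt_asymm hij hkl
      · rintro rfl
        rcases hk with rfl | rfl
        · exact h rfl
        · exact lt_irrefl _ hkl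
    have := congrArg (eval (Pi.single l (1 : ℂ))) hq
    simp [hl.1.symm, hl.2.symm, hkl.ne] at this
  · push Not at hk
    have := congrArg (eval (Pi.single k (1 : ℂ))) hq
    simp [hk.1.symm, hk.2.symm, hkl.ne'] at this

theorem X_sub_X_dvd_hlNumer (lam : Fin m → ℕ) (t : ℂ) {i j : Fin m} (hij : i < j) :
    (X i - X j : MvPolynomial (Fin m) ℂ) ∣ hlNumer lam t X := by
  set N : MvPolynomial (Fin m) ℂ := hlNumer lam t X with hN
  set s := Equiv.swap i j with hs
  have h1 : rename s N = -N := by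
    rw [hN, hlNumer, map_sum, ← Finset.sum_neg_distrib]
    refine Fintype.sum_equiv (Equiv.mulLeft s) _ _ fun w => ?_
    have : Equiv.Perm.sign s = -1 := Equiv.Perm.sign_swap hij.ne
    simp [this, map_prod]
  let I : Ideal (MvPolynomial (Fin m) ℂ) := Ideal.span {X i - X j}
  have h2 : (Ideal.Quotient.mkₐ ℂ I).comp (rename s) = Ideal.Quotient.mkₐ ℂ I := by
    have hij' : Ideal.Quotient.mkₐ ℂ I (X i) = Ideal.Quotient.mkₐ ℂ I (X j) :=
      Ideal.Quotient.eq.2 (Ideal.subset_span rfl)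
    ext k
    simp only [AlgHom.comp_apply, rename_X]
    rcases eq_or_ne k i with rfl | hi
    · rw [hs, Equiv.swap_apply_left, hij']
    · rcases eq_or_ne k j with rfl | hj
      · rw [hs, Equiv.swap_apply_right, hij']
      · rw [hs, Equiv.swap_apply_of_ne_of_ne hi hj]
  have h3 : rename s N - N ∈ I := Ideal.Quotient.eq.1 (DFunLike.congr_fun h2 N)
  rw [h1, Ideal.mem_span_singleton] at h3
  have h4 : N = C (-(1 / 2)) * (-N - N) := by
    have : (C (-(1 / 2)) : MvPolynomial (Fin m) ℂ) * C (-2) = 1 := by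
      rw [← C_mul]; norm_num
    have h5 : (C (-2) : MvPolynomial (Fin m) ℂ) = -2 := by
      rw [C_neg, map_ofNat]
    rw [h5] at this
    linear_combination -N * this
  rw [h4]
  exact h3.mul_left _

/-- The symmetrization, a priori a rational function, is a polynomial. -/
theorem exists_hlR (lam : Fin m → ℕ) (t : ℂ) : ∃ R : MvPolynomial (Fin m) ℂ,
    algebraMap (MvPolynomial (Fin m) ℂ) (FractionRing (MvPolynomial (Fin m) ℂ)) R =
      ∑ w, hlTerm lam t (fun i => algebraMap (MvPolynomial (Fin m) ℂ)
        (FractionRing (MvPolynomial (Fin m) ℂ)) (X i)) w := by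
  have hdvd : (∏ i : Fin m, ∏ j ∈ Ioi i, (X i - X j) : MvPolynomial (Fin m) ℂ) ∣
      hlNumer lam t X := by
    rw [Finset.prod_sigma']
    refine Finset.prod_dvd_of_isRelPrime ?_ ?_
    · rintro ⟨i, j⟩ hij ⟨k, l⟩ hkl hne
      simp only [coe_sigma, Set.mem_sigma_iff, coe_univ, Set.mem_univ, true_and, coe_Ioi,
        Set.mem_Ioi] at hij hkl
      refine X_sub_X_isRelPrime hij hkl ?_
      rintro h
      obtain ⟨rfl, rfl⟩ := Prod.mk.inj h
      exact hne rfl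
    · rintro ⟨i, j⟩ hij
      simp only [mem_sigma, mem_univ, true_and, mem_Ioi] at hij
      exact X_sub_X_dvd_hlNumer lam t hij
  obtain ⟨R, hR⟩ := hdvd
  refine ⟨R, ?_⟩
  set A := algebraMap (MvPolynomial (Fin m) ℂ) (FractionRing (MvPolynomial (Fin m) ℂ)) with hA
  have hAinj : Function.Injective A := IsFractionRing.injective _ _
  have hinj : Function.Injective (fun i : Fin m => A (X i)) :=
    fun i j h => X_injective (hAinj h)
  have hV : (∏ i : Fin m, ∏ j ∈ Ioi i, (A (X i) - A (X j))) ≠ 0 := by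
    refine Finset.prod_ne_zero_iff.2 fun i _ => Finset.prod_ne_zero_iff.2 fun j hj => ?_
    rw [sub_ne_zero]
    exact fun h => (Finset.mem_Ioi.1 hj).ne (hinj h)
  apply mul_right_cancel₀ hV
  rw [hlTerm_sum_mul lam t _ hinj]
  have h6 : A (hlNumer lam t X) = hlNumer lam t (fun i => A (X i)) := by
    simp only [hlNumer, map_sum, map_mul, map_prod, map_pow, map_sub, map_intCast]
    simp only [hA, ← IsScalarTower.algebraMap_apply]
  rw [← h6, hR, map_mul, mul_comm]
  simp [map_prod]

/-- The polynomial `R_λ(x_1, …, x_m; t) = ∑_w w (x^λ ∏_{i < j} (x_i - t x_j) / (x_i - x_j))`, the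
sum being taken in the field of rational functions. -/
noncomputable def hlR (lam : Fin m → ℕ) (t : ℂ) : MvPolynomial (Fin m) ℂ :=
  (exists_hlR lam t).choose

theorem hlR_spec (lam : Fin m → ℕ) (t : ℂ) :
    algebraMap (MvPolynomial (Fin m) ℂ) (FractionRing (MvPolynomial (Fin m) ℂ)) (hlR lam t) =
      ∑ w, hlTerm lam t (fun i => algebraMap (MvPolynomial (Fin m) ℂ)
        (FractionRing (MvPolynomial (Fin m) ℂ)) (X i)) w :=
  (exists_hlR lam t).choose_spec

/-- The Hall–Littlewood polynomial `P_λ(x_1, …, x_m; t) = R_λ(x_1, …, x_m; t) / v_λ(t)`. -/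
noncomputable def hallLittlewoodP (lam : Fin m → ℕ) (t : ℂ) : MvPolynomial (Fin m) ℂ :=
  C (vFactor lam t)⁻¹ * hlR lam t

/-- At a point with distinct coordinates the values are given by the defining formula. -/
theorem eval_hallLittlewoodP (lam : Fin m → ℕ) (t : ℂ) (x : Fin m → ℂ)
    (hx : Function.Injective x) :
    eval x (hallLittlewoodP lam t) = (vFactor lam t)⁻¹ * ∑ w, hlTerm lam t x w := by
  set A := algebraMap (MvPolynomial (Fin m) ℂ) (FractionRing (MvPolynomial (Fin m) ℂ)) with hA
  have hAinj : Function.Injective A := IsFractionRing.injective _ _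
  have hinj : Function.Injective (fun i : Fin m => A (X i)) :=
    fun i j h => X_injective (hAinj h)
  have h6 : A (hlNumer lam t X) = hlNumer lam t (fun i => A (X i)) := by
    simp only [hlNumer, map_sum, map_mul, map_prod, map_pow, map_sub, map_intCast]
    simp only [hA, ← IsScalarTower.algebraMap_apply]
  have h7 : hlR lam t * (∏ i, ∏ j ∈ Ioi i, (X i - X j)) = hlNumer lam t X := by
    apply hAinj
    rw [h6, ← hlTerm_sum_mul lam t _ hinj, map_mul, hlR_spec]
    simp [map_prod, hA]
  have h8 := congrArg (eval x) h7
  have h9 : eval x (hlNumer lam t X) = hlNumer lam t x := by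
    simp [hlNumer, map_sum, map_prod]
  have hV : (∏ i : Fin m, ∏ j ∈ Ioi i, (x i - x j)) ≠ 0 := by
    refine Finset.prod_ne_zero_iff.2 fun i _ => Finset.prod_ne_zero_iff.2 fun j hj => ?_
    rw [sub_ne_zero]
    exact fun h => (Finset.mem_Ioi.1 hj).ne (hx h)
  rw [h9, ← hlTerm_sum_mul lam t x hx, map_mul] at h8
  simp only [map_prod, map_sub, eval_X] at h8
  rw [hallLittlewoodP, map_mul, eval_C, mul_right_cancel₀ hV h8]

end HallLittlewood

/-! ## Densities and integrals over the torus -/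

/-- The factor `1 - u x^{±1}`, meaning `(1 - u x)(1 - u x⁻¹)`. -/
noncomputable def pmFactor (u x : ℂ) : ℂ := (1 - u * x) * (1 - u * x⁻¹)

/-- The factor `1 - u x^{±1} y^{±1}`, a product over the four choices of signs. -/
noncomputable def pmFactor₂ (u x y : ℂ) : ℂ :=
  (1 - u * (x * y)) * (1 - u * (x⁻¹ * y⁻¹)) * (1 - u * (x⁻¹ * y)) * (1 - u * (x * y⁻¹))

/-- The symmetric Koornwinder density (at `q = 0`) in the variables `x_1, …, x_m`. -/
noncomputable def koornwinderDensity {m : ℕ} (a b c d t : ℂ) (x : Fin m → ℂ) : ℂ :=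
  1 / (2 ^ m * (m.factorial : ℂ)) *
    (∏ i, ((1 - x i ^ 2) * (1 - (x i)⁻¹ ^ 2)) /
      (pmFactor a (x i) * pmFactor b (x i) * pmFactor c (x i) * pmFactor d (x i))) *
    ∏ i, ∏ j ∈ Ioi i, pmFactor₂ 1 (x i) (x j) / pmFactor₂ t (x i) (x j)

/-- The integral `∫_T f dT` over the torus `|x_1| = ⋯ = |x_m| = 1` with respect to
`dT = ∏_j dx_j / (2π√-1 x_j)`. -/
noncomputable def torusMean {m : ℕ} (f : (Fin m → ℂ) → ℂ) : ℂ :=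
  torusIntegral (fun x => (∏ j, (2 * (Real.pi : ℂ) * Complex.I * x j)⁻¹) * f x) 0 (fun _ => 1)

/-- The point `(x_1, …, x_{n-1}, x_1⁻¹, …, x_{n-1}⁻¹, 1, -1)` with `2n` coordinates (`n ≥ 1`). -/
noncomputable def oMinusPoint (n : ℕ) (x : Fin (n - 1) → ℂ) : Fin (2 * n) → ℂ := fun k =>
  if h₁ : (k : ℕ) < n - 1 then x ⟨k, h₁⟩
  else if h₂ : (k : ℕ) - (n - 1) < n - 1 then (x ⟨(k : ℕ) - (n - 1), h₂⟩)⁻¹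
  else if (k : ℕ) = 2 * (n - 1) then 1
  else -1

/-- The integrand `P_λ(x_1^{±1}, …, x_{n-1}^{±1}, 1, -1; t) Δ_K^{(n-1)}(x; ±t, ±s; t)
∏_i (1 - α x_i^{±1})`, where `s` plays the role of a square root of `t`. -/
noncomputable def oMinusIntegrand (n : ℕ) (lam : Fin (2 * n) → ℕ) (t s α : ℂ)
    (x : Fin (n - 1) → ℂ) : ℂ :=
  eval (oMinusPoint n x) (hallLittlewoodP lam t) *
    koornwinderDensity t (-t) s (-s) t x * ∏ i, pmFactor α (x i)

/-!
Write `m = n - 1` and `N = 2n`. The point at which `P_λ` is evaluated has the `N` coordinates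
`x_i`, `x_i⁻¹`, `1`, `-1`, the *letters*. Inserting the definition of `P_λ`, the integrand becomes a
sum over the arrangements `v` of the letters on the positions `1, …, N`, the letter at the position
`p` having the exponent `λ_p`. The terms of this sum have poles on the torus, although their sum
does not. So before expanding, the torus is deformed, in every variable separately, to the average
of the two circles `|z| = ρ` and `|z| = ρ⁻¹` with `ρ` slightly larger than `1`
(`integral_pi_circleMeasure_one_eq`). This average avoids the poles and is invariant under
`z ↦ z⁻¹`, so that it behaves like a principal value.

By the inversion symmetry, `x_i` may be assumed to stand to the left of `x_i⁻¹` in the arrangement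
`v`. Then the Hall–Littlewood factors cancel most of the density (`termIntegrand_eq`), and in the
variable whose first letter is leftmost the only poles inside the disc are simple ones at `±1`. They
contribute half of their residues, and the residues have the same shape in the remaining variables.
Hence the integral of a term is a constant times a sum over the specializations `x_i = ε_i = ±1`
(`integral_residueIntegrand`, `integral_termIntegrand`). In it, the pairs `{x_i, x_i⁻¹}`, and the
letters `±1`, interact only through a sign: `-1` for any two pairs of equal sign that cross in `v`,
and for any of the letters `±1` enclosed by a pair of its own sign (`crossSign`).

The pair `(v, ε)` colours the positions by signs, with an odd number of positions coloured `1`, and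
apart from `crossSign` a summand depends on this colouring only. A sign-reversing involution shows
that the signed number of pairs `(v, ε)` with a given colouring does not depend on the colouring
(`sum_crossSign_of_isAdapted`, `sum_mul_crossSign`). There remains the sum of
`∏_p κ_p ^ λ_p (1 - α κ_p)` over the colourings `κ` with an odd number of positions coloured `1`;
this is a difference of two products over the positions, which gives the two powers of `-α`
(`sum_odd_colorings`).

The same computation for `λ = 0` and `α = 0` determines the integral of the density, because
there the symmetrization is the constant `φ_N(t) / (1 - t)^N` (`sum_hlTerm_zero`, which rests on
Lagrange interpolation). Dividing the two results, all constants cancel.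
-/

open MeasureTheory

/-! ### Circle measures -/

/-- The uniform probability measure on the circle `|z| = ρ`. -/
noncomputable def circleMeasure (ρ : ℝ) : Measure ℂ :=
  Measure.map (circleMap 0 ρ)
    (ENNReal.ofReal (2 * Real.pi)⁻¹ • volume.restrict (Set.Ioc 0 (2 * Real.pi)))

instance (ρ : ℝ) : IsProbabilityMeasure (circleMeasure ρ) := by
  have hm : AEMeasurable (circleMap 0 ρ)
      (ENNReal.ofReal (2 * Real.pi)⁻¹ • volume.restrict (Set.Ioc 0 (2 * Real.pi))) :=
    (continuous_circleMap 0 ρ).measurable.aemeasurable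
  have h : IsProbabilityMeasure
      (ENNReal.ofReal (2 * Real.pi)⁻¹ • volume.restrict (Set.Ioc 0 (2 * Real.pi)) : Measure ℝ) := by
    constructor
    have hpi : (0 : ℝ) < 2 * Real.pi := Real.two_pi_pos
    rw [Measure.smul_apply, Measure.restrict_apply_univ, Real.volume_Ioc, smul_eq_mul, sub_zero,
      ← ENNReal.ofReal_mul (inv_pos.2 hpi).le, inv_mul_cancel₀ hpi.ne', ENNReal.ofReal_one]
  exact Measure.isProbabilityMeasure_map hm

theorem circleMeasure_compl_sphere (ρ : ℝ) :
    circleMeasure ρ (Metric.sphere (0 : ℂ) |ρ|)ᶜ = 0 := by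
  rw [circleMeasure, Measure.map_apply (continuous_circleMap 0 ρ).measurable
    Metric.isClosed_sphere.measurableSet.compl]
  have : circleMap 0 ρ ⁻¹' (Metric.sphere (0 : ℂ) |ρ|)ᶜ = ∅ := by
    ext θ
    simp
  rw [this, measure_empty]

theorem circleMeasure_singleton {ρ : ℝ} (hρ : ρ ≠ 0) (z : ℂ) : circleMeasure ρ {z} = 0 := by
  rw [circleMeasure, Measure.map_apply (continuous_circleMap 0 ρ).measurable
    (measurableSet_singleton z), Measure.smul_apply]
  have h : (circleMap 0 ρ ⁻¹' {z}).Countable := (Set.countable_singleton z).preimage_circleMap 0 hρ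
  rw [h.measure_zero, smul_zero]

theorem map_inv_circleMeasure (ρ : ℝ) :
    Measure.map (fun z : ℂ => z⁻¹) (circleMeasure ρ) = circleMeasure ρ⁻¹ := by
  have h1 : (fun z : ℂ => z⁻¹) ∘ circleMap 0 ρ =
      circleMap 0 ρ⁻¹ ∘ fun θ : ℝ => 2 * Real.pi - θ := by
    ext θ
    have : Complex.exp ((2 * Real.pi - θ) * Complex.I) = (Complex.exp (θ * Complex.I))⁻¹ := by
      rw [sub_mul, Complex.exp_sub, Complex.exp_two_pi_mul_I, one_div]
    simp only [Function.comp_apply, circleMap, zero_add, Complex.ofReal_inv, mul_inv, ← this]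
    push_cast
    rfl
  have h2 : Measure.map (fun θ : ℝ => 2 * Real.pi - θ)
      (volume.restrict (Set.Ioc 0 (2 * Real.pi))) = volume.restrict (Set.Ioc 0 (2 * Real.pi)) := by
    have hp : MeasurePreserving (fun θ : ℝ => 2 * Real.pi - θ) volume volume :=
      Measure.measurePreserving_sub_left volume (2 * Real.pi)
    have := hp.restrict_preimage (s := Set.Ioc 0 (2 * Real.pi)) measurableSet_Ioc
    rw [Set.preimage_const_sub_Ioc, sub_self, sub_zero] at this
    rw [restrict_Ico_eq_restrict_Ioc] at this
    exact this.map_eq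
  rw [circleMeasure, Measure.map_map measurable_inv (continuous_circleMap 0 ρ).measurable, h1,
    ← Measure.map_map (continuous_circleMap 0 ρ⁻¹).measurable (by fun_prop), Measure.map_smul, h2,
    circleMeasure]

theorem integral_circleMeasure {ρ : ℝ} (hρ : 0 < ρ) {f : ℂ → ℂ}
    (hf : ContinuousOn f (Metric.sphere 0 ρ)) :
    ∫ z, f z ∂circleMeasure ρ =
      (2 * Real.pi * Complex.I)⁻¹ * ∮ z in C(0, ρ), (z - 0)⁻¹ • f z := by
  have hms : MeasurableSet (Metric.sphere (0 : ℂ) ρ) := Metric.isClosed_sphere.measurableSet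
  have hres : (circleMeasure ρ).restrict (Metric.sphere 0 ρ) = circleMeasure ρ := by
    rw [Measure.restrict_eq_self_of_ae_mem]
    have := circleMeasure_compl_sphere ρ
    rw [abs_of_pos hρ] at this
    exact this
  have hfm : AEStronglyMeasurable f (circleMeasure ρ) := by
    rw [← hres]
    exact hf.aestronglyMeasurable hms
  rw [circleMeasure] at hfm ⊢
  rw [integral_map (continuous_circleMap 0 ρ).measurable.aemeasurable hfm, integral_smul_measure,
    ENNReal.toReal_ofReal (inv_pos.2 Real.two_pi_pos).le, circleIntegral,
    intervalIntegral.integral_of_le Real.two_pi_pos.le]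
  have : ∀ θ : ℝ, deriv (circleMap 0 ρ) θ • (circleMap 0 ρ θ - 0)⁻¹ • f (circleMap 0 ρ θ) =
      Complex.I * f (circleMap 0 ρ θ) := by
    intro θ
    have h0 : circleMap 0 ρ θ ≠ 0 := circleMap_ne_center hρ.ne'
    simp only [deriv_circleMap, sub_zero, smul_eq_mul]
    field_simp
  simp_rw [this]
  rw [integral_const_mul, Complex.real_smul]
  have hpi : (Real.pi : ℂ) ≠ 0 := by exact_mod_cast Real.pi_ne_zero
  push_cast
  field_simp

/-- The average of the uniform probability measures on the circles of radii `ρ` and `ρ⁻¹`. It is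
invariant under `z ↦ z⁻¹`, and for `ρ ≠ 1` it avoids the points `±1`; integrating against it
plays the role of a principal value integral over the unit circle. -/
noncomputable def twoCircleMeasure (ρ : ℝ) : Measure ℂ :=
  (2 : ENNReal)⁻¹ • (circleMeasure ρ + circleMeasure ρ⁻¹)

/-- The closed annulus `ρ⁻¹ ≤ |z| ≤ ρ`. -/
def annulus (ρ : ℝ) : Set ℂ := {z | ρ⁻¹ ≤ ‖z‖ ∧ ‖z‖ ≤ ρ}

/-- The union of the two circles `|z| = ρ` and `|z| = ρ⁻¹`. -/
def twoCircles (ρ : ℝ) : Set ℂ := Metric.sphere 0 ρ ∪ Metric.sphere 0 ρ⁻¹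

instance (ρ : ℝ) : IsProbabilityMeasure (twoCircleMeasure ρ) := by
  constructor
  rw [twoCircleMeasure, Measure.smul_apply, Measure.add_apply, measure_univ, measure_univ,
    smul_eq_mul, one_add_one_eq_two]
  exact ENNReal.inv_mul_cancel (by simp) (by simp)

theorem twoCircleMeasure_compl {ρ : ℝ} (hρ : 0 < ρ) :
    twoCircleMeasure ρ (twoCircles ρ)ᶜ = 0 := by
  have h1 := circleMeasure_compl_sphere ρ
  have h2 := circleMeasure_compl_sphere ρ⁻¹
  rw [abs_of_pos hρ] at h1
  rw [abs_of_pos (inv_pos.2 hρ)] at h2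
  rw [twoCircleMeasure, Measure.smul_apply, Measure.add_apply, twoCircles, Set.compl_union,
    measure_mono_null Set.inter_subset_left h1, measure_mono_null Set.inter_subset_right h2]
  simp

theorem twoCircleMeasure_singleton {ρ : ℝ} (hρ : 0 < ρ) (z : ℂ) :
    twoCircleMeasure ρ {z} = 0 := by
  rw [twoCircleMeasure, Measure.smul_apply, Measure.add_apply, circleMeasure_singleton hρ.ne',
    circleMeasure_singleton (inv_ne_zero hρ.ne')]
  simp

theorem measurePreserving_inv_twoCircleMeasure (ρ : ℝ) :
    MeasurePreserving (fun z : ℂ => z⁻¹) (twoCircleMeasure ρ) (twoCircleMeasure ρ) := by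
  refine ⟨measurable_inv, ?_⟩
  rw [twoCircleMeasure, Measure.map_smul, Measure.map_add _ _ measurable_inv,
    map_inv_circleMeasure, map_inv_circleMeasure, inv_inv, add_comm]

theorem twoCircles_subset_annulus {ρ : ℝ} (hρ : 1 < ρ) : twoCircles ρ ⊆ annulus ρ := by
  have h1 : ρ⁻¹ < 1 := inv_lt_one_of_one_lt₀ hρ
  rintro z (hz | hz) <;> rw [mem_sphere_zero_iff_norm] at hz <;> constructor <;> linarith

theorem sphere_subset_annulus {ρ : ℝ} (hρ : 1 < ρ) : Metric.sphere (0 : ℂ) 1 ⊆ annulus ρ := by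
  have h1 : ρ⁻¹ < 1 := inv_lt_one_of_one_lt₀ hρ
  intro z hz
  rw [mem_sphere_zero_iff_norm] at hz
  constructor <;> linarith

theorem isCompact_twoCircles (ρ : ℝ) : IsCompact (twoCircles ρ) :=
  (isCompact_sphere 0 ρ).union (isCompact_sphere 0 ρ⁻¹)

/-- A function continuous on a compact set carrying a finite measure is integrable. -/
theorem integrable_of_continuousOn {X : Type*} [TopologicalSpace X] [T2Space X]
    [MeasurableSpace X] [BorelSpace X] {μ : Measure X} [IsFiniteMeasure μ]
    {K : Set X} (hK : IsCompact K) (hμ : μ Kᶜ = 0) {f : X → ℂ} (hf : ContinuousOn f K) :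
    Integrable f μ := by
  have h := hf.integrableOn_compact' (μ := μ) hK hK.measurableSet
  rwa [IntegrableOn, Measure.restrict_eq_self_of_ae_mem (show ∀ᵐ x ∂μ, x ∈ K from hμ)] at h

theorem ae_mem_pi {k : ℕ} {μ : Fin k → Measure ℂ} [∀ i, IsProbabilityMeasure (μ i)] {K : Set ℂ}
    (h : ∀ i, μ i Kᶜ = 0) : ∀ᵐ x ∂Measure.pi μ, ∀ i, x i ∈ K := by
  rw [eventually_countable_forall]
  intro i
  exact (Measure.quasiMeasurePreserving_eval μ i).ae (show ∀ᵐ z ∂μ i, z ∈ K from h i)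

theorem integrable_pi_of_continuousOn {k : ℕ} {μ : Fin k → Measure ℂ}
    [∀ i, IsProbabilityMeasure (μ i)] {K : Set ℂ} (hK : IsCompact K) (h : ∀ i, μ i Kᶜ = 0)
    {f : (Fin k → ℂ) → ℂ} (hf : ContinuousOn f {x | ∀ i, x i ∈ K}) :
    Integrable f (Measure.pi μ) := by
  have hc : IsCompact {x : Fin k → ℂ | ∀ i, x i ∈ K} := by
    have := isCompact_univ_pi (fun _ : Fin k => hK)
    convert this using 1
    ext x; simp
  exact integrable_of_continuousOn hc (ae_mem_pi h) hf

theorem integral_twoCircleMeasure {ρ : ℝ} (hρ : 0 < ρ) {f : ℂ → ℂ}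
    (hf : ContinuousOn f (twoCircles ρ)) :
    ∫ z, f z ∂twoCircleMeasure ρ =
      (∫ z, f z ∂circleMeasure ρ + ∫ z, f z ∂circleMeasure ρ⁻¹) / 2 := by
  have h1 : Integrable f (circleMeasure ρ) := by
    refine integrable_of_continuousOn (isCompact_sphere 0 ρ) ?_
      (hf.mono Set.subset_union_left)
    simpa [abs_of_pos hρ] using circleMeasure_compl_sphere ρ
  have h2 : Integrable f (circleMeasure ρ⁻¹) := by
    refine integrable_of_continuousOn (isCompact_sphere 0 ρ⁻¹) ?_
      (hf.mono Set.subset_union_right)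
    simpa [abs_of_pos hρ] using circleMeasure_compl_sphere ρ⁻¹
  rw [twoCircleMeasure, integral_smul_measure, integral_add_measure h1 h2]
  simp [Complex.real_smul, div_eq_inv_mul, mul_add]

/-- For a function holomorphic on an annulus, the average over the unit circle equals the average
against the two-circle measure. -/
theorem integral_circleMeasure_one_eq {ρ : ℝ} (hρ : 1 < ρ) {f : ℂ → ℂ}
    (hf : ∀ z ∈ annulus ρ, DifferentiableAt ℂ f z) :
    ∫ z, f z ∂circleMeasure 1 = ∫ z, f z ∂twoCircleMeasure ρ := by
  have h0 : 0 < ρ := one_pos.trans hρ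
  have h1 : ρ⁻¹ < 1 := inv_lt_one_of_one_lt₀ hρ
  have hi : 0 < ρ⁻¹ := inv_pos.2 h0
  have key : ∀ a b : ℝ, 0 < a → a ≤ b → ρ⁻¹ ≤ a → b ≤ ρ →
      ∫ z, f z ∂circleMeasure b = ∫ z, f z ∂circleMeasure a := by
    intro a b ha hab h3 h4
    have hA : ∀ z : ℂ, a ≤ ‖z‖ → ‖z‖ ≤ b → DifferentiableAt ℂ f z :=
      fun z h5 h6 => hf z ⟨h3.trans h5, h6.trans h4⟩
    rw [integral_circleMeasure ha, integral_circleMeasure (ha.trans_le hab)]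
    · congr 1
      refine Complex.circleIntegral_sub_center_inv_smul_eq_of_differentiable_on_annulus_off_countable
        ha hab Set.countable_empty ?_ ?_
      · rintro z ⟨hz1, hz2⟩
        rw [mem_closedBall_zero_iff] at hz1
        rw [mem_ball_zero_iff, not_lt] at hz2
        exact (hA z hz2 hz1).continuousAt.continuousWithinAt
      · rintro z ⟨⟨hz1, hz2⟩, -⟩
        rw [mem_ball_zero_iff] at hz1
        rw [mem_closedBall_zero_iff, not_le] at hz2
        exact hA z hz2.le hz1.le
    · intro z hz
      rw [mem_sphere_zero_iff_norm] at hz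
      exact (hA z (by linarith) (by linarith)).continuousAt.continuousWithinAt
    · intro z hz
      rw [mem_sphere_zero_iff_norm] at hz
      exact (hA z (by linarith) (by linarith)).continuousAt.continuousWithinAt
  rw [integral_twoCircleMeasure h0
      fun z hz => (hf z (twoCircles_subset_annulus hρ hz)).continuousAt.continuousWithinAt,
    key 1 ρ one_pos hρ.le h1.le le_rfl, key ρ⁻¹ 1 hi h1.le le_rfl hρ.le]
  ring

/-- The residue computation behind the whole argument: only the simple poles at `±1` contribute,
each with half of its residue. -/
theorem integral_twoCircleMeasure_div {ρ R : ℝ} (hρ : 1 < ρ) (hR : ρ < R) {h : ℂ → ℂ}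
    (hh : DifferentiableOn ℂ h (Metric.ball 0 R)) (h0 : h 0 = 0) :
    ∫ z, h z / (1 - z ^ 2) ∂twoCircleMeasure ρ = -(h 1 + h (-1)) / 4 := by
  have hρ0 : 0 < ρ := one_pos.trans hρ
  have h1 : ρ⁻¹ < 1 := inv_lt_one_of_one_lt₀ hρ
  have hi : 0 < ρ⁻¹ := inv_pos.2 hρ0
  have hne : ∀ z : ℂ, ‖z‖ ≠ 1 → 1 - z ^ 2 ≠ 0 := by
    intro z hz h2
    apply hz
    have h3 : z ^ 2 = 1 := by linear_combination -h2
    have h4 : ‖z‖ ^ 2 = 1 := by rw [← norm_pow, h3, norm_one]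
    exact (pow_eq_one_iff_of_nonneg (norm_nonneg z) two_ne_zero).1 h4
  have hd : ∀ z : ℂ, ‖z‖ < R → ‖z‖ ≠ 1 → DifferentiableAt ℂ (fun z => h z / (1 - z ^ 2)) z := by
    intro z hz hz1
    exact (hh.differentiableAt (Metric.isOpen_ball.mem_nhds (by simpa using hz))).div
      (by fun_prop) (hne z hz1)
  have hc : ∀ a : ℝ, 0 < a → a < R → a ≠ 1 →
      ContinuousOn (fun z => h z / (1 - z ^ 2)) (Metric.sphere 0 a) := by
    intro a ha haR ha1 z hz
    rw [mem_sphere_zero_iff_norm] at hz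
    exact (hd z (by linarith) (by rwa [hz])).continuousAt.continuousWithinAt
  have hsmall : ∫ z, h z / (1 - z ^ 2) ∂circleMeasure ρ⁻¹ = 0 := by
    rw [integral_circleMeasure hi (hc _ hi (by linarith) h1.ne)]
    have hD : DifferentiableOn ℂ (fun z => h z / (1 - z ^ 2)) (Metric.closedBall 0 ρ⁻¹) := by
      intro z hz
      rw [mem_closedBall_zero_iff] at hz
      exact (hd z (by linarith) (by linarith)).differentiableWithinAt
    rw [hD.circleIntegral_sub_inv_smul (by simpa using hρ0)]
    simp [h0]
  have hbig : ∫ z, h z / (1 - z ^ 2) ∂circleMeasure ρ = -(h 1 + h (-1)) / 2 := by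
    rw [integral_circleMeasure hρ0 (hc _ hρ0 hR hρ.ne')]
    have hD : DifferentiableOn ℂ h (Metric.closedBall 0 ρ) :=
      hh.mono (Metric.closedBall_subset_ball hR)
    have hw : ∀ w : ℂ, ‖w‖ ≤ 1 → ∮ z in C(0, ρ), (z - w)⁻¹ • h z =
        (2 * ↑Real.pi * Complex.I) • h w := fun w hw =>
      hD.circleIntegral_sub_inv_smul (by simpa using hw.trans_lt hρ)
    have hci : ∀ w : ℂ, ‖w‖ ≤ 1 → CircleIntegrable (fun z => (z - w)⁻¹ • h z) 0 ρ := by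
      intro w hw
      refine ContinuousOn.circleIntegrable hρ0.le ?_
      refine ContinuousOn.smul (ContinuousOn.inv₀ (f := fun z : ℂ => z - w) (by fun_prop) ?_)
        (hD.continuousOn.mono Metric.sphere_subset_closedBall)
      intro z hz h2
      rw [mem_sphere_zero_iff_norm] at hz
      rw [sub_eq_zero] at h2
      rw [← h2, hz] at hw
      linarith
    have hsplit : ∮ z in C(0, ρ), (z - 0)⁻¹ • (h z / (1 - z ^ 2)) =
        ∮ z in C(0, ρ), ((z - 0)⁻¹ • h z - ((1 / 2 : ℂ) • (z - 1)⁻¹ • h z +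
          (1 / 2 : ℂ) • (z - (-1))⁻¹ • h z)) := by
      refine circleIntegral.integral_congr hρ0.le fun z hz => ?_
      rw [mem_sphere_zero_iff_norm] at hz
      have hz0 : z ≠ 0 := by
        rintro rfl
        simp at hz
        linarith
      have hz2 := hne z (by rw [hz]; exact hρ.ne')
      have hz3 : z - 1 ≠ 0 := fun h3 => hz2 (by linear_combination (-(z + 1)) * h3)
      have hz4 : z - (-1) ≠ 0 := fun h3 => hz2 (by linear_combination (-(z - 1)) * h3)
      have hz5 : 1 - z ^ 2 = -((z - 1) * (z - (-1))) := by ring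
      rw [hz5]
      simp only [smul_eq_mul, sub_zero]
      field_simp
      ring
    have c0 := hci 0 (by simp)
    have c1 : CircleIntegrable (fun z => (1 / 2 : ℂ) • (z - 1)⁻¹ • h z) 0 ρ :=
      (hci 1 (by simp)).const_fun_smul
    have c2 : CircleIntegrable (fun z => (1 / 2 : ℂ) • (z - (-1))⁻¹ • h z) 0 ρ :=
      (hci (-1) (by simp)).const_fun_smul
    have c12 : CircleIntegrable (fun z => (1 / 2 : ℂ) • (z - 1)⁻¹ • h z +
      (1 / 2 : ℂ) • (z - (-1))⁻¹ • h z) 0 ρ := c1.add c2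
    rw [hsplit, circleIntegral.integral_sub c0 c12, circleIntegral.integral_add c1 c2,
      circleIntegral.integral_smul, circleIntegral.integral_smul, hw 0 (by simp), hw 1 (by simp),
      hw (-1) (by simp), h0]
    have hpi : (Real.pi : ℂ) ≠ 0 := by exact_mod_cast Real.pi_ne_zero
    simp only [smul_eq_mul]
    field_simp
    ring
  rw [integral_twoCircleMeasure hρ0, hsmall, hbig]
  · ring
  · exact (hc _ hρ0 hR hρ.ne').union_of_isClosed (hc _ hi (by linarith) h1.ne)
      Metric.isClosed_sphere Metric.isClosed_sphere

/-! ### Deformation of the torus -/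

theorem forall_insertNth_mem {k : ℕ} {K : Set ℂ} (i : Fin (k + 1)) {a : ℂ} {y : Fin k → ℂ}
    (ha : a ∈ K) (hy : ∀ j, y j ∈ K) (j : Fin (k + 1)) :
    (i.insertNth a y : Fin (k + 1) → ℂ) j ∈ K := by
  refine Fin.succAboveCases i ?_ (fun j => ?_) j
  · simpa using ha
  · simpa using hy j

theorem continuousOn_comp_insertNth {k : ℕ} {K : Set ℂ} {f : (Fin (k + 1) → ℂ) → ℂ}
    (hf : ContinuousOn f {x | ∀ i, x i ∈ K}) (i : Fin (k + 1)) :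
    ContinuousOn (fun z : ℂ × (Fin k → ℂ) => f (i.insertNth z.1 z.2))
      (K ×ˢ {y | ∀ j, y j ∈ K}) := by
  refine hf.comp (Continuous.continuousOn ?_) fun z hz => forall_insertNth_mem i hz.1 hz.2
  exact Continuous.finInsertNth i continuous_fst continuous_snd

theorem integrable_comp_insertNth {k : ℕ} {K : Set ℂ} (hK : IsCompact K)
    {μ : Measure ℂ} [IsProbabilityMeasure μ] (hμ : μ Kᶜ = 0)
    {ν : Measure ℂ} [IsProbabilityMeasure ν] (hν : ν Kᶜ = 0) {f : (Fin (k + 1) → ℂ) → ℂ}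
    (hf : ContinuousOn f {x | ∀ i, x i ∈ K}) (i : Fin (k + 1)) :
    Integrable (fun z : ℂ × (Fin k → ℂ) => f (i.insertNth z.1 z.2))
      (μ.prod (Measure.pi fun _ => ν)) := by
  have hc : IsCompact {y : Fin k → ℂ | ∀ j, y j ∈ K} := by
    have := isCompact_univ_pi (fun _ : Fin k => hK)
    convert this using 1
    ext x; simp
  refine integrable_of_continuousOn (hK.prod hc) ?_ (continuousOn_comp_insertNth hf i)
  have h1 : ∀ᵐ z ∂μ.prod (Measure.pi fun _ : Fin k => ν), z.1 ∈ K :=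
    Measure.quasiMeasurePreserving_fst.ae (show ∀ᵐ z ∂μ, z ∈ K from hμ)
  have h2 : ∀ᵐ z ∂μ.prod (Measure.pi fun _ : Fin k => ν), ∀ j, z.2 j ∈ K :=
    Measure.quasiMeasurePreserving_snd.ae (ae_mem_pi (μ := fun _ : Fin k => ν) fun _ => hν)
  exact (h1.and h2 : ∀ᵐ z ∂μ.prod (Measure.pi fun _ : Fin k => ν), z.1 ∈ K ∧ ∀ j, z.2 j ∈ K)

theorem integral_pi_eq_integral_insertNth {k : ℕ} {μ : Measure ℂ} [IsProbabilityMeasure μ]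
    (f : (Fin (k + 1) → ℂ) → ℂ) (i : Fin (k + 1)) :
    ∫ x, f x ∂(Measure.pi fun _ => μ) =
      ∫ z, f (i.insertNth z.1 z.2) ∂(μ.prod (Measure.pi fun _ : Fin k => μ)) := by
  have h := (measurePreserving_piFinSuccAbove (fun _ : Fin (k + 1) => μ) i).symm
  exact (h.integral_comp (MeasurableEquiv.measurableEmbedding _) f).symm

theorem isCompact_annulus (ρ : ℝ) : IsCompact (annulus ρ) := by
  refine Metric.isCompact_of_isClosed_isBounded ?_ ?_
  · exact (isClosed_le continuous_const continuous_norm).inter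
      (isClosed_le continuous_norm continuous_const)
  · exact (Metric.isBounded_closedBall (x := (0 : ℂ)) (r := ρ)).subset fun z hz => by
      simpa using hz.2

theorem circleMeasure_compl_annulus {ρ : ℝ} (hρ : 1 < ρ) : circleMeasure 1 (annulus ρ)ᶜ = 0 := by
  refine measure_mono_null (Set.compl_subset_compl.2 (sphere_subset_annulus hρ)) ?_
  simpa using circleMeasure_compl_sphere 1

theorem twoCircleMeasure_compl_annulus {ρ : ℝ} (hρ : 1 < ρ) :
    twoCircleMeasure ρ (annulus ρ)ᶜ = 0 :=
  measure_mono_null (Set.compl_subset_compl.2 (twoCircles_subset_annulus hρ))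
    (twoCircleMeasure_compl (one_pos.trans hρ))

/-- Deformation of the torus, one variable at a time, to the two circles of radii `ρ^{±1}`. -/
theorem integral_pi_circleMeasure_one_eq {ρ : ℝ} (hρ : 1 < ρ) {k : ℕ} {f : (Fin k → ℂ) → ℂ}
    (hf : ∀ x : Fin k → ℂ, (∀ i, x i ∈ annulus ρ) → DifferentiableAt ℂ f x) :
    ∫ x, f x ∂(Measure.pi fun _ => circleMeasure 1) =
      ∫ x, f x ∂(Measure.pi fun _ => twoCircleMeasure ρ) := by
  induction k with
  | zero => rw [Measure.pi_of_empty, Measure.pi_of_empty]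
  | succ k ih =>
    have hc : ContinuousOn f {x | ∀ i, x i ∈ annulus ρ} := fun x hx =>
      (hf x hx).continuousAt.continuousWithinAt
    have hK := isCompact_annulus ρ
    have hμ := circleMeasure_compl_annulus hρ
    have hν := twoCircleMeasure_compl_annulus hρ
    rw [integral_pi_eq_integral_insertNth f 0, integral_pi_eq_integral_insertNth f 0,
      integral_prod_symm _ (integrable_comp_insertNth hK hμ hμ hc 0),
      integral_prod _ (integrable_comp_insertNth hK hν hν hc 0)]
    have h1 : ∀ᵐ y ∂(Measure.pi fun _ : Fin k => circleMeasure 1),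
        ∫ a, f ((0 : Fin (k + 1)).insertNth a y) ∂circleMeasure 1 =
        ∫ a, f ((0 : Fin (k + 1)).insertNth a y) ∂twoCircleMeasure ρ := by
      filter_upwards [ae_mem_pi (μ := fun _ : Fin k => circleMeasure 1) fun _ => hμ] with y hy
      refine integral_circleMeasure_one_eq hρ fun a ha => ?_
      refine (hf _ (forall_insertNth_mem 0 ha hy)).comp a ?_
      rw [differentiableAt_pi]
      intro j
      refine Fin.succAboveCases 0 ?_ (fun j => ?_) j <;> simp
    rw [integral_congr_ae h1,
      ← integral_prod_symm _ (integrable_comp_insertNth hK hν hμ hc 0),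
      integral_prod _ (integrable_comp_insertNth hK hν hμ hc 0)]
    have h2 : ∀ᵐ a ∂twoCircleMeasure ρ, a ∈ annulus ρ := hν
    refine integral_congr_ae ?_
    filter_upwards [h2] with a ha
    refine ih fun y hy => ?_
    refine (hf _ (forall_insertNth_mem 0 ha hy)).comp y ?_
    rw [differentiableAt_pi]
    intro j
    refine Fin.succAboveCases 0 ?_ (fun j => ?_) j
    · simp
    · simp only [Fin.insertNth_apply_succAbove]
      fun_prop

/-! ### Iterated residues -/

/-- The factor left by a pair of letters `x⁻¹`, `y`, the second preceding the first, after
multiplication by the density. -/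
noncomputable def crossFactor (t x y : ℂ) : ℂ := (t - x * y) / (1 - t * (x * y))

theorem one_sub_mul_ne_zero {t z : ℂ} (h : ‖t‖ * ‖z‖ < 1) : 1 - t * z ≠ 0 := by
  intro h0
  have h1 : t * z = 1 := by linear_combination -h0
  rw [← norm_mul, h1, norm_one] at h
  exact lt_irrefl _ h

theorem crossFactor_den_ne_zero {R : ℝ} {t x y : ℂ} (ht : ‖t‖ * R ^ 2 < 1) (hx : ‖x‖ < R)
    (hy : ‖y‖ < R) : 1 - t * (x * y) ≠ 0 := by
  refine one_sub_mul_ne_zero (lt_of_le_of_lt ?_ ht)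
  rw [norm_mul, sq]
  have hR := (norm_nonneg x).trans hx.le
  gcongr

theorem units_int_cast_cases (u : ℤˣ) : ((u : ℤ) : ℂ) = 1 ∨ ((u : ℤ) : ℂ) = -1 := by
  rcases Int.units_eq_one_or u with rfl | rfl <;> simp

theorem norm_units_int_cast (u : ℤˣ) : ‖((u : ℤ) : ℂ)‖ = 1 := by
  rcases units_int_cast_cases u with h | h <;> simp [h]

/-- A pair `y, y⁻¹` enclosed by a pair specialized to `±1` drops out. -/
theorem crossFactor_mul_crossFactor_inv {t y : ℂ} (u : ℤˣ) (hy : y ≠ 0)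
    (h1 : 1 - t * ((u : ℤ) * y) ≠ 0) (h2 : 1 - t * ((u : ℤ) * y⁻¹) ≠ 0) :
    crossFactor t (u : ℤ) y * crossFactor t (u : ℤ) y⁻¹ = 1 := by
  rw [crossFactor, crossFactor, div_mul_div_comm, div_eq_one_iff_eq (mul_ne_zero h1 h2)]
  rcases units_int_cast_cases u with h | h <;> rw [h] <;> field_simp <;> ring

theorem crossFactor_units {t : ℂ} (ht : ‖t‖ < 1) (u v : ℤˣ) :
    crossFactor t (u : ℤ) (v : ℤ) = -((u : ℤ) * (v : ℤ)) := by
  have h := one_sub_mul_ne_zero (t := t) (z := (u : ℤ) * (v : ℤ))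
    (by rw [norm_mul, norm_units_int_cast, norm_units_int_cast]; linarith)
  rw [crossFactor, div_eq_iff h]
  rcases units_int_cast_cases u with h1 | h1 <;> rcases units_int_cast_cases v with h2 | h2 <;>
    rw [h1, h2] <;> ring

/-- The interaction of the variables `x` and `y`, given that the first letter `x` is the leftmost
of `x, x⁻¹, y, y⁻¹`: here `a, b` record whether `y`, respectively `y⁻¹`, stands to the left of
`x⁻¹`. -/
noncomputable def interaction (t : ℂ) (a b : Prop) [Decidable a] [Decidable b] (x y : ℂ) : ℂ :=
  (if a then crossFactor t x y else 1) * (if b then crossFactor t x y⁻¹ else 1)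

/-- The product form of a single term of the integrand: variable `i` has its letters `x_i`,
`x_i⁻¹` at the positions `p i < q i`. -/
noncomputable def residueIntegrand {k : ℕ} (t : ℂ) (p q : Fin k → ℕ) (g : Fin k → ℂ → ℂ)
    (x : Fin k → ℂ) : ℂ :=
  (∏ i, g i (x i) / (1 - x i ^ 2)) *
    ∏ i, ∏ j, if p i < p j then interaction t (p j < q i) (q j < q i) (x i) (x j) else 1

theorem norm_lt_of_mem_twoCircles {ρ R : ℝ} (hρ : 1 < ρ) (hR : ρ < R) {z : ℂ}
    (hz : z ∈ twoCircles ρ) : ‖z‖ < R := (twoCircles_subset_annulus hρ hz).2.trans_lt hR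

theorem inv_mem_twoCircles {ρ : ℝ} {z : ℂ} (hz : z ∈ twoCircles ρ) : z⁻¹ ∈ twoCircles ρ := by
  rcases hz with hz | hz <;> rw [mem_sphere_zero_iff_norm] at hz
  · right; rw [mem_sphere_zero_iff_norm, norm_inv, hz]
  · left; rw [mem_sphere_zero_iff_norm, norm_inv, hz, inv_inv]

theorem ne_zero_of_mem_annulus {ρ : ℝ} (hρ : 1 < ρ) {z : ℂ} (hz : z ∈ annulus ρ) :
    z ≠ 0 := by
  rintro rfl
  have h1 := hz.1
  have h2 : 0 < ρ⁻¹ := inv_pos.2 (one_pos.trans hρ)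
  rw [norm_zero] at h1
  linarith

theorem ne_zero_of_mem_twoCircles {ρ : ℝ} (hρ : 1 < ρ) {z : ℂ} (hz : z ∈ twoCircles ρ) :
    z ≠ 0 := ne_zero_of_mem_annulus hρ (twoCircles_subset_annulus hρ hz)

theorem one_sub_sq_ne_zero_of_mem_twoCircles {ρ : ℝ} (hρ : 1 < ρ) {z : ℂ}
    (hz : z ∈ twoCircles ρ) : 1 - z ^ 2 ≠ 0 := by
  intro h2
  have h3 : z ^ 2 = 1 := by linear_combination -h2
  have h4 : ‖z‖ ^ 2 = 1 := by rw [← norm_pow, h3, norm_one]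
  have h5 := (pow_eq_one_iff_of_nonneg (norm_nonneg z) two_ne_zero).1 h4
  have h1 : ρ⁻¹ < 1 := inv_lt_one_of_one_lt₀ hρ
  rcases hz with hz | hz <;> rw [mem_sphere_zero_iff_norm] at hz <;> linarith

theorem continuousOn_interaction {k : ℕ} {ρ R : ℝ} (hρ : 1 < ρ) (hR : ρ < R) {t : ℂ}
    (ht : ‖t‖ * R ^ 2 < 1) (a b : Prop) [Decidable a] [Decidable b] (i j : Fin k) :
    ContinuousOn (fun x : Fin k → ℂ => interaction t a b (x i) (x j))
      {x | ∀ i, x i ∈ twoCircles ρ} := by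
  intro x hx
  have h1 := crossFactor_den_ne_zero ht (norm_lt_of_mem_twoCircles hρ hR (hx i))
    (norm_lt_of_mem_twoCircles hρ hR (hx j))
  have h2 := crossFactor_den_ne_zero ht (norm_lt_of_mem_twoCircles hρ hR (hx i))
    (norm_lt_of_mem_twoCircles hρ hR (inv_mem_twoCircles (hx j)))
  have h3 := ne_zero_of_mem_twoCircles hρ (hx j)
  have h4 : ContinuousAt (fun x : Fin k → ℂ => (x j)⁻¹) x :=
    (continuous_apply j).continuousAt.inv₀ h3
  refine ContinuousAt.continuousWithinAt ?_
  have h5 : ContinuousAt (fun x : Fin k → ℂ => crossFactor t (x i) (x j)) x :=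
    ContinuousAt.div (by fun_prop) (by fun_prop) h1
  have h6 : ContinuousAt (fun x : Fin k → ℂ => crossFactor t (x i) (x j)⁻¹) x :=
    ContinuousAt.div (continuousAt_const.sub ((continuous_apply i).continuousAt.mul h4))
      (continuousAt_const.sub
        (continuousAt_const.mul ((continuous_apply i).continuousAt.mul h4))) h2
  unfold interaction
  split_ifs <;> fun_prop

theorem continuousOn_residueIntegrand {k : ℕ} {ρ R : ℝ} (hρ : 1 < ρ) (hR : ρ < R) {t : ℂ}
    (ht : ‖t‖ * R ^ 2 < 1) (p q : Fin k → ℕ) {g : Fin k → ℂ → ℂ}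
    (hg : ∀ i, DifferentiableOn ℂ (g i) (Metric.ball 0 R)) :
    ContinuousOn (residueIntegrand t p q g) {x | ∀ i, x i ∈ twoCircles ρ} := by
  unfold residueIntegrand
  refine ContinuousOn.mul ?_ ?_
  · refine continuousOn_finsetProd _ fun i _ => ?_
    refine ContinuousOn.div ?_ (by fun_prop) fun x hx =>
      one_sub_sq_ne_zero_of_mem_twoCircles hρ (hx i)
    refine (hg i).continuousOn.comp (by fun_prop) fun x hx => ?_
    simpa using norm_lt_of_mem_twoCircles hρ hR (hx i)
  · refine continuousOn_finsetProd _ fun i _ => continuousOn_finsetProd _ fun j _ => ?_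
    split_ifs
    · exact continuousOn_interaction hρ hR ht _ _ i j
    · exact continuousOn_const

/-- Separation of the variable `i` whose first letter is leftmost. -/
theorem residueIntegrand_insertNth {k : ℕ} (t : ℂ) (p q : Fin (k + 1) → ℕ)
    (g : Fin (k + 1) → ℂ → ℂ) (i : Fin (k + 1)) (hi : ∀ j, p i < p (i.succAbove j)) (a : ℂ)
    (y : Fin k → ℂ) :
    residueIntegrand t p q g (i.insertNth a y) =
      (g i a * ∏ j, interaction t (p (i.succAbove j) < q i) (q (i.succAbove j) < q i) a (y j)) /
        (1 - a ^ 2) * residueIntegrand t (p ∘ i.succAbove) (q ∘ i.succAbove)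
          (fun j => g (i.succAbove j)) y := by
  have hi' : ∀ j, ¬ p (i.succAbove j) < p i := fun j => (hi j).not_gt
  simp only [residueIntegrand, Fin.prod_univ_succAbove _ i, Fin.insertNth_apply_same,
    Fin.insertNth_apply_succAbove, lt_irrefl, if_false, hi, hi', if_true, one_mul,
    Function.comp_apply]
  ring

/-- The iterated residue formula. The variable whose first letter is leftmost is integrated out
first: in it the integrand is holomorphic inside the disc, apart from the poles at `±1`, and the
residues there have again the product form. -/
theorem integral_residueIntegrand {ρ R : ℝ} (hρ : 1 < ρ) (hR : ρ < R) {t : ℂ}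
    (ht : ‖t‖ * R ^ 2 < 1) {k : ℕ} (p q : Fin k → ℕ) (hp : Function.Injective p)
    (hpq : ∀ i, p i < q i) (g : Fin k → ℂ → ℂ)
    (hg : ∀ i, DifferentiableOn ℂ (g i) (Metric.ball 0 R)) (hg0 : ∀ i, g i 0 = 0) :
    ∫ x, residueIntegrand t p q g x ∂(Measure.pi fun _ => twoCircleMeasure ρ) =
      (-1 / 4) ^ k * ∑ ε : Fin k → ℤˣ, (∏ i, g i (ε i : ℤ)) *
        ∏ i, ∏ j, if p i < p j ∧ p j < q i ∧ ¬ q j < q i then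
          (-(((ε i : ℤ) : ℂ) * ((ε j : ℤ) : ℂ))) else 1 := by
  have hρ0 : 0 < ρ := one_pos.trans hρ
  have hR1 : 1 < R := hρ.trans hR
  have ht1 : ‖t‖ < 1 := by
    refine lt_of_le_of_lt ?_ ht
    exact le_mul_of_one_le_right (norm_nonneg t) (one_le_pow₀ hR1.le)
  have hν := twoCircleMeasure_compl hρ0
  have hK := isCompact_twoCircles ρ
  induction k with
  | zero =>
    rw [Measure.pi_of_empty]
    simp [residueIntegrand]
  | succ k ih =>
    -- the variable whose first letter is leftmost
    obtain ⟨i, hi⟩ := Finite.exists_min p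
    have hi : ∀ j, p i < p (i.succAbove j) := fun j =>
      lt_of_le_of_ne (hi _) fun h => Fin.succAbove_ne i j (hp h).symm
    have hi' : ∀ j, ¬ p (i.succAbove j) < p i := fun j => (hi j).not_gt
    have hpi : Function.Injective (p ∘ i.succAbove) := hp.comp Fin.succAbove_right_injective
    -- what remains of the interaction with the variable `j` after specializing `x_i` to `u`
    let c : ℤˣ → Fin k → ℂ → ℂ := fun u j z =>
      if p (i.succAbove j) < q i ∧ ¬ q (i.succAbove j) < q i then crossFactor t (u : ℤ) z else 1
    let g' : ℤˣ → Fin k → ℂ → ℂ := fun u j z => g (i.succAbove j) z * c u j z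
    have hden : ∀ (u : ℤˣ) (z : ℂ), ‖z‖ < R → 1 - t * ((u : ℤ) * z) ≠ 0 := fun u z hz =>
      crossFactor_den_ne_zero ht (by rw [norm_units_int_cast]; exact hR1) hz
    have hg' : ∀ u j, DifferentiableOn ℂ (g' u j) (Metric.ball 0 R) := by
      intro u j
      refine (hg _).mul ?_
      intro z hz
      have := hden u z (by simpa using hz)
      refine DifferentiableAt.differentiableWithinAt ?_
      simp only [c]
      unfold crossFactor
      split_ifs <;> fun_prop (disch := assumption)
    have hint : ∀ (u : ℤˣ) (z : ℂ) (j : Fin k), z ∈ twoCircles ρ →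
        interaction t (p (i.succAbove j) < q i) (q (i.succAbove j) < q i) (u : ℤ) z = c u j z := by
      intro u z j hz
      have h1 := hden u z (norm_lt_of_mem_twoCircles hρ hR hz)
      have h2 := hden u z⁻¹ (norm_lt_of_mem_twoCircles hρ hR (inv_mem_twoCircles hz))
      have h3 := ne_zero_of_mem_twoCircles hρ hz
      simp only [interaction, c]
      by_cases hb : q (i.succAbove j) < q i
      · have ha := (hpq (i.succAbove j)).trans hb
        simp only [ha, hb, if_true, not_true, and_false, if_false]
        exact crossFactor_mul_crossFactor_inv u h3 h1 h2
      · simp [hb]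
    have hcont := continuousOn_residueIntegrand hρ hR ht p q hg
    rw [integral_pi_eq_integral_insertNth _ i,
      integral_prod_symm _ (integrable_comp_insertNth hK hν hν hcont i)]
    have hinner : ∀ᵐ y ∂(Measure.pi fun _ : Fin k => twoCircleMeasure ρ),
        ∫ a, residueIntegrand t p q g (i.insertNth a y) ∂twoCircleMeasure ρ =
        ∑ u : ℤˣ, (-1 / 4 * g i (u : ℤ)) *
          residueIntegrand t (p ∘ i.succAbove) (q ∘ i.succAbove) (g' u) y := by
      filter_upwards [ae_mem_pi (μ := fun _ : Fin k => twoCircleMeasure ρ) fun _ => hν] with y hy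
      simp only [residueIntegrand_insertNth t p q g i hi]
      rw [integral_mul_const, integral_twoCircleMeasure_div hρ hR
        (h := fun a => g i a * ∏ j, interaction t (p (i.succAbove j) < q i)
          (q (i.succAbove j) < q i) a (y j)) ?_ (by simp [hg0])]
      · have hu : ∀ u : ℤˣ, residueIntegrand t (p ∘ i.succAbove) (q ∘ i.succAbove) (g' u) y =
            (∏ j, interaction t (p (i.succAbove j) < q i) (q (i.succAbove j) < q i)
              ((u : ℤ) : ℂ) (y j)) * residueIntegrand t (p ∘ i.succAbove) (q ∘ i.succAbove)
              (fun j => g (i.succAbove j)) y := by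
          intro u
          rw [Finset.prod_congr rfl fun j _ => hint u (y j) j (hy j)]
          simp only [residueIntegrand, g', Finset.prod_div_distrib, Finset.prod_mul_distrib]
          ring
        simp only [hu, UnitsInt.univ]
        rw [Finset.sum_pair (by decide)]
        push_cast
        ring
      · have hprod : ∀ j ∈ (univ : Finset (Fin k)), DifferentiableOn ℂ (fun a =>
            interaction t (p (i.succAbove j) < q i) (q (i.succAbove j) < q i) a (y j))
            (Metric.ball 0 R) := by
          intro j _ z hz
          have hz : ‖z‖ < R := by simpa using hz
          have h1 := crossFactor_den_ne_zero ht hz (norm_lt_of_mem_twoCircles hρ hR (hy j))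
          have h2 := crossFactor_den_ne_zero ht hz
            (norm_lt_of_mem_twoCircles hρ hR (inv_mem_twoCircles (hy j)))
          refine DifferentiableAt.differentiableWithinAt ?_
          unfold interaction crossFactor
          split_ifs <;> fun_prop (disch := assumption)
        have hprod' : DifferentiableOn ℂ (fun a => ∏ j, interaction t (p (i.succAbove j) < q i)
            (q (i.succAbove j) < q i) a (y j)) (Metric.ball 0 R) :=
          DifferentiableOn.fun_finsetProd hprod
        exact (hg i).fun_mul hprod'
    rw [integral_congr_ae hinner, integral_finsetSum]
    · simp only [integral_const_mul]
      have hih := fun u => ih (p ∘ i.succAbove) (q ∘ i.succAbove) hpi (fun j => hpq _) (g' u)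
        (hg' u) (fun j => by simp [g', hg0])
      simp only [hih]
      rw [← (Fin.insertNthEquiv (fun _ : Fin (k + 1) => ℤˣ) i).sum_comp, Fintype.sum_prod_type,
        Finset.mul_sum]
      refine Finset.sum_congr rfl fun u _ => ?_
      rw [Finset.mul_sum, Finset.mul_sum, Finset.mul_sum]
      refine Finset.sum_congr rfl fun ε _ => ?_
      simp only [Fin.insertNthEquiv_apply, Fin.prod_univ_succAbove _ i, Fin.insertNth_apply_same,
        Fin.insertNth_apply_succAbove, lt_irrefl, false_and, if_false, hi, hi', true_and, one_mul,
        Function.comp_apply, g', Finset.prod_mul_distrib, c, crossFactor_units ht1]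
      ring
    · intro u _
      exact (integrable_pi_of_continuousOn hK (fun _ => hν)
        (continuousOn_residueIntegrand hρ hR ht _ _ (hg' u))).const_mul _

/-! ### The signed number of arrangements -/

/-- The `2(m + 1)` letters: `(i.succ, false)` and `(i.succ, true)` stand for `x_i` and `x_i⁻¹`,
while `(0, false)` and `(0, true)` stand for `1` and `-1`. -/
abbrev Letter (m : ℕ) := Fin (m + 1) × Bool

/-- The sign of a letter when every variable `x_i` is specialized to the sign `ε i`. -/
def letterColor {m : ℕ} (ε : Fin m → ℤˣ) (l : Letter m) : ℤˣ :=
  Fin.cases (if l.2 then -1 else 1) (fun i => ε i) l.1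

@[simp]
theorem letterColor_zero {m : ℕ} (ε : Fin m → ℤˣ) (b : Bool) :
    letterColor ε (0, b) = if b then -1 else 1 := rfl

@[simp]
theorem letterColor_succ {m : ℕ} (ε : Fin m → ℤˣ) (i : Fin m) (b : Bool) :
    letterColor ε (i.succ, b) = ε i := rfl

/-- For letters at the positions `v` coloured by `y`, the product of `-1` over the pairs of letters
of equal colour and different index that are out of order. As the pairs `(k, false)`, `(k, true)`
with `k ≠ 0` are monochromatic, this is `-1` to the number of crossings of equally coloured
pairs, up to the orientations of the pairs. -/
def crossSign {m N : ℕ} (v : Letter m → Fin N) (y : Letter m → ℤˣ) : ℤ :=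
  ∏ l, ∏ l', if l.1 < l'.1 ∧ y l = y l' ∧ v l' < v l then -1 else 1

theorem prod_prod_ite_pair_eq {α : Type*} [Fintype α] [DecidableEq α] (a b : α) :
    ∏ l : α, ∏ l' : α, (if l = a ∧ l' = b then (-1 : ℤ) else 1) = -1 := by
  rw [Finset.prod_eq_single a, Finset.prod_eq_single b]
  · simp
  · intro c _ hc; simp [hc]
  · simp
  · intro c _ hc; simp [hc]
  · simp

/-- Interchanging two letters of equal colour and different index, between whose positions no
letter of that colour stands, reverses the sign. -/
theorem crossSign_swap {m N : ℕ} (v : Letter m → Fin N) (hv : Function.Injective v)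
    (y : Letter m → ℤˣ) (a b : Letter m) (hab : a.1 ≠ b.1) (hy : y a = y b)
    (hadj : ∀ l, y l = y a → l ≠ a → l ≠ b → (v l < v a ↔ v l < v b)) :
    crossSign (v ∘ Equiv.swap a b) y = -crossSign v y := by
  wlog h : a.1 < b.1 generalizing a b
  · rw [Equiv.swap_comm]
    exact this b a hab.symm hy.symm
      (fun l h1 h2 h3 => (hadj l (h1.trans hy.symm) h3 h2).symm)
      (lt_of_le_of_ne (not_lt.1 h) hab.symm)
  have hne : a ≠ b := fun h => hab (congrArg Prod.fst h)
  have key : ∀ l l' : Letter m,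
      (if l.1 < l'.1 ∧ y l = y l' ∧ (v ∘ Equiv.swap a b) l' < (v ∘ Equiv.swap a b) l
        then (-1 : ℤ) else 1) =
      (if l.1 < l'.1 ∧ y l = y l' ∧ v l' < v l then -1 else 1) *
        (if l = a ∧ l' = b then -1 else 1) := by
    intro l l'
    have hadj' : ∀ l, y l = y a → l ≠ a → l ≠ b → (v a < v l ↔ v b < v l) := by
      intro l h1 h2 h3
      have h4 := hadj l h1 h2 h3
      have h5 : v l ≠ v a := hv.ne h2
      have h6 : v l ≠ v b := hv.ne h3
      constructor
      · intro h7
        exact lt_of_le_of_ne (not_lt.1 fun h8 => (h4.2 h8).not_gt h7) h6.symm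
      · intro h7
        exact lt_of_le_of_ne (not_lt.1 fun h8 => (h4.1 h8).not_gt h7) h5.symm
    have hvab : v a ≠ v b := hv.ne hne
    simp only [Function.comp_apply]
    by_cases hl : l.1 < l'.1
    swap
    · have : ¬(l = a ∧ l' = b) := by rintro ⟨rfl, rfl⟩; exact hl h
      simp [hl, this]
    by_cases hyl : y l = y l'
    swap
    · have : ¬(l = a ∧ l' = b) := by rintro ⟨rfl, rfl⟩; exact hyl hy
      simp [hyl, this]
    simp only [hl, hyl, true_and]
    by_cases h1 : l = a
    · subst h1
      by_cases h2 : l' = b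
      · subst h2
        simp only [Equiv.swap_apply_left, Equiv.swap_apply_right, and_self, if_true]
        rcases lt_or_gt_of_ne hvab with h3 | h3 <;> simp [h3, h3.not_gt]
      · have h3 : l' ≠ l := fun h4 => hl.ne (congrArg Prod.fst h4.symm)
        rw [Equiv.swap_apply_left, Equiv.swap_apply_of_ne_of_ne h3 h2]
        simp [h2, hadj l' hyl.symm h3 h2]
    · by_cases h2 : l = b
      · subst h2
        by_cases h3 : l' = a
        · subst h3
          exact absurd hl h.not_gt
        · have h4 : l' ≠ l := fun h4 => hl.ne (congrArg Prod.fst h4.symm)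
          rw [Equiv.swap_apply_right, Equiv.swap_apply_of_ne_of_ne h3 h4]
          simp [h1, hadj l' (hyl.symm.trans hy.symm) h3 h4]
      · rw [Equiv.swap_apply_of_ne_of_ne h1 h2]
        by_cases h3 : l' = a
        · subst h3
          rw [Equiv.swap_apply_left]
          simp [h1, hadj' l hyl h1 h2]
        · by_cases h4 : l' = b
          · subst h4
            rw [Equiv.swap_apply_right]
            simp [h1, hadj' l (hyl.trans hy.symm) h1 h2]
          · rw [Equiv.swap_apply_of_ne_of_ne h3 h4]
            simp [h1]
  simp only [crossSign, key, Finset.prod_mul_distrib, prod_prod_ite_pair_eq]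
  ring

/-- The colours at the positions `v` come from a specialization of the variables to signs. -/
def IsColoring {m N : ℕ} (κ : Fin N → ℤˣ) (v : Letter m → Fin N) : Prop :=
  (∀ i : Fin m, κ (v (i.succ, false)) = κ (v (i.succ, true))) ∧
    κ (v (0, false)) = 1 ∧ κ (v (0, true)) = -1

instance {m N : ℕ} (κ : Fin N → ℤˣ) (v : Letter m → Fin N) : Decidable (IsColoring κ v) := by
  unfold IsColoring; infer_instance

theorem IsColoring.eq_of_eq {m N : ℕ} {κ : Fin N → ℤˣ} {v : Letter m → Fin N}
    (h : IsColoring κ v) (i : Fin m) (b c : Bool) : κ (v (i.succ, b)) = κ (v (i.succ, c)) := by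
  have := h.1 i
  cases b <;> cases c <;> simp [this]

/-- The specializations that induce the colouring `κ`: there is at most one, and it exists
exactly when `κ` is a colouring for `v`. -/
theorem isColoring_iff {m N : ℕ} (κ : Fin N → ℤˣ) (v : Letter m → Fin N) (ε : Fin m → ℤˣ) :
    letterColor ε = κ ∘ v ↔ IsColoring κ v ∧ ε = fun i => κ (v (i.succ, false)) := by
  constructor
  · intro h
    have h' := fun l => congrFun h l
    simp only [Function.comp_apply] at h'
    refine ⟨⟨fun i => ?_, ?_, ?_⟩, ?_⟩
    · rw [← h', ← h']; rfl
    · rw [← h']; rfl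
    · rw [← h']; rfl
    · funext i
      rw [← h']; rfl
  · rintro ⟨h, rfl⟩
    funext ⟨k, b⟩
    refine Fin.cases ?_ (fun i => ?_) k
    · cases b <;> simp [h.2.1, h.2.2]
    · exact h.eq_of_eq i _ _

/-- The permutations of the letters that fix `±1` and permute the pairs `{x_i, x_i⁻¹}`. -/
def pairPerms (m : ℕ) : Finset (Equiv.Perm (Letter m)) :=
  {g | (∀ b, g (0, b) = (0, b)) ∧
    ∀ i : Fin m, (g.symm (i.succ, false)).1 = (g.symm (i.succ, true)).1}

theorem pairPerms_card_pos (m : ℕ) : 0 < #(pairPerms m) :=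
  Finset.card_pos.2 ⟨1, by
    simp only [pairPerms, mem_filter, mem_univ, true_and]
    exact ⟨fun _ => rfl, fun _ => rfl⟩⟩

/-- If every pair of neighbouring positions carries the two letters of one pair, in either order,
then the partner of a letter stands at the partner of its position. -/
theorem apply_not_of_apply {m : ℕ} {g : Equiv.Perm (Letter m)}
    (hg : ∀ i : Fin m, (g.symm (i.succ, false)).1 = (g.symm (i.succ, true)).1)
    {k : Fin (m + 1)} {b c : Bool} {i : Fin m} (h : g (k, b) = (i.succ, c)) :
    g (k, !b) = (i.succ, !c) := by
  have h1 : g.symm (i.succ, c) = (k, b) := by rw [← h, Equiv.symm_apply_apply]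
  have h2 : (g.symm (i.succ, !c)).1 = k := by
    have := hg i
    cases c <;> simp_all
  have h3 : (g.symm (i.succ, !c)).2 = !b := by
    by_contra h4
    have h5 : (g.symm (i.succ, !c)).2 = b := by
      revert h4; cases (g.symm (i.succ, !c)).2 <;> cases b <;> simp
    have h6 : g.symm (i.succ, !c) = g.symm (i.succ, c) := by
      rw [h1]; exact Prod.ext h2 h5
    have := g.symm.injective h6
    cases c <;> simp at this
  rw [← Equiv.apply_symm_apply g (i.succ, !c)]
  exact congrArg g (Prod.ext h2 h3).symm

/-- An arrangement `u` of the letters such that the two letters of each pair `{x_i, x_i⁻¹}` are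
neighbours among the positions of their colour. -/
structure IsAdapted {m N : ℕ} (κ : Fin N → ℤˣ) (u : Letter m ≃ Fin N) : Prop where
  isColoring : IsColoring κ u
  adjacent : ∀ (i : Fin m) (p : Fin N), κ p = κ (u (i.succ, false)) → p ≠ u (i.succ, false) →
    p ≠ u (i.succ, true) → (p < u (i.succ, false) ↔ p < u (i.succ, true))

theorem IsAdapted.adjacent' {m N : ℕ} {κ : Fin N → ℤˣ} {u : Letter m ≃ Fin N}
    (h : IsAdapted κ u) (i : Fin m) (b c : Bool) (p : Fin N) (hp : κ p = κ (u (i.succ, false)))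
    (h0 : p ≠ u (i.succ, false)) (h1 : p ≠ u (i.succ, true)) :
    (u (i.succ, b) < p ↔ u (i.succ, c) < p) := by
  have h2 := h.adjacent i p hp h0 h1
  have : u (i.succ, false) < p ↔ u (i.succ, true) < p := by
    rw [← not_le, ← not_le, le_iff_lt_or_eq, le_iff_lt_or_eq, h2]
    simp [h0, h1]
  cases b <;> cases c <;> simp [this]

/-- If every pair of neighbouring positions carries the two letters of one pair, in either order,
then the pair that consists of the letters `±1` can only be at its own place. -/
theorem isColoring_comp_iff {m N : ℕ} {κ : Fin N → ℤˣ} {u : Letter m ≃ Fin N}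
    (hu : IsAdapted κ u) {g : Equiv.Perm (Letter m)}
    (hg : ∀ i : Fin m, (g.symm (i.succ, false)).1 = (g.symm (i.succ, true)).1) :
    IsColoring κ (u ∘ g) ↔ ∀ b, g (0, b) = (0, b) := by
  obtain ⟨hc, -⟩ := hu
  constructor
  · intro h b
    have h0 : (g (0, b)).1 = 0 := by
      by_contra h1
      obtain ⟨i, hi⟩ := Fin.exists_succ_eq.2 h1
      have h2 : g (0, b) = (i.succ, (g (0, b)).2) := Prod.ext hi.symm rfl
      have h3 := apply_not_of_apply hg h2
      have h4 : κ (u (g (0, false))) = κ (u (g (0, true))) := by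
        cases b
        · rw [h2, show g (0, true) = _ from h3]
          exact hc.eq_of_eq i _ _
        · rw [h2, show g (0, false) = _ from h3]
          exact hc.eq_of_eq i _ _
      have h5 : κ (u (g (0, false))) = 1 := h.2.1
      have h6 : κ (u (g (0, true))) = -1 := h.2.2
      rw [h5, h6] at h4
      exact absurd h4 (by decide)
    have h1 : g (0, b) = (0, (g (0, b)).2) := Prod.ext h0 rfl
    have h5 : κ (u (g (0, false))) = 1 := h.2.1
    have h6 : κ (u (g (0, true))) = -1 := h.2.2
    refine Prod.ext h0 ?_
    show (g (0, b)).2 = b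
    generalize (g (0, b)).2 = c at h1
    cases b <;> cases c
    · rfl
    · rw [h1, hc.2.2] at h5
      exact absurd h5 (by decide)
    · rw [h1, hc.2.1] at h6
      exact absurd h6 (by decide)
    · rfl
  · intro h
    refine ⟨fun i => ?_, ?_, ?_⟩
    · have h1 : (g (i.succ, false)).1 ≠ 0 := by
        intro h2
        have h3 : g (i.succ, false) = g (0, (g (i.succ, false)).2) := by
          rw [h]; exact Prod.ext h2 rfl
        exact Fin.succ_ne_zero i (congrArg Prod.fst (g.injective h3))
      obtain ⟨j, hj⟩ := Fin.exists_succ_eq.2 h1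
      have h2 : g (i.succ, false) = (j.succ, (g (i.succ, false)).2) := Prod.ext hj.symm rfl
      have h3 := apply_not_of_apply hg h2
      simp only [Function.comp_apply]
      rw [h2, show g (i.succ, true) = _ from h3]
      exact hc.eq_of_eq j _ _
    · simp [h, hc.2.1]
    · simp [h, hc.2.2]

/-- The arrangements that survive the cancellation have no crossings, hence have sign `1`. -/
theorem crossSign_comp_eq_one {m N : ℕ} {κ : Fin N → ℤˣ} {u : Letter m ≃ Fin N}
    (hu : IsAdapted κ u) {g : Equiv.Perm (Letter m)} (hg : g ∈ pairPerms m) :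
    crossSign (u ∘ g) (κ ∘ u ∘ g) = 1 := by
  simp only [pairPerms, mem_filter, mem_univ, true_and] at hg
  obtain ⟨hg0, hg⟩ := hg
  have hcol := (isColoring_comp_iff hu hg).2 hg0
  rw [crossSign]
  refine Finset.prod_eq_one fun l _ => ?_
  rw [Fintype.prod_prod_type]
  refine Finset.prod_eq_one fun k _ => ?_
  rw [Fintype.prod_bool]
  by_cases hl : l.1 < k
  swap
  · simp [hl]
  obtain ⟨j, rfl⟩ := Fin.exists_succ_eq.2 (Fin.ne_zero_of_lt hl)
  have h1 : (g (j.succ, true)).1 ≠ 0 := by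
    intro h2
    have h3 : g (j.succ, true) = g (0, (g (j.succ, true)).2) := by
      rw [hg0]; exact Prod.ext h2 rfl
    exact Fin.succ_ne_zero j (congrArg Prod.fst (g.injective h3))
  obtain ⟨i, hi⟩ := Fin.exists_succ_eq.2 h1
  have h2 : g (j.succ, true) = (i.succ, (g (j.succ, true)).2) := Prod.ext hi.symm rfl
  have h3 : g (j.succ, false) = (i.succ, !(g (j.succ, true)).2) := apply_not_of_apply hg h2
  generalize (g (j.succ, true)).2 = c at h2 h3
  have hne : ∀ d, g l ≠ (i.succ, d) := by
    intro d hd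
    have : l.1 = j.succ := by
      rcases Bool.eq_or_eq_not d c with rfl | rfl
      · exact congrArg Prod.fst (g.injective (hd.trans h2.symm))
      · exact congrArg Prod.fst (g.injective (hd.trans h3.symm))
    exact hl.ne this
  simp only [Function.comp_apply, hl, true_and, h2, h3]
  rw [hu.isColoring.eq_of_eq i c false, hu.isColoring.eq_of_eq i (!c) false]
  by_cases hy : κ (u (g l)) = κ (u (i.succ, false))
  swap
  · simp [hy]
  have h4 := hu.adjacent' i c (!c) (u (g l)) hy (u.injective.ne (hne _)) (u.injective.ne (hne _))
  simp only [h4, hy, true_and]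
  split_ifs <;> rfl

/-- The signed number of arrangements compatible with a given colouring does not depend on the
colouring: in an adapted frame, the arrangements in which some pair of neighbouring positions
carries letters of different pairs cancel. -/
theorem sum_crossSign_of_isAdapted {m N : ℕ} {κ : Fin N → ℤˣ} {u : Letter m ≃ Fin N}
    (hu : IsAdapted κ u) :
    ∑ v : Letter m ≃ Fin N, (if IsColoring κ v then crossSign v (κ ∘ v) else 0) =
      #(pairPerms m) := by
  let e : Equiv.Perm (Letter m) ≃ (Letter m ≃ Fin N) := Equiv.equivCongr (Equiv.refl _) u
  have he : ∀ g, ⇑(e g) = u ∘ g := fun g => by ext; simp [e]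
  let F : Equiv.Perm (Letter m) → ℤ := fun g =>
    if IsColoring κ (u ∘ g) then crossSign (u ∘ g) (κ ∘ u ∘ g) else 0
  let P : Fin m → Equiv.Perm (Letter m) → Prop := fun i g =>
    (g.symm (i.succ, false)).1 = (g.symm (i.succ, true)).1
  rw [← e.sum_comp]
  simp only [he]
  change ∑ g, F g = _
  -- Discard, for one `i` after the other, the arrangements in which the `i`-th pair of neighbours
  -- carries letters of different pairs: exchanging these two letters reverses the sign.
  have hstep : ∀ (S : Finset (Fin m)), ∑ g, F g = ∑ g with ∀ i ∈ S, P i g, F g := by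
    intro S
    induction S using Finset.induction_on with
    | empty => simp
    | insert i S hi ih =>
      rw [ih, ← Finset.sum_filter_add_sum_filter_not _ (fun g => P i g)]
      have h0 : ∑ g with (∀ j ∈ S, P j g), (if P i g then 0 else F g) = 0 := by
        have h1 : ∑ g with (∀ j ∈ S, P j g), (if P i g then 0 else F g) =
            ∑ g with (∀ j ∈ S, P j g), -(if P i g then 0 else F g) := by
          let s : Equiv.Perm (Letter m) := Equiv.swap (i.succ, false) (i.succ, true)
          refine Finset.sum_equiv (Equiv.mulLeft s) ?_ ?_
          · intro g
            simp only [mem_filter, mem_univ, true_and, Equiv.coe_mulLeft]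
            refine forall₂_congr fun j hj => ?_
            have hji : j ≠ i := fun h => hi (h ▸ hj)
            have hs : ∀ b, s (j.succ, b) = (j.succ, b) := fun b =>
              Equiv.swap_apply_of_ne_of_ne (by simp [hji]) (by simp [hji])
            have h2 : ∀ b, (s * g).symm (j.succ, b) = g.symm (j.succ, b) := by
              intro b
              rw [Equiv.symm_apply_eq, Equiv.Perm.mul_apply, Equiv.apply_symm_apply, hs]
            simp only [P, h2]
          · intro g hg
            rw [Equiv.coe_mulLeft]
            have h2 : ∀ b, (s * g).symm (i.succ, b) = g.symm (i.succ, !b) := by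
              intro b
              rw [Equiv.symm_apply_eq, Equiv.Perm.mul_apply, Equiv.apply_symm_apply]
              cases b <;> simp [s]
            have hP : P i (s * g) ↔ P i g := by
              simp only [P, h2, Bool.not_false, Bool.not_true]
              exact eq_comm
            simp only [hP]
            by_cases hPg : P i g
            · simp [hPg]
            simp only [hPg, if_false]
            set a := g.symm (i.succ, false) with ha
            set b := g.symm (i.succ, true) with hb
            have hga : g a = (i.succ, false) := by rw [ha, Equiv.apply_symm_apply]
            have hgb : g b = (i.succ, true) := by rw [hb, Equiv.apply_symm_apply]
            have hsg : ⇑(s * g) = g ∘ Equiv.swap a b := by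
              ext1 l
              have := Equiv.swap_apply_apply g a b
              rw [hga, hgb] at this
              simp only [s, this, Equiv.Perm.mul_apply, Function.comp_apply]
              change g (Equiv.swap a b (g.symm (g l))) = _
              rw [Equiv.symm_apply_apply]
            have hyy : κ ∘ u ∘ (g ∘ Equiv.swap a b) = κ ∘ u ∘ g := by
              ext1 l
              simp only [Function.comp_apply]
              rcases eq_or_ne l a with rfl | h3
              · rw [Equiv.swap_apply_left, hga, hgb]
                exact (hu.isColoring.1 i).symm
              rcases eq_or_ne l b with rfl | h4
              · rw [Equiv.swap_apply_right, hga, hgb]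
                exact hu.isColoring.1 i
              rw [Equiv.swap_apply_of_ne_of_ne h3 h4]
            have hcol : IsColoring κ (u ∘ (s * g)) ↔ IsColoring κ (u ∘ g) := by
              have h3 := fun l => congrFun hyy l
              simp only [Function.comp_apply] at h3
              simp only [IsColoring, hsg, Function.comp_apply, h3]
            have hcs : crossSign ((u ∘ g) ∘ Equiv.swap a b) (κ ∘ u ∘ g) =
                -crossSign (u ∘ g) (κ ∘ u ∘ g) := by
              refine crossSign_swap (u ∘ g) (u.injective.comp g.injective) _ a b hPg ?_ ?_
              · simp only [Function.comp_apply, hga, hgb]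
                exact hu.isColoring.1 i
              · intro l h3 h4 h5
                simp only [Function.comp_apply, hga, hgb] at h3 ⊢
                refine hu.adjacent i _ h3 ?_ ?_
                · rw [← hga]
                  exact (u.injective.comp g.injective).ne h4
                · rw [← hgb]
                  exact (u.injective.comp g.injective).ne h5
            simp only [F]
            rw [hsg] at hcol ⊢
            simp only [hyy, hcol]
            rw [← Function.comp_assoc (⇑u), hcs]
            split_ifs <;> simp
        rw [Finset.sum_neg_distrib] at h1
        linarith
      have h1 : ∑ g with (∀ j ∈ S, P j g), (if P i g then 0 else F g) =
          ∑ g ∈ ({g | ∀ j ∈ S, P j g} : Finset _) with ¬ P i g, F g := by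
        rw [Finset.sum_filter (fun g => ¬ P i g)]
        refine Finset.sum_congr rfl fun g _ => ?_
        split_ifs <;> rfl
      rw [← h1, h0, add_zero, Finset.filter_filter]
      refine Finset.sum_congr ?_ fun _ _ => rfl
      ext g
      simp only [mem_filter, mem_univ, true_and, Finset.forall_mem_insert]
      exact and_comm
  rw [hstep univ]
  have h2 : ∀ g ∈ ({g | ∀ i ∈ univ, P i g} : Finset (Equiv.Perm (Letter m))),
      F g = if ∀ b, g (0, b) = (0, b) then 1 else 0 := by
    intro g hg
    simp only [mem_filter, mem_univ, true_and, forall_true_left] at hg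
    simp only [F, isColoring_comp_iff hu hg]
    split_ifs with h3
    · exact crossSign_comp_eq_one hu (by simpa [pairPerms] using ⟨⟨h3 false, h3 true⟩, hg⟩)
    · rfl
  rw [Finset.sum_congr rfl h2, ← Finset.sum_filter, Finset.filter_filter, Finset.sum_const,
    nsmul_eq_mul, mul_one]
  congr 2
  ext g
  simp only [pairPerms, mem_filter, mem_univ, true_and, forall_true_left, P]
  exact and_comm

theorem odd_card_of_isColoring {m N : ℕ} {κ : Fin N → ℤˣ} {v : Letter m ≃ Fin N}
    (h : IsColoring κ v) : Odd #{p | κ p = 1} := by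
  have h1 : #{p | κ p = 1} = ∑ l : Letter m, if κ (v l) = 1 then 1 else 0 := by
    rw [Finset.card_filter]
    exact (v.sum_comp fun p => if κ p = 1 then 1 else 0).symm
  rw [h1, Fintype.sum_prod_type, Fin.sum_univ_succ]
  simp only [Fintype.sum_bool, h.2.1, h.2.2, ← h.1]
  rw [if_neg (by decide), if_pos trivial, zero_add]
  refine odd_one.add_even (Finset.even_sum _ fun i _ => ⟨_, rfl⟩)

/-- If both colours occur an odd number of times, grouping the positions of each colour into
successive pairs leaves one position of each colour, which the letters `1` and `-1` take. -/
theorem exists_isAdapted {m : ℕ} (κ : Fin (2 * (m + 1)) → ℤˣ) (h : Odd #{p | κ p = 1}) :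
    ∃ u : Letter m ≃ Fin (2 * (m + 1)), IsAdapted κ u := by
  obtain ⟨r, hr⟩ := h
  have hcard : #{p | κ p = 1} + #{p | κ p = -1} = 2 * (m + 1) := by
    have h1 := Finset.card_filter_add_card_filter_not (s := univ) (fun p => κ p = 1)
    rw [Finset.card_univ, Fintype.card_fin] at h1
    convert h1 using 2
    congr 1
    ext p
    rcases Int.units_eq_one_or (κ p) with h | h <;> simp [h]
  have hrm : r ≤ m := by omega
  have hs : #{p | κ p = -1} = 2 * (m - r) + 1 := by omega
  let e := orderEmbOfFin {p | κ p = 1} hr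
  let f := orderEmbOfFin {p | κ p = -1} hs
  have he : ∀ j, κ (e j) = 1 := fun j =>
    (mem_filter.1 (orderEmbOfFin_mem {p | κ p = 1} hr j)).2
  have hf : ∀ j, κ (f j) = -1 := fun j =>
    (mem_filter.1 (orderEmbOfFin_mem {p | κ p = -1} hs j)).2
  have he' : ∀ p, κ p = 1 → ∃ j, e j = p := fun p hp => by
    have : p ∈ Set.range e := by rw [range_orderEmbOfFin]; simpa using hp
    exact this
  have hf' : ∀ p, κ p = -1 → ∃ j, f j = p := fun p hp => by
    have : p ∈ Set.range f := by rw [range_orderEmbOfFin]; simpa using hp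
    exact this
  have hef : ∀ i j, e i ≠ f j := fun i j h => by
    have h1 := he i
    rw [h, hf j] at h1
    exact absurd h1 (by decide)
  -- The first `r` pairs take the first `2r` positions of colour `1`, the other pairs all but the
  -- last position of colour `-1`.
  let a : Fin m → Bool → Fin (2 * (m + 1)) := fun i b =>
    if hi : (i : ℕ) < r then e ⟨2 * i + b.toNat, by cases b <;> simp <;> omega⟩
    else f ⟨2 * (i - r) + b.toNat, by cases b <;> simp <;> omega⟩
  let w : Letter m → Fin (2 * (m + 1)) := fun l =>
    Fin.cases (if l.2 then f (Fin.last _) else e (Fin.last _)) (fun i => a i l.2) l.1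
  have hw0 : ∀ b, w (0, b) = if b then f (Fin.last _) else e (Fin.last _) := fun b => rfl
  have hws : ∀ (i : Fin m) b, w (i.succ, b) = a i b := fun i b => rfl
  have hinj : Function.Injective w := by
    rintro ⟨k, b⟩ ⟨k', b'⟩
    refine Fin.cases ?_ (fun i => ?_) k <;> refine Fin.cases ?_ (fun j => ?_) k'
    · rw [hw0, hw0]
      cases b <;> cases b' <;> simp [hef, (hef _ _).symm]
    · rw [hw0, hws]
      intro h
      exfalso
      simp only [a] at h
      split_ifs at h with h1 h2 h2
      · exact hef _ _ h.symm
      · have := congrArg Fin.val (f.injective h)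
        cases b' <;> simp at this <;> omega
      · have := congrArg Fin.val (e.injective h)
        cases b' <;> simp at this <;> omega
      · exact hef _ _ h
    · rw [hw0, hws]
      intro h
      exfalso
      simp only [a] at h
      split_ifs at h with h1 h2 h2
      · exact hef _ _ h
      · have := congrArg Fin.val (e.injective h)
        cases b <;> simp at this <;> omega
      · have := congrArg Fin.val (f.injective h)
        cases b <;> simp at this <;> omega
      · exact hef _ _ h.symm
    · rw [hws, hws]
      intro h
      simp only [a] at h
      have key : (i : ℕ) = j ∧ b = b' := by
        split_ifs at h with h1 h2 h2
        · have := congrArg Fin.val (e.injective h)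
          cases b <;> cases b' <;> simp at this ⊢ <;> omega
        · exact absurd h (hef _ _)
        · exact absurd h.symm (hef _ _)
        · have := congrArg Fin.val (f.injective h)
          cases b <;> cases b' <;> simp at this ⊢ <;> omega
      rw [Fin.ext key.1, key.2]
  have hbij : Function.Bijective w := by
    rw [Fintype.bijective_iff_injective_and_card]
    exact ⟨hinj, by simp [mul_comm]⟩
  refine ⟨Equiv.ofBijective w hbij, ⟨fun i => ?_, ?_, ?_⟩, fun i p hp h0 h1 => ?_⟩
  · simp only [Equiv.ofBijective_apply, hws, a]
    split_ifs <;> simp [he, hf]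
  · simp [hw0, he]
  · simp [hw0, hf]
  · simp only [Equiv.ofBijective_apply, hws, a] at hp h0 h1 ⊢
    split_ifs at hp h0 h1 ⊢ with hi
    · rw [he] at hp
      obtain ⟨j, rfl⟩ := he' p hp
      rw [e.lt_iff_lt, e.lt_iff_lt, Fin.lt_def, Fin.lt_def]
      have h2 := Fin.val_ne_of_ne (ne_of_apply_ne e h0)
      have h3 := Fin.val_ne_of_ne (ne_of_apply_ne e h1)
      simp at h2 h3 ⊢
      omega
    · rw [hf] at hp
      obtain ⟨j, rfl⟩ := hf' p hp
      rw [f.lt_iff_lt, f.lt_iff_lt, Fin.lt_def, Fin.lt_def]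
      have h2 := Fin.val_ne_of_ne (ne_of_apply_ne f h0)
      have h3 := Fin.val_ne_of_ne (ne_of_apply_ne f h1)
      simp at h2 h3 ⊢
      omega

/-- Summation over the arrangements and the specializations, sorted by the induced colouring of the
positions. A colouring arises only if the number of positions coloured `1` is odd, and then its
signed number of arrangements is `#(pairPerms m)`. -/
theorem sum_mul_crossSign (m : ℕ) (φ : (Fin (2 * (m + 1)) → ℤˣ) → ℂ) :
    ∑ v : Letter m ≃ Fin (2 * (m + 1)), ∑ ε : Fin m → ℤˣ,
      φ (letterColor ε ∘ v.symm) * (crossSign v (letterColor ε) : ℂ) =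
    (#(pairPerms m) : ℂ) * ∑ κ with Odd #{p | κ p = 1}, φ κ := by
  have h1 : ∀ v : Letter m ≃ Fin (2 * (m + 1)), ∑ ε : Fin m → ℤˣ,
      φ (letterColor ε ∘ v.symm) * (crossSign v (letterColor ε) : ℂ) =
      ∑ κ, φ κ * ((if IsColoring κ v then crossSign v (κ ∘ v) else 0 : ℤ) : ℂ) := by
    intro v
    have h2 : ∀ κ, φ κ * ((if IsColoring κ v then crossSign v (κ ∘ v) else 0 : ℤ) : ℂ) =
        if IsColoring κ v then φ κ * (crossSign v (κ ∘ v) : ℂ) else 0 := by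
      intro κ; split_ifs <;> simp
    simp only [h2]
    rw [← Finset.sum_filter]
    have h3 : ∀ ε : Fin m → ℤˣ, letterColor ε = (letterColor ε ∘ v.symm) ∘ v := by
      intro ε; ext1 l; simp
    refine Finset.sum_bij' (fun ε _ => letterColor ε ∘ v.symm)
      (fun κ _ => fun i => κ (v (i.succ, false))) ?_ ?_ ?_ ?_ ?_
    · intro ε _
      simpa using ((isColoring_iff _ v ε).1 (h3 ε)).1
    · intro κ _; simp
    · intro ε _
      exact ((isColoring_iff _ v ε).1 (h3 ε)).2.symm
    · intro κ hκ
      simp only [mem_filter, mem_univ, true_and] at hκ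
      rw [(isColoring_iff κ v _).2 ⟨hκ, rfl⟩]
      ext1 p; simp
    · intro ε _
      rw [← h3]
  simp only [h1]
  rw [Finset.sum_comm, Finset.mul_sum, Finset.sum_filter]
  refine Finset.sum_congr rfl fun κ _ => ?_
  rw [← Finset.mul_sum, ← Int.cast_sum]
  split_ifs with h
  · obtain ⟨u, hu⟩ := exists_isAdapted κ h
    rw [sum_crossSign_of_isAdapted hu]
    push_cast
    ring
  · rw [Finset.sum_eq_zero]
    · simp
    · intro v _
      rw [if_neg]
      exact fun h2 => h (odd_card_of_isColoring h2)

/-! ### Products over pairs of letters -/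

/-- The product of a symmetric function over unordered pairs does not depend on the order by which
each pair is listed once. -/
theorem prod_prod_ite_lt_eq {ι A B M : Type*} [Fintype ι] [CommMonoid M] [LinearOrder A]
    [LinearOrder B] {a : ι → A} {b : ι → B} (ha : Function.Injective a)
    (hb : Function.Injective b) (s : ι → ι → M) (hs : ∀ i j, i ≠ j → s i j = s j i) :
    ∏ i, ∏ j, (if a i < a j then s i j else 1) = ∏ i, ∏ j, (if b i < b j then s i j else 1) := by
  have h1 : ∀ i j, (if a i < a j then s i j else 1) =
      (if b i < b j ∧ a i < a j then s i j else 1) *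
        (if b j < b i ∧ a i < a j then s j i else 1) := by
    intro i j
    by_cases h : a i < a j
    · have hij : i ≠ j := fun h2 => h.ne (congrArg a h2)
      rcases lt_or_gt_of_ne (hb.ne hij) with h2 | h2
      · simp [h, h2, h2.not_gt]
      · simp [h, h2, h2.not_gt, hs i j hij]
    · simp [h]
  have h2 : ∀ i j, (if b i < b j then s i j else 1) =
      (if b i < b j ∧ a i < a j then s i j else 1) *
        (if b i < b j ∧ a j < a i then s i j else 1) := by
    intro i j
    by_cases h : b i < b j
    · have hij : i ≠ j := fun h2 => h.ne (congrArg b h2)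
      rcases lt_or_gt_of_ne (ha.ne hij) with h2 | h2 <;> simp [h, h2, h2.not_gt]
    · simp [h]
  simp only [h1, h2, Finset.prod_mul_distrib]
  rw [Finset.prod_comm (f := fun i j => if b j < b i ∧ a i < a j then s j i else 1)]

theorem prod_prod_ite_lt_eq_fin {m : ℕ} {B M : Type*} [CommMonoid M] [LinearOrder B]
    {b : Fin m → B} (hb : Function.Injective b) (s : Fin m → Fin m → M)
    (hs : ∀ i j, i ≠ j → s i j = s j i) :
    ∏ i, ∏ j, (if i < j then s i j else 1) = ∏ i, ∏ j, (if b i < b j then s i j else 1) :=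
  prod_prod_ite_lt_eq (a := id) Function.injective_id hb s hs

theorem prod_letter_pairs {m : ℕ} {M : Type*} [CommMonoid M] (F : Letter m → Letter m → M) :
    ∏ l, ∏ l', (if l.1 < l'.1 then F l l' else 1) =
      (∏ j : Fin m, ∏ b, ∏ b', F (0, b) (j.succ, b')) *
        ∏ i : Fin m, ∏ j : Fin m,
          if i < j then ∏ b, ∏ b', F (i.succ, b) (j.succ, b') else 1 := by
  have h1 : ∏ l, ∏ l', (if l.1 < l'.1 then F l l' else 1) =
      ∏ k, ∏ k', if k < k' then ∏ b, ∏ b', F (k, b) (k', b') else 1 := by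
    rw [Fintype.prod_prod_type]
    refine Finset.prod_congr rfl fun k _ => ?_
    simp only [Fintype.prod_prod_type]
    rw [Finset.prod_comm]
    refine Finset.prod_congr rfl fun k' _ => ?_
    split_ifs <;> simp
  rw [h1, Fin.prod_univ_succ, Fin.prod_univ_succ]
  simp only [lt_irrefl, if_false, one_mul, Fin.succ_pos, if_true]
  congr 1
  refine Finset.prod_congr rfl fun i _ => ?_
  rw [Fin.prod_univ_succ]
  simp only [Fin.not_lt_zero, if_false, one_mul, Fin.succ_lt_succ_iff]

/-- The factor `(a - t b) / (a - b)` of the Hall–Littlewood symmetrization. -/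
noncomputable def hlFactor (t a b : ℂ) : ℂ := (a - t * b) / (a - b)

/-- The factor of the pair of letters `l`, `l'` at the positions `v`, with values `z`: the letter
further to the left comes first. -/
noncomputable def orderedFactor {m N : ℕ} (t : ℂ) (v : Letter m → Fin N) (z : Letter m → ℂ)
    (l l' : Letter m) : ℂ :=
  if v l < v l' then hlFactor t (z l) (z l') else hlFactor t (z l') (z l)

theorem orderedFactor_comm {m N : ℕ} (t : ℂ) {v : Letter m → Fin N} (hv : Function.Injective v)
    (z : Letter m → ℂ) {l l' : Letter m} (h : l ≠ l') :
    orderedFactor t v z l l' = orderedFactor t v z l' l := by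
  rcases lt_or_gt_of_ne (hv.ne h) with h2 | h2 <;> simp [orderedFactor, h2, h2.not_gt]

/-- The term of the Hall–Littlewood symmetrization in which the letter `l` has the value `z l` and
stands at the position `v l`. -/
noncomputable def letterTerm {m N : ℕ} (t : ℂ) (lam : Fin N → ℕ) (v : Letter m → Fin N)
    (z : Letter m → ℂ) : ℂ :=
  (∏ l, z l ^ lam (v l)) * ∏ l, ∏ l', if v l < v l' then hlFactor t (z l) (z l') else 1

theorem letterTerm_comp {m N : ℕ} (t : ℂ) (lam : Fin N → ℕ) (v : Letter m → Fin N)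
    (z : Letter m → ℂ) (σ : Equiv.Perm (Letter m)) :
    letterTerm t lam (v ∘ σ) (z ∘ σ) = letterTerm t lam v z := by
  simp only [letterTerm, Function.comp_apply]
  rw [Equiv.prod_comp σ fun l => z l ^ lam (v l),
    Equiv.prod_comp σ fun l => ∏ l', if v l < v (σ l') then hlFactor t (z l) (z (σ l')) else 1]
  congr 1
  refine Finset.prod_congr rfl fun l _ => ?_
  rw [Equiv.prod_comp σ fun l' => if v l < v l' then hlFactor t (z l) (z l') else 1]

/-- The factors of a term, grouped by the variables involved. -/
theorem letterTerm_eq {m N : ℕ} (t : ℂ) (lam : Fin N → ℕ) {v : Letter m → Fin N}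
    (hv : Function.Injective v) (z : Letter m → ℂ) :
    letterTerm t lam v z = (∏ k, (z (k, false) ^ lam (v (k, false)) *
        z (k, true) ^ lam (v (k, true)) * orderedFactor t v z (k, false) (k, true))) *
      ((∏ j : Fin m, ∏ b, ∏ b', orderedFactor t v z (0, b) (j.succ, b')) *
        ∏ i : Fin m, ∏ j : Fin m,
          if i < j then ∏ b, ∏ b', orderedFactor t v z (i.succ, b) (j.succ, b') else 1) := by
  have h1 : ∀ l l', (if v l < v l' then hlFactor t (z l) (z l') else 1) =
      if v l < v l' then orderedFactor t v z l l' else 1 := by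
    intro l l'
    by_cases h : v l < v l' <;> simp [orderedFactor, h]
  -- the lexicographic order of the letters
  let c : Letter m → ℕ := fun l => 2 * l.1 + l.2.toNat
  have hc : Function.Injective c := by
    rintro ⟨k, b⟩ ⟨k', b'⟩ h
    have h2 : (k : ℕ) = k' ∧ b = b' := by
      cases b <;> cases b' <;> simp [c] at h ⊢ <;> omega
    rw [Fin.ext h2.1, h2.2]
  have h2 : ∀ l l', (if c l < c l' then orderedFactor t v z l l' else 1) =
      (if l.1 < l'.1 then orderedFactor t v z l l' else 1) *
        (if l.1 = l'.1 ∧ l.2 < l'.2 then orderedFactor t v z l l' else 1) := by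
    rintro ⟨k, b⟩ ⟨k', b'⟩
    have h3 : c (k, b) < c (k', b') ↔ k < k' ∨ (k = k' ∧ b < b') := by
      have h5 : ¬ (true < false) := by decide
      rw [Fin.lt_def, Fin.ext_iff]
      cases b <;> cases b' <;> simp [c, h5, -Fin.val_fin_le, -Fin.val_fin_lt] <;> omega
    simp only [h3]
    by_cases h4 : k < k'
    · simp [h4, h4.ne]
    · simp [h4]
  have h3 : ∏ l, ∏ l', (if l.1 = l'.1 ∧ l.2 < l'.2 then orderedFactor t v z l l' else 1) =
      ∏ k, orderedFactor t v z (k, false) (k, true) := by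
    rw [Fintype.prod_prod_type]
    refine Finset.prod_congr rfl fun k _ => ?_
    simp only [Fintype.prod_prod_type, Fintype.prod_bool]
    rw [Finset.prod_eq_single k, Finset.prod_eq_single k] <;> simp +contextual [eq_comm]
  rw [letterTerm, Fintype.prod_prod_type]
  simp only [h1]
  rw [prod_prod_ite_lt_eq hv hc _ fun l l' h => orderedFactor_comm t hv z h]
  simp only [h2, Finset.prod_mul_distrib]
  rw [h3, prod_letter_pairs]
  simp only [Fintype.prod_bool, Finset.prod_mul_distrib]
  ring

/-- The sign in the form in which the iterated residues produce it. -/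
theorem crossSign_eq {m N : ℕ} {v : Letter m → Fin N} (hv : Function.Injective v)
    (hpq : ∀ i : Fin m, v (i.succ, false) < v (i.succ, true)) (ε : Fin m → ℤˣ) :
    (crossSign v (letterColor ε) : ℂ) =
      (∏ i : Fin m, ∏ b : Bool, if v (i.succ, false) < v (0, b) ∧ v (0, b) < v (i.succ, true) then
        -(((letterColor ε (0, b) : ℤ) : ℂ) * ((ε i : ℤ) : ℂ)) else 1) *
      ∏ i : Fin m, ∏ j : Fin m, if v (i.succ, false) < v (j.succ, false) ∧
        v (j.succ, false) < v (i.succ, true) ∧ ¬ v (j.succ, true) < v (i.succ, true) then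
          -(((ε i : ℤ) : ℂ) * ((ε j : ℤ) : ℂ)) else 1 := by
  have hflip : ∀ u w : ℤˣ, -(((u : ℤ) : ℂ) * ((w : ℤ) : ℂ)) = if u = w then -1 else 1 := by
    intro u w
    rcases Int.units_eq_one_or u with rfl | rfl <;> rcases Int.units_eq_one_or w with rfl | rfl <;>
      simp [show (1 : ℤˣ) ≠ -1 by decide, show (-1 : ℤˣ) ≠ 1 by decide]
  have h1 : crossSign v (letterColor ε) = ∏ l, ∏ l', if l.1 < l'.1 then
      (if letterColor ε l = letterColor ε l' ∧ v l' < v l then (-1 : ℤ) else 1) else 1 := by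
    rw [crossSign]
    refine Finset.prod_congr rfl fun l _ => Finset.prod_congr rfl fun l' _ => ?_
    by_cases h : l.1 < l'.1 <;> simp [h]
  have hv' : Function.Injective fun i : Fin m => v (i.succ, false) := fun i j h => by
    simpa using hv h
  rw [h1, prod_letter_pairs, prod_prod_ite_lt_eq_fin hv']
  · push_cast
    congr 1
    · refine Finset.prod_congr rfl fun i _ => Finset.prod_congr rfl fun b _ => ?_
      rw [Fintype.prod_bool, hflip, letterColor_succ, letterColor_succ]
      have h2 : v (0, b) ≠ v (i.succ, true) := hv.ne (by simp [(Fin.succ_ne_zero i).symm])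
      have h3 : v (0, b) ≠ v (i.succ, false) := hv.ne (by simp [(Fin.succ_ne_zero i).symm])
      have h4 := hpq i
      by_cases hc : letterColor ε (0, b) = ε i
      · simp only [hc, true_and, if_true]
        rcases lt_or_gt_of_ne h2 with h5 | h5
        · simp [h5, h5.not_gt]
        · simp [h5, h5.not_gt, h4.trans h5]
      · simp only [hc, false_and, if_false, mul_one, ite_self]
    · refine Finset.prod_congr rfl fun i _ => Finset.prod_congr rfl fun j _ => ?_
      simp only [Fintype.prod_bool, letterColor_succ, hflip]
      by_cases h2 : v (i.succ, false) < v (j.succ, false)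
      · have h3 := h2.trans (hpq j)
        simp only [h2, h2.not_gt, h3.not_gt, true_and, and_false, if_false, if_true, mul_one]
        by_cases hc : ε i = ε j
        · simp only [hc, true_and, if_true]
          by_cases h4 : v (j.succ, true) < v (i.succ, true)
          · simp [h4, (hpq j).trans h4]
          · simp [h4]
        · simp [hc]
      · simp [h2]
  · intro i j hij
    simp only [Fintype.prod_bool, letterColor_succ]
    by_cases hc : ε i = ε j
    swap
    · simp [hc, Ne.symm hc]
    have h2 : ∀ b b', v (j.succ, b') < v (i.succ, b) ↔ ¬ v (i.succ, b) < v (j.succ, b') := by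
      intro b b'
      have : v (j.succ, b') ≠ v (i.succ, b) := hv.ne (by simp [hij.symm])
      rw [not_lt, le_iff_lt_or_eq]
      simp [this]
    simp only [hc, true_and, h2]
    split_ifs <;> rfl

/-! ### A single term of the integrand -/

/-- The value of a letter at the point `x`. -/
noncomputable def letterVal {m : ℕ} (x : Fin m → ℂ) (l : Letter m) : ℂ :=
  Fin.cases (if l.2 then -1 else 1) (fun i => if l.2 then (x i)⁻¹ else x i) l.1

@[simp]
theorem letterVal_zero {m : ℕ} (x : Fin m → ℂ) (b : Bool) :
    letterVal x (0, b) = if b then -1 else 1 := rfl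

@[simp]
theorem letterVal_succ {m : ℕ} (x : Fin m → ℂ) (i : Fin m) (b : Bool) :
    letterVal x (i.succ, b) = if b then (x i)⁻¹ else x i := rfl

section Algebra

variable {t x y : ℂ}

theorem hlFactor_sign_inv {c : ℂ} (hc : c = 1 ∨ c = -1) (hx : x ≠ 0) (hxc : x ≠ c) :
    hlFactor t c x⁻¹ = (x - t * c) / (x - c) := by
  have h3 : x - c ≠ 0 := sub_ne_zero.2 hxc
  have h4 : c - x⁻¹ = c * (x - c) / x := by
    rcases hc with rfl | rfl <;> field_simp <;> ring
  have h5 : c - x⁻¹ ≠ 0 := by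
    rw [h4]
    exact div_ne_zero (mul_ne_zero (by rcases hc with rfl | rfl <;> simp) h3) hx
  rw [hlFactor, div_eq_div_iff h5 h3]
  rcases hc with rfl | rfl <;> field_simp <;> ring

theorem hlFactor_inv_sign {c : ℂ} (hc : c = 1 ∨ c = -1) (hx : x ≠ 0) (hxc : x ≠ c) :
    hlFactor t x⁻¹ c = (c - t * x) / (c - x) := by
  have h3 : c - x ≠ 0 := sub_ne_zero.2 hxc.symm
  have h4 : x⁻¹ - c = c * (c - x) / x := by
    rcases hc with rfl | rfl <;> field_simp <;> ring
  have h5 : x⁻¹ - c ≠ 0 := by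
    rw [h4]
    exact div_ne_zero (mul_ne_zero (by rcases hc with rfl | rfl <;> simp) h3) hx
  rw [hlFactor, div_eq_div_iff h5 h3]
  rcases hc with rfl | rfl <;> field_simp <;> ring

/-- The factors of the pairs `c, x` and `c, x⁻¹` with `c = ±1` and the part of the density depending
on `c t`, for the order `x, c, x⁻¹`. -/
theorem hlFactor_sign_between {c : ℂ} (hc : c = 1 ∨ c = -1) (hx : x ≠ 0) (hxc : x ≠ c)
    (h1 : 1 - t * (c * x) ≠ 0) (h2 : 1 - t * (c * x⁻¹) ≠ 0) :
    hlFactor t x c * hlFactor t c x⁻¹ / pmFactor (c * t) x =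
      -(c * x) / (x - c) ^ 2 * crossFactor t c x := by
  have h3 : x - c ≠ 0 := sub_ne_zero.2 hxc
  have h4 : x - t * c ≠ 0 := fun h => h2 (by field_simp; linear_combination h)
  have e2 : 1 - c * t * x = 1 - t * (c * x) := by ring
  have e3 : 1 - c * t * x⁻¹ = (x - t * c) / x := by field_simp
  rw [hlFactor_sign_inv hc hx hxc, hlFactor, crossFactor, pmFactor, e2, e3]
  generalize hD : 1 - t * (c * x) = D at h1
  field_simp
  rcases hc with rfl | rfl <;> ring

/-- The same for the orders `c, x, x⁻¹` and `x, x⁻¹, c`: the factor `crossFactor t c x` is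
absent. -/
theorem hlFactor_sign_outside {c : ℂ} (hc : c = 1 ∨ c = -1) (hx : x ≠ 0) (hxc : x ≠ c)
    (h1 : 1 - t * (c * x) ≠ 0) (h2 : 1 - t * (c * x⁻¹) ≠ 0) :
    hlFactor t c x * hlFactor t c x⁻¹ / pmFactor (c * t) x = -(c * x) / (x - c) ^ 2 ∧
    hlFactor t x c * hlFactor t x⁻¹ c / pmFactor (c * t) x = -(c * x) / (x - c) ^ 2 := by
  have h3 : x - c ≠ 0 := sub_ne_zero.2 hxc
  have h4 : x - t * c ≠ 0 := fun h => h2 (by field_simp; linear_combination h)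
  have e2 : 1 - c * t * x = c * (c - t * x) := by rcases hc with rfl | rfl <;> ring
  have e3 : 1 - c * t * x⁻¹ = (x - t * c) / x := by field_simp
  have h5 : c - t * x ≠ 0 := fun h => h1 (by
    rw [show 1 - t * (c * x) = 1 - c * t * x by ring, e2, h, mul_zero])
  have h6 : c ≠ 0 := by rcases hc with rfl | rfl <;> simp
  have h7 : c - x = -(x - c) := by ring
  rw [hlFactor_sign_inv hc hx hxc, hlFactor_inv_sign hc hx hxc, hlFactor, hlFactor, pmFactor, e2,
    e3, h7]
  generalize x - t * c = A at h4
  generalize c - t * x = B at h5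
  constructor <;> field_simp <;> rcases hc with h | h <;> rw [h] <;> ring

/-- The self-interaction of the pair `x, x⁻¹` times the part of the density depending on
`±√t`. -/
theorem hlFactor_self_mul_density {s : ℂ} (hs : s ^ 2 = t) (hx : x ≠ 0) (hx2 : 1 - x ^ 2 ≠ 0)
    (h1 : 1 - t * (x * x) ≠ 0) (h2 : 1 - t * (x⁻¹ * x⁻¹) ≠ 0) :
    hlFactor t x x⁻¹ * ((1 - x ^ 2) * (1 - x⁻¹ ^ 2)) / (pmFactor s x * pmFactor (-s) x) =
      (1 - x ^ 2) / (1 - t * x ^ 2) := by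
  have e1 : pmFactor s x * pmFactor (-s) x = (1 - t * (x * x)) * (1 - t * (x⁻¹ * x⁻¹)) := by
    rw [pmFactor, pmFactor, ← hs]; ring
  have e2 : 1 - t * (x⁻¹ * x⁻¹) = (x ^ 2 - t) / x ^ 2 := by field_simp
  have h3 : x ^ 2 - t ≠ 0 := by
    intro h
    rw [e2, h, zero_div] at h2
    exact h2 rfl
  have e3 : hlFactor t x x⁻¹ = -(x ^ 2 - t) / (1 - x ^ 2) := by
    have h4 : x - x⁻¹ ≠ 0 := by
      intro h
      apply hx2
      field_simp at h
      linear_combination -h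
    rw [hlFactor, div_eq_div_iff h4 hx2]
    field_simp
    ring
  have h5 : 1 - t * x ^ 2 ≠ 0 := by rwa [sq]
  rw [e1, e2, e3, ← sq]
  field_simp
  ring

theorem hlFactor_inv_left (hx : x ≠ 0) (hxy : 1 - x * y ≠ 0) :
    hlFactor t x⁻¹ y = (1 - t * (x * y)) / (1 - x * y) := by
  have h : x⁻¹ - y = (1 - x * y) / x := by field_simp
  have h' : x⁻¹ - y ≠ 0 := by rw [h]; exact div_ne_zero hxy hx
  rw [hlFactor, div_eq_div_iff h' hxy]
  field_simp

theorem hlFactor_inv_right (hx : x ≠ 0) (hxy : 1 - x * y ≠ 0) :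
    hlFactor t y x⁻¹ = (t - x * y) / (1 - x * y) := by
  have h : y - x⁻¹ = -(1 - x * y) / x := by field_simp; ring
  have h' : y - x⁻¹ ≠ 0 := by rw [h]; exact div_ne_zero (neg_ne_zero.2 hxy) hx
  rw [hlFactor, div_eq_div_iff h' hxy]
  field_simp
  ring

theorem hlFactor_inv_mul_div (p : Prop) [Decidable p] (hx : x ≠ 0) (hxy : 1 - x * y ≠ 0)
    (h1 : 1 - t * (x * y) ≠ 0) :
    (if p then hlFactor t y x⁻¹ else hlFactor t x⁻¹ y) * ((1 - x * y) / (1 - t * (x * y))) =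
      if p then crossFactor t x y else 1 := by
  rw [hlFactor_inv_left hx hxy, hlFactor_inv_right hx hxy, crossFactor]
  generalize 1 - t * (x * y) = D at h1
  generalize 1 - x * y = E at hxy
  split_ifs <;> field_simp

theorem hlFactor_mul_div (hx : x ≠ 0) (hxy : 1 - x⁻¹ * y ≠ 0)
    (h1 : 1 - t * (x⁻¹ * y) ≠ 0) :
    hlFactor t x y * ((1 - x⁻¹ * y) / (1 - t * (x⁻¹ * y))) = 1 := by
  have := hlFactor_inv_mul_div (t := t) (x := x⁻¹) (y := y) False (inv_ne_zero hx) hxy h1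
  simpa using this

/-- The factors of the pairs formed by `x^{±1}` and `y^{±1}`, multiplied by the density. -/
theorem interaction_eq (p q : Prop) [Decidable p] [Decidable q] (hx : x ≠ 0)
    (a1 : 1 - x * y ≠ 0) (a2 : 1 - x⁻¹ * y⁻¹ ≠ 0) (a3 : 1 - x⁻¹ * y ≠ 0) (a4 : 1 - x * y⁻¹ ≠ 0)
    (b1 : 1 - t * (x * y) ≠ 0) (b2 : 1 - t * (x⁻¹ * y⁻¹) ≠ 0) (b3 : 1 - t * (x⁻¹ * y) ≠ 0)
    (b4 : 1 - t * (x * y⁻¹) ≠ 0) :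
    hlFactor t x y * hlFactor t x y⁻¹ * (if p then hlFactor t y x⁻¹ else hlFactor t x⁻¹ y) *
      (if q then hlFactor t y⁻¹ x⁻¹ else hlFactor t x⁻¹ y⁻¹) *
      (pmFactor₂ 1 x y / pmFactor₂ t x y) = interaction t p q x y := by
  have e1 := hlFactor_mul_div (t := t) hx a3 b3
  have e2 := hlFactor_mul_div (t := t) hx a2 b2
  have e3 := hlFactor_inv_mul_div (t := t) p hx a1 b1
  have e4 := hlFactor_inv_mul_div (t := t) q hx a4 b4
  rw [interaction, ← e3, ← e4]
  have e5 : pmFactor₂ 1 x y / pmFactor₂ t x y =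
      ((1 - x⁻¹ * y) / (1 - t * (x⁻¹ * y))) * ((1 - x⁻¹ * y⁻¹) / (1 - t * (x⁻¹ * y⁻¹))) *
      ((1 - x * y) / (1 - t * (x * y))) * ((1 - x * y⁻¹) / (1 - t * (x * y⁻¹))) := by
    rw [pmFactor₂, pmFactor₂, div_mul_div_comm, div_mul_div_comm, div_mul_div_comm]
    congr 1 <;> ring
  rw [e5]
  linear_combination ((if p then hlFactor t y x⁻¹ else hlFactor t x⁻¹ y) *
    ((1 - x * y) / (1 - t * (x * y)))) * ((if q then hlFactor t y⁻¹ x⁻¹ else hlFactor t x⁻¹ y⁻¹) *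
    ((1 - x * y⁻¹) / (1 - t * (x * y⁻¹)))) *
    ((hlFactor t x y⁻¹ * ((1 - x⁻¹ * y⁻¹) / (1 - t * (x⁻¹ * y⁻¹)))) * e1 + e2)

end Algebra

/-- The hypotheses on a point under which no denominator in a term vanishes: its coordinates lie on
the two circles, and the values of the letters are distinct. -/
structure IsGeneric {m : ℕ} (ρ : ℝ) (x : Fin m → ℂ) : Prop where
  mem : ∀ i, x i ∈ twoCircles ρ
  injective : Function.Injective (letterVal x)

/-- The term of the integrand in which the letters stand at the positions `v`. -/
noncomputable def termIntegrand {m N : ℕ} (t s α : ℂ) (lam : Fin N → ℕ) (v : Letter m → Fin N)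
    (x : Fin m → ℂ) : ℂ :=
  letterTerm t lam v (letterVal x) * koornwinderDensity t (-t) s (-s) t x *
    ∏ i, pmFactor α (x i)

/-- The value `1` or `-1` of the letter `(0, b)`. -/
noncomputable def signVal (b : Bool) : ℂ := if b then -1 else 1

/-- The numerator, as a function of the variable `x_i`, in the product form of a term. -/
noncomputable def residueNumerator {m N : ℕ} (t α : ℂ) (lam : Fin N → ℕ) (v : Letter m → Fin N)
    (i : Fin m) (z : ℂ) : ℂ :=
  -(z ^ (lam (v (i.succ, false)) - lam (v (i.succ, true)) + 1) * (1 - α * z) * (z - α)) /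
    (1 - t * z ^ 2) * ∏ b, if v (i.succ, false) < v (0, b) ∧ v (0, b) < v (i.succ, true) then
      crossFactor t (signVal b) z else 1

theorem signVal_cases (b : Bool) : signVal b = 1 ∨ signVal b = -1 := by
  cases b <;> simp [signVal]

section Standard

variable {m N : ℕ} {ρ R : ℝ} {t s α : ℂ} {lam : Fin N → ℕ} {v : Letter m → Fin N}
  {x : Fin m → ℂ}

theorem orderedFactor_sign_mul (hρ : 1 < ρ) (hR : ρ < R) (ht : ‖t‖ * R ^ 2 < 1)
    (hv : Function.Injective v) (hpq : ∀ i : Fin m, v (i.succ, false) < v (i.succ, true))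
    (hx : IsGeneric ρ x) (i : Fin m) (b : Bool) :
    (∏ b', orderedFactor t v (letterVal x) (0, b) (i.succ, b')) / pmFactor (signVal b * t) (x i) =
      -(signVal b * x i) / (x i - signVal b) ^ 2 *
        if v (i.succ, false) < v (0, b) ∧ v (0, b) < v (i.succ, true) then
          crossFactor t (signVal b) (x i) else 1 := by
  have hc := signVal_cases b
  have hx0 := ne_zero_of_mem_twoCircles hρ (hx.mem i)
  have hR1 : ‖signVal b‖ < R := by
    rcases hc with h | h <;> rw [h] <;> simpa using hρ.trans hR
  have h1 := crossFactor_den_ne_zero ht hR1 (norm_lt_of_mem_twoCircles hρ hR (hx.mem i))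
  have h2 := crossFactor_den_ne_zero ht hR1
    (norm_lt_of_mem_twoCircles hρ hR (inv_mem_twoCircles (hx.mem i)))
  have hxc : x i ≠ signVal b := by
    have : letterVal x (i.succ, false) ≠ letterVal x (0, b) :=
      hx.injective.ne (by simp)
    simpa [signVal] using this
  have hne1 : v (0, b) ≠ v (i.succ, false) := hv.ne (by simp [(Fin.succ_ne_zero i).symm])
  have hne2 : v (0, b) ≠ v (i.succ, true) := hv.ne (by simp [(Fin.succ_ne_zero i).symm])
  have h3 := hpq i
  have hval : letterVal x (0, b) = signVal b := rfl
  rw [Fintype.prod_bool, orderedFactor, orderedFactor, hval, letterVal_succ, letterVal_succ,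
    if_pos rfl, if_neg Bool.false_ne_true]
  rcases lt_or_gt_of_ne hne1 with h4 | h4
  · have h5 := h4.trans h3
    simp only [h4, h5, h4.not_gt, if_true, false_and, if_false, mul_one]
    rw [mul_comm (hlFactor _ _ _)]
    exact (hlFactor_sign_outside hc hx0 hxc h1 h2).1
  · rcases lt_or_gt_of_ne hne2 with h5 | h5
    · simp only [h4, h5, h4.not_gt, if_true, and_self, if_false]
      rw [mul_comm (hlFactor _ _ _)]
      exact hlFactor_sign_between hc hx0 hxc h1 h2
    · simp only [h4.not_gt, h5.not_gt, and_false, if_false, mul_one]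
      rw [mul_comm (hlFactor _ _ _)]
      exact (hlFactor_sign_outside hc hx0 hxc h1 h2).2

/-- All factors of a term that involve only the variable `x_i`. -/
theorem single_variable_factor (hρ : 1 < ρ) (hR : ρ < R) (ht : ‖t‖ * R ^ 2 < 1)
    (hs : s ^ 2 = t) (hlam : Antitone lam)
    (hv : Function.Injective v) (hpq : ∀ i : Fin m, v (i.succ, false) < v (i.succ, true))
    (hx : IsGeneric ρ x) (i : Fin m) :
    (letterVal x (i.succ, false) ^ lam (v (i.succ, false)) *
        letterVal x (i.succ, true) ^ lam (v (i.succ, true)) *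
        orderedFactor t v (letterVal x) (i.succ, false) (i.succ, true)) *
      (∏ b, ∏ b', orderedFactor t v (letterVal x) (0, b) (i.succ, b')) *
      (((1 - x i ^ 2) * (1 - (x i)⁻¹ ^ 2)) /
        (pmFactor t (x i) * pmFactor (-t) (x i) * pmFactor s (x i) * pmFactor (-s) (x i))) *
      pmFactor α (x i) = residueNumerator t α lam v i (x i) / (1 - x i ^ 2) := by
  have hx0 := ne_zero_of_mem_twoCircles hρ (hx.mem i)
  have hn := norm_lt_of_mem_twoCircles hρ hR (hx.mem i)
  have hn' := norm_lt_of_mem_twoCircles hρ hR (inv_mem_twoCircles (hx.mem i))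
  have h1 := crossFactor_den_ne_zero ht hn hn
  have h2 := crossFactor_den_ne_zero ht hn' hn'
  have h3 := one_sub_sq_ne_zero_of_mem_twoCircles hρ (hx.mem i)
  have hself := hlFactor_self_mul_density hs hx0 h3 h1 h2
  have hB := orderedFactor_sign_mul hρ hR ht hv hpq hx i
  have ho : orderedFactor t v (letterVal x) (i.succ, false) (i.succ, true) =
      hlFactor t (x i) (x i)⁻¹ := by
    simp [orderedFactor, hpq i]
  have hpow : letterVal x (i.succ, false) ^ lam (v (i.succ, false)) *
      letterVal x (i.succ, true) ^ lam (v (i.succ, true)) =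
      x i ^ (lam (v (i.succ, false)) - lam (v (i.succ, true))) := by
    rw [pow_sub₀ _ hx0 (hlam (hpq i).le)]
    simp
  have h4 : (1 - x i) ≠ 0 := fun h => h3 (by linear_combination (1 + x i) * h)
  have h5 : (1 + x i) ≠ 0 := fun h => h3 (by linear_combination (1 - x i) * h)
  have hpm : pmFactor α (x i) = (1 - α * x i) * (x i - α) / x i := by
    rw [pmFactor]; field_simp
  calc _ = (x i ^ (lam (v (i.succ, false)) - lam (v (i.succ, true)))) *
        (hlFactor t (x i) (x i)⁻¹ * ((1 - x i ^ 2) * (1 - (x i)⁻¹ ^ 2)) /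
          (pmFactor s (x i) * pmFactor (-s) (x i))) *
        (∏ b, (∏ b', orderedFactor t v (letterVal x) (0, b) (i.succ, b')) /
          pmFactor (signVal b * t) (x i)) * pmFactor α (x i) := by
        rw [hpow, ho, Finset.prod_div_distrib, Fintype.prod_bool (f := fun b =>
          pmFactor (signVal b * t) (x i))]
        simp only [signVal, if_true, Bool.false_eq_true, if_false, one_mul, neg_mul]
        ring
    _ = _ := by
        simp only [hB]
        rw [hself, Finset.prod_mul_distrib,
          Fintype.prod_bool (f := fun b => -(signVal b * _) / _), residueNumerator, hpm,
          pow_succ (x i) (_ - _)]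
        simp only [signVal, if_true, Bool.false_eq_true, if_false]
        have h6 : (x i - -1) = 1 + x i := by ring
        have h7 : (x i - 1) = -(1 - x i) := by ring
        have h8 : 1 - x i ^ 2 = (1 - x i) * (1 + x i) := by ring
        rw [h6, h7, h8]
        rw [← sq] at h1
        generalize 1 - t * x i ^ 2 = D at h1
        field_simp

theorem pmFactor₂_div_comm (a b : ℂ) :
    pmFactor₂ 1 a b / pmFactor₂ t a b = pmFactor₂ 1 b a / pmFactor₂ t b a := by
  unfold pmFactor₂
  congr 1 <;> ring

/-- All factors of a term that involve the variables `x_i` and `x_j`. -/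
theorem pair_variable_factor (hρ : 1 < ρ) (hR : ρ < R) (ht : ‖t‖ * R ^ 2 < 1)
    (hpq : ∀ i : Fin m, v (i.succ, false) < v (i.succ, true)) (hv : Function.Injective v)
    (hx : IsGeneric ρ x) {i j : Fin m} (hij : v (i.succ, false) < v (j.succ, false)) :
    (∏ b, ∏ b', orderedFactor t v (letterVal x) (i.succ, b) (j.succ, b')) *
        (pmFactor₂ 1 (x i) (x j) / pmFactor₂ t (x i) (x j)) =
      interaction t (v (j.succ, false) < v (i.succ, true)) (v (j.succ, true) < v (i.succ, true))
        (x i) (x j) := by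
  have hne : i ≠ j := by rintro rfl; exact lt_irrefl _ hij
  have hxi := ne_zero_of_mem_twoCircles hρ (hx.mem i)
  have hxj := ne_zero_of_mem_twoCircles hρ (hx.mem j)
  have hn := fun i => norm_lt_of_mem_twoCircles hρ hR (hx.mem i)
  have hn' := fun i => norm_lt_of_mem_twoCircles hρ hR (inv_mem_twoCircles (hx.mem i))
  have hd : ∀ b b', letterVal x (i.succ, b) ≠ letterVal x (j.succ, b') := fun b b' =>
    hx.injective.ne (by simp [hne])
  have h1 : x i ≠ x j := by simpa using hd false false
  have h2 : x i ≠ (x j)⁻¹ := by simpa using hd false true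
  rw [← interaction_eq (t := t) _ _ hxi]
  · have h3 := hij.trans (hpq j)
    have hne1 : ∀ b, v (j.succ, b) ≠ v (i.succ, true) := fun b => hv.ne (by simp [hne.symm])
    have hnot : ∀ b, v (i.succ, true) < v (j.succ, b) ↔ ¬ v (j.succ, b) < v (i.succ, true) := by
      intro b
      rw [not_lt, le_iff_lt_or_eq]
      simp [(hne1 b).symm]
    simp only [Fintype.prod_bool, orderedFactor, letterVal_succ, if_true, Bool.false_eq_true,
      if_false, hij, h3, hnot, ite_not]
    ring
  · intro h
    apply h2
    field_simp
    linear_combination -h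
  · intro h
    apply h2
    field_simp at h ⊢
    linear_combination h
  · intro h
    apply h1
    field_simp at h
    linear_combination h
  · intro h
    apply h1
    field_simp at h
    linear_combination -h
  · exact crossFactor_den_ne_zero ht (hn i) (hn j)
  · exact crossFactor_den_ne_zero ht (hn' i) (hn' j)
  · exact crossFactor_den_ne_zero ht (hn' i) (hn j)
  · exact crossFactor_den_ne_zero ht (hn i) (hn' j)

/-- A term in which every `x_i` precedes `x_i⁻¹` has the product form of `residueIntegrand`. -/
theorem termIntegrand_eq (hρ : 1 < ρ) (hR : ρ < R) (ht : ‖t‖ * R ^ 2 < 1)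
    (hs : s ^ 2 = t) (hlam : Antitone lam)
    (hv : Function.Injective v) (hpq : ∀ i : Fin m, v (i.succ, false) < v (i.succ, true))
    (hx : IsGeneric ρ x) :
    termIntegrand t s α lam v x =
      1 / (2 ^ m * (m.factorial : ℂ)) * ((1 + t) / 2) * (-1) ^ lam (v (0, true)) *
        residueIntegrand t (fun i => v (i.succ, false)) (fun i => v (i.succ, true))
          (residueNumerator t α lam v) x := by
  have hv' : Function.Injective fun i : Fin m => v (i.succ, false) := fun i j h => by
    simpa using hv h
  have hnone : letterVal x (0, false) ^ lam (v (0, false)) *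
      letterVal x (0, true) ^ lam (v (0, true)) *
        orderedFactor t v (letterVal x) (0, false) (0, true) =
      (1 + t) / 2 * (-1) ^ lam (v (0, true)) := by
    simp only [orderedFactor, hlFactor, letterVal_zero, if_true, Bool.false_eq_true, if_false,
      one_pow, one_mul]
    split_ifs <;> ring
  have hpair : (∏ i : Fin m, ∏ j : Fin m, if i < j then
        ∏ b, ∏ b', orderedFactor t v (letterVal x) (i.succ, b) (j.succ, b') else 1) *
      (∏ i, ∏ j ∈ Ioi i, pmFactor₂ 1 (x i) (x j) / pmFactor₂ t (x i) (x j)) =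
      ∏ i : Fin m, ∏ j : Fin m, if v (i.succ, false) < v (j.succ, false) then
        interaction t (v (j.succ, false) < v (i.succ, true)) (v (j.succ, true) < v (i.succ, true))
        (x i) (x j) else 1 := by
    have h1 : ∏ i, ∏ j ∈ Ioi i, pmFactor₂ 1 (x i) (x j) / pmFactor₂ t (x i) (x j) =
        ∏ i, ∏ j, if i < j then pmFactor₂ 1 (x i) (x j) / pmFactor₂ t (x i) (x j) else 1 := by
      refine Finset.prod_congr rfl fun i _ => ?_
      rw [← Finset.prod_filter, Finset.filter_lt_eq_Ioi]
    rw [h1, ← Finset.prod_mul_distrib]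
    simp only [← Finset.prod_mul_distrib, ite_mul_ite, one_mul]
    rw [prod_prod_ite_lt_eq_fin hv']
    · refine Finset.prod_congr rfl fun i _ => Finset.prod_congr rfl fun j _ => ?_
      split_ifs with hij
      · exact pair_variable_factor hρ hR ht hpq hv hx hij
      · rfl
    · intro i j hij
      rw [pmFactor₂_div_comm, Finset.prod_comm]
      congr 1
      refine Finset.prod_congr rfl fun b _ => Finset.prod_congr rfl fun b' _ => ?_
      exact orderedFactor_comm t hv _ (by simp [hij])
  rw [termIntegrand, letterTerm_eq t lam hv, Fin.prod_univ_succ, hnone, koornwinderDensity,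
    residueIntegrand]
  simp only [Fin.val_fin_lt]
  rw [← hpair]
  simp only [← single_variable_factor (α := α) hρ hR ht hs hlam hv hpq hx,
    Finset.prod_mul_distrib]
  ring

end Standard

/-! ### Generic points -/

section Generic

variable {m : ℕ} {ρ : ℝ}

/-- Graphs are null sets, as the two-circle measure has no atoms. -/
theorem ae_ne_apply_apply (hρ : 0 < ρ) {i j : Fin m} (hij : i ≠ j) {φ : ℂ → ℂ}
    (hφ : Measurable φ) :
    ∀ᵐ x ∂(Measure.pi fun _ : Fin m => twoCircleMeasure ρ), x i ≠ φ (x j) := by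
  have h := ProbabilityTheory.iIndepFun_pi (μ := fun _ : Fin m => twoCircleMeasure ρ)
    (X := fun _ z => z) (fun _ => aemeasurable_id)
  have h2 := (ProbabilityTheory.indepFun_iff_map_prod_eq_prod_map_map
    (measurable_pi_apply j).aemeasurable (measurable_pi_apply i).aemeasurable).1
    (h.indepFun hij.symm)
  have h3 : ∀ k : Fin m, Measure.map (fun x : Fin m → ℂ => x k)
      (Measure.pi fun _ : Fin m => twoCircleMeasure ρ) = twoCircleMeasure ρ := fun k =>
    (measurePreserving_eval (fun _ : Fin m => twoCircleMeasure ρ) k).map_eq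
  rw [h3, h3] at h2
  have hms : MeasurableSet {z : ℂ × ℂ | z.2 = φ z.1} :=
    measurableSet_eq_fun measurable_snd (hφ.comp measurable_fst)
  have h4 : ((twoCircleMeasure ρ).prod (twoCircleMeasure ρ)) {z : ℂ × ℂ | z.2 = φ z.1} = 0 := by
    rw [Measure.measure_prod_null hms]
    refine Filter.Eventually.of_forall fun a => ?_
    have : Prod.mk a ⁻¹' {z : ℂ × ℂ | z.2 = φ z.1} = {φ a} := by ext; simp
    change twoCircleMeasure ρ (Prod.mk a ⁻¹' {z : ℂ × ℂ | z.2 = φ z.1}) = 0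
    rw [this]
    exact twoCircleMeasure_singleton hρ _
  rw [← h2, Measure.map_apply
    ((measurable_pi_apply j).prodMk (measurable_pi_apply i)) hms] at h4
  rw [ae_iff]
  simpa using h4

/-- The formula for `P_λ` at points with distinct coordinates applies almost everywhere. -/
theorem ae_isGeneric (hρ : 1 < ρ) :
    ∀ᵐ x ∂(Measure.pi fun _ : Fin m => twoCircleMeasure ρ), IsGeneric ρ x := by
  have hρ0 : 0 < ρ := one_pos.trans hρ
  have h1 := ae_mem_pi (μ := fun _ : Fin m => twoCircleMeasure ρ)
    fun _ => twoCircleMeasure_compl hρ0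
  have h2 : ∀ᵐ x ∂(Measure.pi fun _ : Fin m => twoCircleMeasure ρ), ∀ i j, i ≠ j → x i ≠ x j := by
    simp only [eventually_countable_forall]
    exact fun i j hij => ae_ne_apply_apply hρ0 hij measurable_id
  have h3 : ∀ᵐ x ∂(Measure.pi fun _ : Fin m => twoCircleMeasure ρ),
      ∀ i j, i ≠ j → x i ≠ (x j)⁻¹ := by
    simp only [eventually_countable_forall]
    exact fun i j hij => ae_ne_apply_apply hρ0 hij measurable_inv
  filter_upwards [h1, h2, h3] with x h1 h2 h3
  refine ⟨h1, ?_⟩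
  have hsq : ∀ i, x i ^ 2 ≠ 1 := fun i h =>
    one_sub_sq_ne_zero_of_mem_twoCircles hρ (h1 i) (by rw [h, sub_self])
  have h0 : ∀ i, x i ≠ 0 := fun i => ne_zero_of_mem_twoCircles hρ (h1 i)
  have hc : ∀ (i : Fin m) (b b' : Bool), letterVal x (i.succ, b) ≠ letterVal x (0, b') := by
    intro i b b' h
    apply hsq i
    cases b <;> cases b' <;> simp [inv_eq_iff_eq_inv] at h <;> simp [h]
  rintro ⟨k, b⟩ ⟨k', b'⟩
  refine Fin.cases ?_ (fun i => ?_) k <;> refine Fin.cases ?_ (fun j => ?_) k'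
  · intro h
    cases b <;> cases b' <;> first | rfl | (exfalso; norm_num at h)
  · intro h
    exact absurd h.symm (hc j _ _)
  · intro h
    exact absurd h (hc i _ _)
  · intro h
    by_cases hij : i = j
    · subst hij
      have h4 : x i ≠ (x i)⁻¹ := fun h5 => hsq i (by
        rw [sq]; nth_rewrite 2 [h5]; exact mul_inv_cancel₀ (h0 i))
      cases b <;> cases b' <;> simp [h4, h4.symm] at h ⊢
    · exfalso
      have h5 : (x i)⁻¹ ≠ x j := fun h5 => h3 i j hij (by rw [← h5, inv_inv])
      cases b <;> cases b' <;> simp [h2 i j hij, h3 i j hij, h5] at h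

end Generic

/-! ### The integral of a single term -/

/-- Inversion of the coordinates `x_i` with `δ i = true`. -/
noncomputable def invAt {m : ℕ} (δ : Fin m → Bool) (x : Fin m → ℂ) (i : Fin m) : ℂ :=
  if δ i then (x i)⁻¹ else x i

theorem invAt_invAt {m : ℕ} (δ : Fin m → Bool) (x : Fin m → ℂ) : invAt δ (invAt δ x) = x := by
  funext i
  simp only [invAt]
  split_ifs <;> simp

theorem measurable_invAt {m : ℕ} (δ : Fin m → Bool) : Measurable (invAt δ) := by
  refine measurable_pi_lambda _ fun i => ?_
  unfold invAt
  split_ifs <;> fun_prop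

/-- `invAt` as a measurable equivalence. -/
noncomputable def invAtEquiv {m : ℕ} (δ : Fin m → Bool) : (Fin m → ℂ) ≃ᵐ (Fin m → ℂ) where
  toFun := invAt δ
  invFun := invAt δ
  left_inv := invAt_invAt δ
  right_inv := invAt_invAt δ
  measurable_toFun := measurable_invAt δ
  measurable_invFun := measurable_invAt δ

theorem measurePreserving_invAtEquiv {m : ℕ} (ρ : ℝ) (δ : Fin m → Bool) :
    MeasurePreserving (invAtEquiv δ) (Measure.pi fun _ => twoCircleMeasure ρ)
      (Measure.pi fun _ => twoCircleMeasure ρ) := by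
  have : ∀ i : Fin m, MeasurePreserving (fun z : ℂ => if δ i then z⁻¹ else z)
      (twoCircleMeasure ρ) (twoCircleMeasure ρ) := by
    intro i
    split_ifs
    · exact measurePreserving_inv_twoCircleMeasure ρ
    · exact MeasurePreserving.id _
  exact measurePreserving_pi _ _ this

/-- Interchange of the letters `x_i`, `x_i⁻¹` with `δ i = true`. -/
def flipLetter {m : ℕ} (δ : Fin m → Bool) : Equiv.Perm (Letter m) :=
  Function.Involutive.toPerm
    (fun l => (l.1, xor l.2 (Fin.cases false δ l.1 : Bool))) fun l => by simp

theorem flipLetter_apply_fst {m : ℕ} (δ : Fin m → Bool) (l : Letter m) :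
    (flipLetter δ l).1 = l.1 := rfl

theorem flipLetter_zero {m : ℕ} (δ : Fin m → Bool) (b : Bool) :
    flipLetter δ (0, b) = (0, b) :=
  Prod.ext rfl (Bool.xor_false b)

theorem flipLetter_succ {m : ℕ} (δ : Fin m → Bool) (i : Fin m) (b : Bool) :
    flipLetter δ (i.succ, b) = (i.succ, xor b (δ i)) := rfl

theorem letterVal_invAt {m : ℕ} (δ : Fin m → Bool) (x : Fin m → ℂ) :
    letterVal (invAt δ x) = letterVal x ∘ flipLetter δ := by
  funext ⟨k, b⟩
  refine Fin.cases ?_ (fun i => ?_) k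
  · rw [Function.comp_apply, flipLetter_zero]; rfl
  · rw [Function.comp_apply, flipLetter_succ, letterVal_succ, letterVal_succ, invAt]
    cases b <;> cases δ i <;> simp

theorem letterColor_comp_flipLetter {m : ℕ} (δ : Fin m → Bool) (ε : Fin m → ℤˣ) :
    letterColor ε ∘ flipLetter δ = letterColor ε := by
  funext ⟨k, b⟩
  refine Fin.cases ?_ (fun i => ?_) k
  · rw [Function.comp_apply, flipLetter_zero]
  · rw [Function.comp_apply, flipLetter_succ, letterColor_succ, letterColor_succ]

theorem crossSign_comp {m N : ℕ} (v : Letter m → Fin N) (y : Letter m → ℤˣ)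
    (σ : Equiv.Perm (Letter m)) (hσ : ∀ l, (σ l).1 = l.1) :
    crossSign (v ∘ σ) (y ∘ σ) = crossSign v y := by
  have h : ∀ l l', (if l.1 < l'.1 ∧ (y ∘ σ) l = (y ∘ σ) l' ∧ (v ∘ σ) l' < (v ∘ σ) l
      then (-1 : ℤ) else 1) =
      if (σ l).1 < (σ l').1 ∧ y (σ l) = y (σ l') ∧ v (σ l') < v (σ l) then -1 else 1 := by
    intro l l'
    rw [hσ, hσ]
    rfl
  simp only [crossSign, h]
  rw [Equiv.prod_comp σ fun l => ∏ l', if l.1 < (σ l').1 ∧ y l = y (σ l') ∧ v (σ l') < v l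
    then (-1 : ℤ) else 1]
  refine Finset.prod_congr rfl fun l _ => ?_
  rw [Equiv.prod_comp σ fun l' => if l.1 < l'.1 ∧ y l = y l' ∧ v l' < v l then (-1 : ℤ) else 1]

theorem pmFactor_inv (u z : ℂ) : pmFactor u z⁻¹ = pmFactor u z := by
  rw [pmFactor, pmFactor, inv_inv, mul_comm]

theorem pmFactor₂_inv_left (u z w : ℂ) : pmFactor₂ u z⁻¹ w = pmFactor₂ u z w := by
  rw [pmFactor₂, pmFactor₂, inv_inv]; ring

theorem pmFactor₂_inv_right (u z w : ℂ) : pmFactor₂ u z w⁻¹ = pmFactor₂ u z w := by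
  rw [pmFactor₂, pmFactor₂, inv_inv]; ring

theorem pmFactor_invAt {m : ℕ} (δ : Fin m → Bool) (x : Fin m → ℂ) (u : ℂ) (i : Fin m) :
    pmFactor u (invAt δ x i) = pmFactor u (x i) := by
  rw [invAt]
  split_ifs
  · rw [pmFactor_inv]
  · rfl

theorem pmFactor₂_invAt {m : ℕ} (δ : Fin m → Bool) (x : Fin m → ℂ) (u : ℂ) (i j : Fin m) :
    pmFactor₂ u (invAt δ x i) (invAt δ x j) = pmFactor₂ u (x i) (x j) := by
  rw [invAt, invAt]
  split_ifs <;> simp only [pmFactor₂_inv_left, pmFactor₂_inv_right]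

theorem koornwinderDensity_invAt {m : ℕ} (δ : Fin m → Bool) (a b c d t : ℂ) (x : Fin m → ℂ) :
    koornwinderDensity a b c d t (invAt δ x) = koornwinderDensity a b c d t x := by
  have h : ∀ i, (1 - invAt δ x i ^ 2) * (1 - (invAt δ x i)⁻¹ ^ 2) =
      (1 - x i ^ 2) * (1 - (x i)⁻¹ ^ 2) := by
    intro i
    rw [invAt]
    split_ifs
    · rw [inv_inv, mul_comm]
    · rfl
  simp only [koornwinderDensity, pmFactor_invAt, pmFactor₂_invAt, h]

/-- Inverting variables amounts to exchanging the positions of `x_i` and `x_i⁻¹`. -/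
theorem termIntegrand_invAt {m N : ℕ} (t s α : ℂ) (lam : Fin N → ℕ) (v : Letter m → Fin N)
    (δ : Fin m → Bool) (x : Fin m → ℂ) :
    termIntegrand t s α lam (v ∘ flipLetter δ) (invAt δ x) = termIntegrand t s α lam v x := by
  simp only [termIntegrand, koornwinderDensity_invAt, pmFactor_invAt, letterVal_invAt,
    letterTerm_comp]

section Term

variable {m N : ℕ} {ρ R : ℝ} {t s α : ℂ} {lam : Fin N → ℕ}

/-- The numerators at the poles `±1`. -/
theorem residueNumerator_unit (ht : ‖t‖ < 1) (hlam : Antitone lam) {v : Letter m → Fin N}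
    (hpq : ∀ i : Fin m, v (i.succ, false) < v (i.succ, true)) (ε : Fin m → ℤˣ) (i : Fin m) :
    residueNumerator t α lam v i ((ε i : ℤ) : ℂ) =
      -(1 - t)⁻¹ * ((((ε i : ℤ) : ℂ) ^ lam (v (i.succ, false)) *
        ((ε i : ℤ) : ℂ) ^ lam (v (i.succ, true))) * (1 - α * ((ε i : ℤ) : ℂ)) ^ 2 *
        ∏ b : Bool, if v (i.succ, false) < v (0, b) ∧ v (0, b) < v (i.succ, true) then
          -(((letterColor ε (0, b) : ℤ) : ℂ) * ((ε i : ℤ) : ℂ)) else 1) := by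
  have hsq : ((ε i : ℤ) : ℂ) ^ 2 = 1 := by
    rcases units_int_cast_cases (ε i) with h | h <;> rw [h] <;> norm_num
  have hpow : ((ε i : ℤ) : ℂ) ^ (lam (v (i.succ, false)) - lam (v (i.succ, true))) =
      ((ε i : ℤ) : ℂ) ^ lam (v (i.succ, false)) * ((ε i : ℤ) : ℂ) ^ lam (v (i.succ, true)) := by
    have h1 := hlam (hpq i).le
    conv_rhs => rw [← Nat.sub_add_cancel h1, pow_add, mul_assoc, ← pow_add, ← two_mul, pow_mul,
      hsq, one_pow, mul_one]
  have hb : ∀ b, signVal b = ((letterColor ε (0, b) : ℤ) : ℂ) := by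
    intro b; cases b <;> simp [signVal]
  rw [residueNumerator, hsq, mul_one, pow_succ, hpow]
  simp only [hb, crossFactor_units ht]
  have h2 : ((ε i : ℤ) : ℂ) * (((ε i : ℤ) : ℂ) - α) = 1 - α * ((ε i : ℤ) : ℂ) := by
    linear_combination hsq
  rw [sq (1 - α * ((ε i : ℤ) : ℂ)), div_eq_mul_inv]
  nth_rewrite 3 [← h2]
  ring

theorem differentiableOn_residueNumerator (hR : 1 < R) (ht : ‖t‖ * R ^ 2 < 1)
    (v : Letter m → Fin N) (i : Fin m) :
    DifferentiableOn ℂ (residueNumerator t α lam v i) (Metric.ball 0 R) := by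
  intro z hz
  have hz : ‖z‖ < R := by simpa using hz
  have h1 : 1 - t * z ^ 2 ≠ 0 := by
    rw [sq]; exact crossFactor_den_ne_zero ht hz hz
  have h2 : ∀ b, 1 - t * (signVal b * z) ≠ 0 := fun b => crossFactor_den_ne_zero ht
    (by rcases signVal_cases b with h | h <;> rw [h] <;> simpa using hR) hz
  have h3 := h2 true
  have h4 := h2 false
  refine DifferentiableAt.differentiableWithinAt ?_
  unfold residueNumerator crossFactor
  simp only [Fintype.prod_bool]
  split_ifs <;> fun_prop (disch := assumption)

theorem prod_letterColor_pow (v : Letter m → Fin N) (ε : Fin m → ℤˣ) :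
    ∏ l, ((letterColor ε l : ℤ) : ℂ) ^ lam (v l) = (-1) ^ lam (v (0, true)) *
      ∏ i : Fin m, ((ε i : ℤ) : ℂ) ^ lam (v (i.succ, false)) *
        ((ε i : ℤ) : ℂ) ^ lam (v (i.succ, true)) := by
  rw [Fintype.prod_prod_type, Fin.prod_univ_succ]
  simp [mul_comm]

theorem integral_termIntegrand_of_lt (hρ : 1 < ρ) (hR : ρ < R) (ht : ‖t‖ * R ^ 2 < 1)
    (hs : s ^ 2 = t) (hlam : Antitone lam) {v : Letter m → Fin N} (hv : Function.Injective v)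
    (hpq : ∀ i : Fin m, v (i.succ, false) < v (i.succ, true)) :
    Integrable (termIntegrand t s α lam v) (Measure.pi fun _ => twoCircleMeasure ρ) ∧
    ∫ x, termIntegrand t s α lam v x ∂(Measure.pi fun _ => twoCircleMeasure ρ) =
      1 / (2 ^ m * (m.factorial : ℂ)) * ((1 + t) / 2) * (4 * (1 - t))⁻¹ ^ m *
        ∑ ε : Fin m → ℤˣ, (∏ l, ((letterColor ε l : ℤ) : ℂ) ^ lam (v l)) *
          (∏ i, (1 - α * ((ε i : ℤ) : ℂ)) ^ 2) * (crossSign v (letterColor ε) : ℂ) := by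
  have hR1 : 1 < R := hρ.trans hR
  have ht1 : ‖t‖ < 1 :=
    lt_of_le_of_lt (le_mul_of_one_le_right (norm_nonneg t) (one_le_pow₀ hR1.le)) ht
  have hae : termIntegrand t s α lam v =ᵐ[Measure.pi fun _ => twoCircleMeasure ρ] fun x =>
      1 / (2 ^ m * (m.factorial : ℂ)) * ((1 + t) / 2) * (-1) ^ lam (v (0, true)) *
        residueIntegrand t (fun i => v (i.succ, false)) (fun i => v (i.succ, true))
          (residueNumerator t α lam v) x := by
    filter_upwards [ae_isGeneric hρ] with x hx
    exact termIntegrand_eq hρ hR ht hs hlam hv hpq hx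
  have hd := differentiableOn_residueNumerator (α := α) (lam := lam) hR1 ht v
  constructor
  · refine Integrable.congr ?_ hae.symm
    exact (integrable_pi_of_continuousOn (isCompact_twoCircles ρ)
      (fun _ => twoCircleMeasure_compl (one_pos.trans hρ))
      (continuousOn_residueIntegrand hρ hR ht _ _ hd)).const_mul _
  · rw [integral_congr_ae hae, integral_const_mul, integral_residueIntegrand hρ hR ht _ _ ?_
      (fun i => by exact_mod_cast hpq i) _ hd (fun i => by simp [residueNumerator])]
    · rw [mul_assoc (1 / (2 ^ m * (m.factorial : ℂ)) * ((1 + t) / 2)),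
        mul_assoc (1 / (2 ^ m * (m.factorial : ℂ)) * ((1 + t) / 2))]
      congr 1
      simp only [Finset.mul_sum]
      refine Finset.sum_congr rfl fun ε _ => ?_
      simp only [residueNumerator_unit ht1 hlam hpq, prod_letterColor_pow, crossSign_eq hv hpq,
        Finset.prod_mul_distrib, Finset.prod_const, Finset.card_univ, Fintype.card_fin,
        Fin.val_fin_lt]
      have : (-1 / 4 : ℂ) ^ m * (-(1 - t)⁻¹) ^ m = (4 * (1 - t))⁻¹ ^ m := by
        rw [← mul_pow]
        congr 1
        rw [mul_inv]
        ring
      rw [← this]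
      ring
    · intro i j h
      have := hv (Fin.ext h)
      simpa using this

/-- The integral of a term. The measure is invariant under inversion of any of the variables, which
allows the assumption that each `x_i` stands to the left of `x_i⁻¹`. -/
theorem integral_termIntegrand (hρ : 1 < ρ) (hR : ρ < R) (ht : ‖t‖ * R ^ 2 < 1)
    (hs : s ^ 2 = t) (hlam : Antitone lam) {v : Letter m → Fin N} (hv : Function.Injective v) :
    Integrable (termIntegrand t s α lam v) (Measure.pi fun _ => twoCircleMeasure ρ) ∧
    ∫ x, termIntegrand t s α lam v x ∂(Measure.pi fun _ => twoCircleMeasure ρ) =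
      1 / (2 ^ m * (m.factorial : ℂ)) * ((1 + t) / 2) * (4 * (1 - t))⁻¹ ^ m *
        ∑ ε : Fin m → ℤˣ, (∏ l, ((letterColor ε l : ℤ) : ℂ) ^ lam (v l)) *
          (∏ i, (1 - α * ((ε i : ℤ) : ℂ)) ^ 2) * (crossSign v (letterColor ε) : ℂ) := by
  let δ : Fin m → Bool := fun i => decide (v (i.succ, true) < v (i.succ, false))
  have hv' : Function.Injective (v ∘ flipLetter δ) := hv.comp (flipLetter δ).injective
  have hpq : ∀ i : Fin m,
      (v ∘ flipLetter δ) (i.succ, false) < (v ∘ flipLetter δ) (i.succ, true) := by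
    intro i
    simp only [Function.comp_apply, flipLetter_succ]
    by_cases h : v (i.succ, true) < v (i.succ, false)
    · simp [δ, h]
    · have h2 : v (i.succ, false) ≠ v (i.succ, true) := hv.ne (by simp)
      simpa [δ, h] using lt_of_le_of_ne (not_lt.1 h) h2
  obtain ⟨h1, h2⟩ := integral_termIntegrand_of_lt (α := α) hρ hR ht hs hlam hv' hpq
  have hmp := measurePreserving_invAtEquiv ρ δ
  have hcomp : termIntegrand t s α lam v =
      termIntegrand t s α lam (v ∘ flipLetter δ) ∘ invAtEquiv δ := by
    funext x
    exact (termIntegrand_invAt t s α lam v δ x).symm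
  constructor
  · rw [hcomp]
    exact (hmp.integrable_comp_emb (invAtEquiv δ).measurableEmbedding).2 h1
  · have h3 : ∫ x, termIntegrand t s α lam v x ∂(Measure.pi fun _ => twoCircleMeasure ρ) =
        ∫ x, termIntegrand t s α lam (v ∘ flipLetter δ) x
          ∂(Measure.pi fun _ => twoCircleMeasure ρ) := by
      rw [hcomp]
      exact hmp.integral_comp (invAtEquiv δ).measurableEmbedding _
    rw [h3, h2]
    congr 1
    refine Finset.sum_congr rfl fun ε _ => ?_
    have h4 := crossSign_comp v (letterColor ε) (flipLetter δ) (flipLetter_apply_fst δ)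
    have h5 : ∏ l, ((letterColor ε l : ℤ) : ℂ) ^ lam ((v ∘ flipLetter δ) l) =
        ∏ l, ((letterColor ε l : ℤ) : ℂ) ^ lam (v l) := by
      rw [← Equiv.prod_comp (flipLetter δ) fun l => ((letterColor ε l : ℤ) : ℂ) ^ lam (v l)]
      refine Finset.prod_congr rfl fun l _ => ?_
      rw [← congrFun (letterColor_comp_flipLetter δ ε) l]
      rfl
    rw [letterColor_comp_flipLetter] at h4
    rw [h4, h5]

end Term

/-! ### The Hall–Littlewood polynomial of the zero partition -/

/-- Lagrange interpolation at the nodes `x_k` for `(∏ (X - t x_i) - t^(n+1) ∏ (X - x_i)) / X`: this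
is a polynomial of degree at most `n`, with coefficient `1 - t^(n+1)` at `X^n`. -/
theorem sum_prod_hlFactor {n : ℕ} {t : ℂ} (ht : t ≠ 1) {x : Fin (n + 1) → ℂ}
    (hx : Function.Injective x) (hx0 : ∀ i, x i ≠ 0) :
    ∑ k, ∏ i ∈ univ.erase k, hlFactor t (x k) (x i) = (1 - t ^ (n + 1)) / (1 - t) := by
  have ht' : 1 - t ≠ 0 := sub_ne_zero.2 ht.symm
  let Q : Polynomial ℂ := Lagrange.nodal univ (fun i => t * x i) -
    Polynomial.C (t ^ (n + 1)) * Lagrange.nodal univ x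
  have hcard : #(univ : Finset (Fin (n + 1))) = n + 1 := by simp
  have hQ0 : Q.coeff 0 = 0 := by
    rw [Polynomial.coeff_zero_eq_eval_zero]
    simp only [Q, Polynomial.eval_sub, Polynomial.eval_mul, Polynomial.eval_C,
      Lagrange.eval_nodal, zero_sub, ← mul_neg, Finset.prod_mul_distrib, Finset.prod_const, hcard,
      sub_self]
  have hQ : Q.divX * Polynomial.X = Q := by
    have := Polynomial.divX_mul_X_add Q
    rwa [hQ0, Polynomial.C_0, add_zero] at this
  have hdeg : ∀ y : Fin (n + 1) → ℂ, (Lagrange.nodal univ y).natDegree = n + 1 := fun y => by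
    rw [Lagrange.natDegree_nodal, hcard]
  have hlead : ∀ y : Fin (n + 1) → ℂ, (Lagrange.nodal univ y).coeff (n + 1) = 1 := fun y => by
    have h := (Lagrange.nodal_monic (s := univ) (v := y)).coeff_natDegree
    rwa [hdeg] at h
  have hlt : Q.divX.degree < #(univ : Finset (Fin (n + 1))) := by
    rw [hcard, Polynomial.degree_lt_iff_coeff_zero]
    intro k hk
    rw [Polynomial.coeff_divX]
    simp only [Q, Polynomial.coeff_sub, Polynomial.coeff_C_mul]
    rw [Polynomial.coeff_eq_zero_of_natDegree_lt (by rw [hdeg]; omega),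
      Polynomial.coeff_eq_zero_of_natDegree_lt (by rw [hdeg]; omega)]
    simp
  have h1 := Lagrange.coeff_eq_sum (s := univ) hx.injOn hlt
  rw [hcard, Nat.add_sub_cancel, Polynomial.coeff_divX] at h1
  have h2 : Q.coeff (n + 1) = 1 - t ^ (n + 1) := by
    simp only [Q, Polynomial.coeff_sub, Polynomial.coeff_C_mul, hlead, mul_one]
  rw [h2] at h1
  rw [h1, Finset.sum_div]
  refine Finset.sum_congr rfl fun k _ => ?_
  have h3 : Q.divX.eval (x k) = (1 - t) * ∏ i ∈ univ.erase k, (x k - t * x i) := by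
    apply mul_right_cancel₀ (hx0 k)
    have h4 := congrArg (Polynomial.eval (x k)) hQ
    rw [Polynomial.eval_mul, Polynomial.eval_X] at h4
    rw [h4]
    simp only [Q, Polynomial.eval_sub, Polynomial.eval_mul, Polynomial.eval_C,
      Lagrange.eval_nodal]
    rw [← Finset.mul_prod_erase univ (fun i => x k - t * x i) (mem_univ k),
      Finset.prod_eq_zero (mem_univ k) (sub_self (x k))]
    ring
  rw [h3]
  simp only [hlFactor, Finset.prod_div_distrib]
  field_simp

theorem phiFactor_succ (n : ℕ) (t : ℂ) :
    phiFactor (n + 1) t = phiFactor n t * (1 - t ^ (n + 1)) := by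
  rw [phiFactor, phiFactor, Finset.prod_Icc_succ_top (by omega)]

/-- The symmetrization of the empty monomial is the constant `∏_{j ≤ N} (1 - t^j) / (1 - t)`. -/
theorem sum_hlTerm_zero {n : ℕ} {t : ℂ} (ht : t ≠ 1) {x : Fin n → ℂ}
    (hx : Function.Injective x) (hx0 : ∀ i, x i ≠ 0) :
    ∑ w, hlTerm (fun _ => 0) t x w = phiFactor n t / (1 - t) ^ n := by
  have hterm : ∀ {n : ℕ} (x : Fin n → ℂ) (w : Equiv.Perm (Fin n)),
      hlTerm (fun _ => 0) t x w = ∏ i, ∏ j ∈ Ioi i, hlFactor t (x (w i)) (x (w j)) := by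
    intro n x w
    simp [hlTerm, hlFactor]
  induction n with
  | zero => simp [hterm, phiFactor]
  | succ n ih =>
    -- sort the permutations by the variable `x k` in the first place
    rw [← Equiv.Perm.decomposeFin.symm.sum_comp, Fintype.sum_prod_type]
    have h1 : ∀ k : Fin (n + 1), ∑ e : Equiv.Perm (Fin n),
        hlTerm (fun _ => 0) t x (Equiv.Perm.decomposeFin.symm (k, e)) =
        (∏ i ∈ univ.erase k, hlFactor t (x k) (x i)) * (phiFactor n t / (1 - t) ^ n) := by
      intro k
      let y : Fin n → ℂ := fun j => x (Equiv.swap 0 k j.succ)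
      have hy : Function.Injective y := fun i j h => by
        simpa using (Equiv.swap 0 k).injective (hx h)
      rw [← ih (x := y) hy fun j => hx0 _, Finset.mul_sum]
      refine Finset.sum_congr rfl fun e _ => ?_
      rw [hterm, hterm, Fin.prod_univ_succ]
      have h0 : ∏ j ∈ Ioi (0 : Fin (n + 1)),
          hlFactor t (x (Equiv.Perm.decomposeFin.symm (k, e) 0))
            (x (Equiv.Perm.decomposeFin.symm (k, e) j)) =
          ∏ i ∈ univ.erase k, hlFactor t (x k) (x i) := by
        rw [Fin.prod_Ioi_zero, Equiv.Perm.decomposeFin_symm_apply_zero]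
        simp only [Equiv.Perm.decomposeFin_symm_apply_succ]
        rw [Equiv.prod_comp e fun j => hlFactor t (x k) (x (Equiv.swap 0 k j.succ))]
        have h2 : univ.erase k =
            (univ.erase (0 : Fin (n + 1))).map (Equiv.swap 0 k).toEmbedding := by
          rw [Finset.map_erase]
          simp
        rw [h2, Finset.prod_map, ← Fin.prod_Ioi_zero
          (f := fun j => hlFactor t (x k) (x (Equiv.swap 0 k j)))]
        refine Finset.prod_congr ?_ fun _ _ => rfl
        ext j
        simp
      rw [h0]
      congr 1
      refine Finset.prod_congr rfl fun i _ => ?_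
      rw [Fin.prod_Ioi_succ]
      simp only [Equiv.Perm.decomposeFin_symm_apply_succ]
      rfl
    simp only [h1]
    rw [← Finset.sum_mul, sum_prod_hlFactor ht hx hx0, phiFactor_succ, pow_succ,
      div_mul_div_comm]
    ring

/-! ### Integrals over the torus -/

/-- The product of the circle measures, expressed by the parametrization of the torus in Mathlib. -/
theorem pi_circleMeasure_one (m : ℕ) :
    (Measure.pi fun _ : Fin m => circleMeasure 1) =
      Measure.map (torusMap 0 fun _ => 1)
        (ENNReal.ofReal (2 * Real.pi)⁻¹ ^ m •
          volume.restrict (Set.Icc (0 : Fin m → ℝ) fun _ => 2 * Real.pi)) := by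
  have hfin : IsFiniteMeasure
      (ENNReal.ofReal (2 * Real.pi)⁻¹ • volume.restrict (Set.Ioc 0 (2 * Real.pi)) : Measure ℝ) := by
    constructor
    rw [Measure.smul_apply, Measure.restrict_apply_univ, Real.volume_Ioc, smul_eq_mul]
    exact ENNReal.mul_lt_top ENNReal.ofReal_lt_top ENNReal.ofReal_lt_top
  have h1 : (Measure.pi fun _ : Fin m =>
      (ENNReal.ofReal (2 * Real.pi)⁻¹ • volume.restrict (Set.Ioc 0 (2 * Real.pi)) : Measure ℝ)) =
      ENNReal.ofReal (2 * Real.pi)⁻¹ ^ m •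
        volume.restrict (Set.Icc (0 : Fin m → ℝ) fun _ => 2 * Real.pi) := by
    refine Measure.pi_eq fun s _ => ?_
    have h2 : (Set.Icc (0 : Fin m → ℝ) fun _ => 2 * Real.pi) =
        Set.univ.pi fun _ => Set.Icc (0 : ℝ) (2 * Real.pi) := by
      rw [Set.pi_univ_Icc]; rfl
    rw [h2, volume_pi, Measure.restrict_pi_pi, Measure.smul_apply, Measure.pi_pi]
    simp only [Measure.smul_apply, smul_eq_mul, Finset.prod_mul_distrib, Finset.prod_const,
      Finset.card_univ, Fintype.card_fin]
    congr 1
    refine Finset.prod_congr rfl fun i _ => ?_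
    rw [Measure.restrict_congr_set Ioc_ae_eq_Icc]
  rw [← h1]
  have h3 := Measure.pi_map_pi (μ := fun _ : Fin m =>
      (ENNReal.ofReal (2 * Real.pi)⁻¹ • volume.restrict (Set.Ioc 0 (2 * Real.pi)) : Measure ℝ))
    (f := fun _ => circleMap 0 1) fun _ => (continuous_circleMap 0 1).measurable.aemeasurable
  rw [circleMeasure, ← h3]
  congr 1

theorem continuous_torusMap (m : ℕ) : Continuous (torusMap (0 : Fin m → ℂ) fun _ => 1) := by
  unfold torusMap
  fun_prop

theorem norm_torusMap {m : ℕ} (θ : Fin m → ℝ) (i : Fin m) :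
    ‖torusMap (0 : Fin m → ℂ) (fun _ => 1) θ i‖ = 1 := by
  simp [torusMap, Complex.norm_exp_ofReal_mul_I]

theorem torusIntegrable_of_continuousOn {ρ : ℝ} (hρ : 1 < ρ) {m : ℕ} {f : (Fin m → ℂ) → ℂ}
    (hf : ContinuousOn f {x | ∀ i, x i ∈ annulus ρ}) :
    TorusIntegrable f 0 (fun _ => 1) := by
  refine ContinuousOn.integrableOn_compact isCompact_Icc ?_
  refine hf.comp (continuous_torusMap m).continuousOn fun θ _ i => ?_
  exact sphere_subset_annulus hρ (by simpa using norm_torusMap θ i)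

theorem torusMean_eq_integral_pi {ρ : ℝ} (hρ : 1 < ρ) {m : ℕ} {f : (Fin m → ℂ) → ℂ}
    (hf : ContinuousOn f {x | ∀ i, x i ∈ annulus ρ}) :
    torusMean f = ∫ x, f x ∂(Measure.pi fun _ => circleMeasure 1) := by
  have hint := integrable_pi_of_continuousOn (μ := fun _ : Fin m => circleMeasure 1)
    (isCompact_annulus ρ) (fun _ => circleMeasure_compl_annulus hρ) hf
  have hm := hint.aestronglyMeasurable
  rw [pi_circleMeasure_one] at hm ⊢
  rw [integral_map (continuous_torusMap m).measurable.aemeasurable hm, integral_smul_measure,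
    torusMean, torusIntegral, ← integral_smul]
  refine integral_congr_ae (Filter.Eventually.of_forall fun θ => ?_)
  have hpi : (Real.pi : ℂ) ≠ 0 := by exact_mod_cast Real.pi_ne_zero
  have h0 : ∀ i, Complex.exp (θ i * Complex.I) ≠ 0 := fun i => Complex.exp_ne_zero _
  have h1 : (∏ i : Fin m, ((1 : ℝ) : ℂ) * Complex.exp (θ i * Complex.I) * Complex.I) *
      (∏ j, (2 * (Real.pi : ℂ) * Complex.I * torusMap (0 : Fin m → ℂ) (fun _ => 1) θ j)⁻¹) =
      ((2 * Real.pi)⁻¹ : ℂ) ^ m := by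
    rw [← Finset.prod_mul_distrib, Finset.prod_congr rfl (g := fun _ => ((2 * Real.pi)⁻¹ : ℂ))]
    · simp
    · intro i _
      have := h0 i
      simp only [torusMap, Pi.zero_apply, zero_add, Complex.ofReal_one, one_mul]
      field_simp
  simp only [smul_eq_mul]
  rw [← mul_assoc, h1, ENNReal.toReal_pow, ENNReal.toReal_ofReal (inv_pos.2 Real.two_pi_pos).le,
    Complex.real_smul]
  push_cast
  rfl

/-! ### Holomorphy of the integrands near the torus -/

section Holomorphy

variable {m : ℕ} {ρ R : ℝ}

theorem inv_mem_annulus (hρ : 1 < ρ) {z : ℂ} (hz : z ∈ annulus ρ) : z⁻¹ ∈ annulus ρ := by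
  have h0 : 0 < ‖z‖ := norm_pos_iff.2 (ne_zero_of_mem_annulus hρ hz)
  constructor <;> rw [norm_inv]
  · exact inv_anti₀ h0 hz.2
  · exact inv_le_of_inv_le₀ (one_pos.trans hρ) hz.1

theorem pmFactor_ne_zero (hρ : 1 < ρ) (hR : ρ < R) {a z : ℂ} (ha : ‖a‖ * R < 1)
    (hz : z ∈ annulus ρ) : pmFactor a z ≠ 0 := by
  have h : ∀ w ∈ annulus ρ, 1 - a * w ≠ 0 := fun w hw =>
    one_sub_mul_ne_zero (lt_of_le_of_lt
      (mul_le_mul_of_nonneg_left (hw.2.trans hR.le) (norm_nonneg a)) ha)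
  exact mul_ne_zero (h z hz) (h _ (inv_mem_annulus hρ hz))

theorem pmFactor₂_ne_zero (hρ : 1 < ρ) (hR : ρ < R) {t z w : ℂ} (ht : ‖t‖ * R ^ 2 < 1)
    (hz : z ∈ annulus ρ) (hw : w ∈ annulus ρ) : pmFactor₂ t z w ≠ 0 := by
  have h : ∀ z' ∈ annulus ρ, ∀ w' ∈ annulus ρ, 1 - t * (z' * w') ≠ 0 := fun z' hz' w' hw' =>
    crossFactor_den_ne_zero ht (hz'.2.trans_lt hR) (hw'.2.trans_lt hR)
  have hz' := inv_mem_annulus hρ hz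
  have hw' := inv_mem_annulus hρ hw
  exact mul_ne_zero (mul_ne_zero (mul_ne_zero (h _ hz _ hw) (h _ hz' _ hw')) (h _ hz' _ hw))
    (h _ hz _ hw')

theorem differentiableAt_pmFactor (a : ℂ) {x : Fin m → ℂ} {i : Fin m} (hx : x i ≠ 0) :
    DifferentiableAt ℂ (fun x : Fin m → ℂ => pmFactor a (x i)) x := by
  unfold pmFactor
  fun_prop (disch := assumption)

theorem differentiableAt_pmFactor₂ (a : ℂ) {x : Fin m → ℂ} {i j : Fin m} (hi : x i ≠ 0)
    (hj : x j ≠ 0) : DifferentiableAt ℂ (fun x : Fin m → ℂ => pmFactor₂ a (x i) (x j)) x := by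
  unfold pmFactor₂
  fun_prop (disch := assumption)

/-- A version of `DifferentiableAt.fun_finsetProd` for functions on a normed space. -/
theorem differentiableAt_prod {ι E : Type*} [NormedAddCommGroup E] [NormedSpace ℂ E]
    {u : Finset ι} {f : ι → E → ℂ} {x : E} (hf : ∀ i ∈ u, DifferentiableAt ℂ (f i) x) :
    DifferentiableAt ℂ (fun x => ∏ i ∈ u, f i x) x := by
  classical
  exact (HasFDerivAt.finsetProd fun i hi => (hf i hi).hasFDerivAt).differentiableAt

theorem differentiableAt_koornwinderDensity (hρ : 1 < ρ) (hR : ρ < R) {a b c d t : ℂ}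
    (ha : ‖a‖ * R < 1) (hb : ‖b‖ * R < 1) (hc : ‖c‖ * R < 1) (hd : ‖d‖ * R < 1)
    (ht : ‖t‖ * R ^ 2 < 1) {x : Fin m → ℂ} (hx : ∀ i, x i ∈ annulus ρ) :
    DifferentiableAt ℂ (koornwinderDensity a b c d t) x := by
  have h0 : ∀ i, x i ≠ 0 := fun i => ne_zero_of_mem_annulus hρ (hx i)
  unfold koornwinderDensity
  simp only [div_eq_mul_inv]
  refine DifferentiableAt.fun_mul (DifferentiableAt.fun_mul (by fun_prop) ?_) ?_
  swap
  · refine differentiableAt_prod fun i _ => ?_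
    refine differentiableAt_prod fun j _ => ?_
    exact (differentiableAt_pmFactor₂ 1 (h0 i) (h0 j)).fun_mul
      ((differentiableAt_pmFactor₂ t (h0 i) (h0 j)).fun_inv
        (pmFactor₂_ne_zero hρ hR ht (hx i) (hx j)))
  refine differentiableAt_prod fun i _ => DifferentiableAt.fun_mul ?_
    (DifferentiableAt.fun_inv ?_ ?_)
  · have := h0 i
    fun_prop (disch := assumption)
  · have h1 := fun a => differentiableAt_pmFactor a (h0 i)
    exact (((h1 a).fun_mul (h1 b)).fun_mul (h1 c)).fun_mul (h1 d)
  · have h1 : ∀ {a : ℂ}, ‖a‖ * R < 1 → pmFactor a (x i) ≠ 0 := fun ha =>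
      pmFactor_ne_zero hρ hR ha (hx i)
    exact mul_ne_zero (mul_ne_zero (mul_ne_zero (h1 ha) (h1 hb)) (h1 hc)) (h1 hd)

theorem differentiable_eval {n : ℕ} (P : MvPolynomial (Fin n) ℂ) :
    Differentiable ℂ fun y : Fin n → ℂ => eval y P := by
  induction P using MvPolynomial.induction_on with
  | C a => simp
  | add p q hp hq => simpa using hp.fun_add hq
  | mul_X p i hp =>
    simp only [map_mul, eval_X]
    exact hp.fun_mul (by fun_prop)

theorem differentiableAt_oMinusPoint {x : Fin m → ℂ} (hx : ∀ i, x i ≠ 0) :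
    DifferentiableAt ℂ (fun y : Fin m → ℂ => oMinusPoint (m + 1) y) x := by
  rw [differentiableAt_pi]
  intro k
  unfold oMinusPoint
  split_ifs
  · exact differentiableAt_apply (𝕜 := ℂ) _ x
  · exact (differentiableAt_apply (𝕜 := ℂ) _ x).fun_inv (hx _)
  · fun_prop
  · fun_prop

theorem differentiableAt_oMinusIntegrand (hρ : 1 < ρ) {t s : ℂ}
    (lam : Fin (2 * (m + 1)) → ℕ) (α : ℂ)
    {x : Fin m → ℂ} (hx : ∀ i, x i ∈ annulus ρ)
    (hd : DifferentiableAt ℂ (koornwinderDensity t (-t) s (-s) t) x) :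
    DifferentiableAt ℂ (fun y : Fin m → ℂ => oMinusIntegrand (m + 1) lam t s α y) x := by
  have h0 : ∀ i, x i ≠ 0 := fun i => ne_zero_of_mem_annulus hρ (hx i)
  have h1 : DifferentiableAt ℂ (fun y : Fin m → ℂ => ∏ i, pmFactor α (y i)) x :=
    differentiableAt_prod fun i _ => differentiableAt_pmFactor α (h0 i)
  have h2 : DifferentiableAt ℂ (fun y : Fin m → ℂ =>
      eval (oMinusPoint (m + 1) y) (hallLittlewoodP lam t)) x :=
    ((differentiable_eval (hallLittlewoodP lam t)) _).comp x (differentiableAt_oMinusPoint h0)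
  exact (h2.fun_mul hd).fun_mul h1

end Holomorphy

/-! ### Expansion of the integrand into terms -/

/-- The coordinate of `oMinusPoint` at which a letter stands. -/
def letterPos {m : ℕ} (l : Letter m) : Fin (2 * (m + 1)) :=
  Fin.cases ⟨2 * m + l.2.toNat, by have := l.2.toNat_lt; omega⟩
    (fun i => ⟨i + m * l.2.toNat, by
      have := i.2
      have : m * l.2.toNat ≤ m * 1 := Nat.mul_le_mul_left _ (by have := l.2.toNat_lt; omega)
      omega⟩) l.1

theorem letterPos_zero {m : ℕ} (b : Bool) :
    (letterPos ((0 : Fin (m + 1)), b) : ℕ) = 2 * m + b.toNat := rfl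

theorem letterPos_succ {m : ℕ} (i : Fin m) (b : Bool) :
    (letterPos (i.succ, b) : ℕ) = i + m * b.toNat := rfl

theorem letterPos_bijective (m : ℕ) : Function.Bijective (letterPos (m := m)) := by
  rw [Fintype.bijective_iff_injective_and_card]
  constructor
  · rintro ⟨k, b⟩ ⟨k', b'⟩ h
    have h := congrArg Fin.val h
    revert h
    refine Fin.cases ?_ (fun i => ?_) k <;> refine Fin.cases ?_ (fun j => ?_) k' <;>
      cases b <;> cases b' <;>
      simp only [letterPos_zero, letterPos_succ, Bool.toNat_true, Bool.toNat_false, mul_one,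
        mul_zero, Prod.mk.injEq, Fin.ext_iff] <;> intro h <;>
      simp <;> omega
  · simp
    omega

theorem oMinusPoint_letterPos {m : ℕ} (x : Fin m → ℂ) (l : Letter m) :
    oMinusPoint (m + 1) x (letterPos l) = letterVal x l := by
  obtain ⟨k, b⟩ := l
  refine Fin.cases ?_ (fun i => ?_) k
  · have h := letterPos_zero (m := m) b
    cases b <;> simp only [Bool.toNat_true, Bool.toNat_false] at h <;>
      simp [oMinusPoint, h]
    · rw [dif_neg (by omega), dif_neg (by omega)]
    · rw [dif_neg (by omega), dif_neg (by omega)]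
  · have h := letterPos_succ i b
    have hi := i.2
    cases b <;> simp only [Bool.toNat_true, Bool.toNat_false, mul_one, mul_zero, add_zero] at h <;>
      simp [oMinusPoint, h]

theorem oMinusPoint_injective {m : ℕ} {ρ : ℝ} {x : Fin m → ℂ} (hx : IsGeneric ρ x) :
    Function.Injective (oMinusPoint (m + 1) x) := by
  have h : oMinusPoint (m + 1) x ∘ letterPos = letterVal x := funext (oMinusPoint_letterPos x)
  have h1 := hx.injective
  rw [← h] at h1
  exact (Function.Injective.of_comp_iff' _ (letterPos_bijective m)).1 h1

theorem sum_hlTerm_oMinusPoint {m : ℕ} (lam : Fin (2 * (m + 1)) → ℕ) (t : ℂ) (x : Fin m → ℂ) :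
    ∑ w, hlTerm lam t (oMinusPoint (m + 1) x) w =
      ∑ v : Letter m ≃ Fin (2 * (m + 1)), letterTerm t lam v (letterVal x) := by
  let e := Equiv.ofBijective _ (letterPos_bijective m)
  refine Fintype.sum_equiv ((Equiv.inv _).trans (Equiv.equivCongr e.symm (Equiv.refl _))) _ _
    fun w => ?_
  set v := ((Equiv.inv _).trans (Equiv.equivCongr e.symm (Equiv.refl _))) w with hv
  have hv' : ∀ k, letterVal x (v.symm k) = oMinusPoint (m + 1) x (w k) := by
    intro k
    rw [← oMinusPoint_letterPos]
    congr 1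
    exact e.apply_symm_apply (w k)
  rw [hlTerm, letterTerm, ← v.symm.prod_comp, ← v.symm.prod_comp]
  simp only [Equiv.apply_symm_apply, hv']
  congr 1
  refine Finset.prod_congr rfl fun k _ => ?_
  rw [← v.symm.prod_comp]
  simp only [Equiv.apply_symm_apply, hv']
  rw [← Finset.prod_filter, Finset.filter_lt_eq_Ioi]
  rfl

theorem oMinusIntegrand_eq {m : ℕ} {ρ : ℝ} (lam : Fin (2 * (m + 1)) → ℕ) (t s α : ℂ)
    {x : Fin m → ℂ} (hx : IsGeneric ρ x) :
    oMinusIntegrand (m + 1) lam t s α x = (vFactor lam t)⁻¹ *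
      ∑ v : Letter m ≃ Fin (2 * (m + 1)), termIntegrand t s α lam v x := by
  rw [oMinusIntegrand, eval_hallLittlewoodP _ _ _ (oMinusPoint_injective hx),
    sum_hlTerm_oMinusPoint]
  simp only [termIntegrand, ← Finset.sum_mul, mul_assoc]
  rfl

/-- For the zero partition and `α = 0` the terms add up to a multiple of the density. -/
theorem sum_termIntegrand_zero {m : ℕ} {ρ : ℝ} (hρ : 1 < ρ) {t : ℂ} (ht : t ≠ 1) (s : ℂ)
    {x : Fin m → ℂ} (hx : IsGeneric ρ x) :
    ∑ v : Letter m ≃ Fin (2 * (m + 1)), termIntegrand t s 0 (fun _ : Fin (2 * (m + 1)) => 0) v x =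
      phiFactor (2 * (m + 1)) t / (1 - t) ^ (2 * (m + 1)) *
        koornwinderDensity t (-t) s (-s) t x := by
  have h0 : ∀ k, oMinusPoint (m + 1) x k ≠ 0 := by
    intro k
    obtain ⟨⟨j, b⟩, rfl⟩ := (letterPos_bijective m).2 k
    rw [oMinusPoint_letterPos]
    refine Fin.cases ?_ (fun i => ?_) j
    · cases b <;> simp
    · have := ne_zero_of_mem_twoCircles hρ (hx.mem i)
      cases b <;> simpa using this
  rw [← sum_hlTerm_zero ht (oMinusPoint_injective hx) h0, sum_hlTerm_oMinusPoint]
  simp [termIntegrand, pmFactor, Finset.sum_mul]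

/-! ### Summation over the colourings -/

/-- The parity condition is expressed by `∏_p (-κ_p)`, which is `-1` if the number of `p` with
`κ p = 1` is odd, and `1` otherwise. -/
theorem sum_odd_prod_units {N : ℕ} (h : Fin N → ℤˣ → ℂ) :
    2 * ∑ κ : Fin N → ℤˣ with Odd #{p | κ p = 1}, ∏ p, h p (κ p) =
      (∏ p, (h p 1 + h p (-1))) - ∏ p, (h p (-1) - h p 1) := by
  have hexp : ∀ g : Fin N → ℤˣ → ℂ,
      ∏ p, (g p 1 + g p (-1)) = ∑ κ : Fin N → ℤˣ, ∏ p, g p (κ p) := by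
    intro g
    rw [← Fintype.piFinset_univ, ← Finset.prod_univ_sum]
    refine Finset.prod_congr rfl fun p _ => ?_
    rw [UnitsInt.univ, Finset.sum_pair (by decide)]
  have h1 := hexp h
  have h2 := hexp fun p u => -((u : ℤ) : ℂ) * h p u
  have h3 : ∏ p, (h p (-1) - h p 1) = ∑ κ : Fin N → ℤˣ, ∏ p, -((κ p : ℤ) : ℂ) * h p (κ p) := by
    rw [← h2]
    refine Finset.prod_congr rfl fun p _ => ?_
    push_cast
    ring
  rw [h1, h3, ← Finset.sum_sub_distrib, Finset.mul_sum, Finset.sum_filter]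
  refine Finset.sum_congr rfl fun κ _ => ?_
  have h4 : ∏ p, -((κ p : ℤ) : ℂ) = (-1) ^ #{p | κ p = 1} := by
    rw [← Finset.prod_const, Finset.prod_filter]
    refine Finset.prod_congr rfl fun p _ => ?_
    rcases Int.units_eq_one_or (κ p) with h | h <;> rw [h] <;> simp
  rw [Finset.prod_mul_distrib, h4]
  split_ifs with h5
  · rw [h5.neg_one_pow]; ring
  · rw [(Nat.not_odd_iff_even.1 h5).neg_one_pow]; ring

theorem numOddParts_add_numEvenParts {N : ℕ} (lam : Fin N → ℕ) :
    numOddParts lam + numEvenParts lam = N := by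
  rw [numOddParts, numEvenParts]
  simp only [← Nat.not_odd_iff_even]
  rw [Finset.card_filter_add_card_filter_not, Finset.card_univ, Fintype.card_fin]

theorem prod_ite_odd {N : ℕ} (lam : Fin N → ℕ) (a b : ℂ) :
    ∏ p, (if Odd (lam p) then a else b) = a ^ numOddParts lam * b ^ numEvenParts lam := by
  rw [Finset.prod_ite, Finset.prod_const, Finset.prod_const, numOddParts, numEvenParts]
  simp only [Nat.not_odd_iff_even]

/-- Both exponents have the same parity, as their sum is `2(m + 1)`; this accounts for the signs. -/
theorem sum_odd_colorings {m : ℕ} (lam : Fin (2 * (m + 1)) → ℕ) (α : ℂ) :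
    2 * ∑ κ : Fin (2 * (m + 1)) → ℤˣ with Odd #{p | κ p = 1},
        ∏ p, ((κ p : ℤ) : ℂ) ^ lam p * (1 - α * ((κ p : ℤ) : ℂ)) =
      2 ^ (2 * (m + 1)) * ((-α) ^ numOddParts lam - (-α) ^ numEvenParts lam) := by
  have hN := numOddParts_add_numEvenParts lam
  rw [sum_odd_prod_units fun p u => ((u : ℤ) : ℂ) ^ lam p * (1 - α * ((u : ℤ) : ℂ))]
  have h1 : ∀ p, (((1 : ℤˣ) : ℤ) : ℂ) ^ lam p * (1 - α * (((1 : ℤˣ) : ℤ) : ℂ)) +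
      (((-1 : ℤˣ) : ℤ) : ℂ) ^ lam p * (1 - α * (((-1 : ℤˣ) : ℤ) : ℂ)) =
      if Odd (lam p) then 2 * (-α) else 2 := by
    intro p
    push_cast
    split_ifs with h
    · rw [h.neg_one_pow]; ring
    · rw [(Nat.not_odd_iff_even.1 h).neg_one_pow]; ring
  have h2 : ∀ p, (((-1 : ℤˣ) : ℤ) : ℂ) ^ lam p * (1 - α * (((-1 : ℤˣ) : ℤ) : ℂ)) -
      (((1 : ℤˣ) : ℤ) : ℂ) ^ lam p * (1 - α * (((1 : ℤˣ) : ℤ) : ℂ)) =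
      if Odd (lam p) then -2 else -2 * (-α) := by
    intro p
    push_cast
    split_ifs with h
    · rw [h.neg_one_pow]; ring
    · rw [(Nat.not_odd_iff_even.1 h).neg_one_pow]; ring
  have h3 : (-2 : ℂ) ^ numOddParts lam * (-2) ^ numEvenParts lam = 2 ^ (2 * (m + 1)) := by
    rw [← pow_add, hN, (even_two_mul (m + 1)).neg_pow]
  have h4 : (2 : ℂ) ^ numOddParts lam * 2 ^ numEvenParts lam = 2 ^ (2 * (m + 1)) := by
    rw [← pow_add, hN]
  simp only [h1, h2, prod_ite_odd, mul_pow]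
  linear_combination (-α) ^ numOddParts lam * h4 - (-α) ^ numEvenParts lam * h3

/-- The integral of the whole integrand, up to the constants `(v_λ(t))⁻¹` and `1 - α²`. -/
theorem integral_sum_termIntegrand {m : ℕ} {ρ R : ℝ} {t s : ℂ} (hρ : 1 < ρ) (hR : ρ < R)
    (ht : ‖t‖ * R ^ 2 < 1) (hs : s ^ 2 = t) {lam : Fin (2 * (m + 1)) → ℕ} (hlam : Antitone lam)
    (α : ℂ) :
    (1 - α ^ 2) * (2 * ∫ x, ∑ v : Letter m ≃ Fin (2 * (m + 1)), termIntegrand t s α lam v x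
        ∂(Measure.pi fun _ => twoCircleMeasure ρ)) =
      1 / (2 ^ m * (m.factorial : ℂ)) * ((1 + t) / 2) * (4 * (1 - t))⁻¹ ^ m *
        #(pairPerms m) * 2 ^ (2 * (m + 1)) *
          ((-α) ^ numOddParts lam - (-α) ^ numEvenParts lam) := by
  have hint := fun v : Letter m ≃ Fin (2 * (m + 1)) =>
    integral_termIntegrand (α := α) hρ hR ht hs hlam v.injective
  rw [integral_finsetSum _ fun v _ => (hint v).1]
  simp only [fun v => (hint v).2]
  rw [← Finset.mul_sum]
  have h1 := sum_mul_crossSign m fun κ => ∏ p, ((κ p : ℤ) : ℂ) ^ lam p * (1 - α * ((κ p : ℤ) : ℂ))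
  -- the letters `±1` contribute the factor `(1 - α) (1 + α)`
  have h2 : ∀ (v : Letter m ≃ Fin (2 * (m + 1))) (ε : Fin m → ℤˣ),
      ∏ p, (((letterColor ε ∘ v.symm) p : ℤ) : ℂ) ^ lam p *
          (1 - α * (((letterColor ε ∘ v.symm) p : ℤ) : ℂ)) =
        (1 - α ^ 2) * ((∏ l, ((letterColor ε l : ℤ) : ℂ) ^ lam (v l)) *
          ∏ i, (1 - α * ((ε i : ℤ) : ℂ)) ^ 2) := by
    intro v ε
    rw [← v.prod_comp]
    simp only [Function.comp_apply, Equiv.symm_apply_apply, Finset.prod_mul_distrib]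
    have h3 : ∏ l : Letter m, (1 - α * ((letterColor ε l : ℤ) : ℂ)) =
        (1 - α ^ 2) * ∏ i, (1 - α * ((ε i : ℤ) : ℂ)) ^ 2 := by
      rw [Fintype.prod_prod_type, Fin.prod_univ_succ]
      simp only [Fintype.prod_bool, letterColor_zero, letterColor_succ, if_true,
        Bool.false_eq_true, if_false, sq]
      push_cast
      ring
    rw [h3]
    ring
  simp only [h2, mul_assoc (1 - α ^ 2)] at h1
  simp only [← Finset.mul_sum] at h1
  have h4 := sum_odd_colorings lam α
  linear_combination (2 * (1 / (2 ^ m * (m.factorial : ℂ)) * ((1 + t) / 2) *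
    (4 * (1 - t))⁻¹ ^ m)) * h1 + (1 / (2 ^ m * (m.factorial : ℂ)) * ((1 + t) / 2) *
    (4 * (1 - t))⁻¹ ^ m * #(pairPerms m)) * h4

/-! ### The integral formula -/

theorem exists_one_lt_mul_sq_lt {a : ℝ} (ha : a < 1) : ∃ R : ℝ, 1 < R ∧ a * R ^ 2 < 1 := by
  have h : Filter.Tendsto (fun R : ℝ => a * R ^ 2) (nhdsWithin 1 (Set.Ioi 1)) (nhds (a * 1 ^ 2)) :=
    (Continuous.tendsto (by fun_prop) 1).mono_left nhdsWithin_le_nhds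
  obtain ⟨R, h1, h2⟩ := ((h.eventually_lt_const (by simpa using ha)).and
    self_mem_nhdsWithin).exists
  exact ⟨R, h2, h1⟩

theorem theorem4p5 (n : ℕ) (hn : 1 ≤ n) (lam : Fin (2 * n) → ℕ) (hlam : Antitone lam)
    (t s α : ℂ) (ht : ‖t‖ < 1) (hs : s ^ 2 = t) :
    TorusIntegrable (fun x : Fin (n - 1) → ℂ => koornwinderDensity t (-t) s (-s) t x)
      0 (fun _ => 1) ∧
    TorusIntegrable (oMinusIntegrand n lam t s α) 0 (fun _ => 1) ∧
    torusMean (fun x : Fin (n - 1) → ℂ => koornwinderDensity t (-t) s (-s) t x) ≠ 0 ∧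
    (1 - α ^ 2) / torusMean (fun x : Fin (n - 1) → ℂ => koornwinderDensity t (-t) s (-s) t x) *
        torusMean (oMinusIntegrand n lam t s α) =
      phiFactor (2 * n) t / (vFactor lam t * (1 - t) ^ (2 * n)) *
        ((-α) ^ numOddParts lam - (-α) ^ numEvenParts lam) := by
  obtain ⟨m, rfl⟩ : ∃ m, n = m + 1 := ⟨n - 1, by omega⟩
  change TorusIntegrable (fun x : Fin m → ℂ => koornwinderDensity t (-t) s (-s) t x)
      0 (fun _ => 1) ∧
    TorusIntegrable (fun x : Fin m → ℂ => oMinusIntegrand (m + 1) lam t s α x) 0 (fun _ => 1) ∧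
    torusMean (fun x : Fin m → ℂ => koornwinderDensity t (-t) s (-s) t x) ≠ 0 ∧
    (1 - α ^ 2) / torusMean (fun x : Fin m → ℂ => koornwinderDensity t (-t) s (-s) t x) *
        torusMean (fun x : Fin m → ℂ => oMinusIntegrand (m + 1) lam t s α x) = _
  -- all denominators of the integrands are nonzero for `R⁻¹ < |x_i| < R`
  obtain ⟨R, hR1, htR⟩ := exists_one_lt_mul_sq_lt ht
  obtain ⟨ρ, hρ, hR⟩ := exists_between hR1
  have hR0 : 0 < R := one_pos.trans hR1
  have htR1 : ‖t‖ * R < 1 := by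
    refine lt_of_le_of_lt ?_ htR
    exact mul_le_mul_of_nonneg_left (le_self_pow₀ hR1.le two_ne_zero) (norm_nonneg t)
  have hsR : ‖s‖ * R < 1 := by
    rw [← hs, norm_pow, ← mul_pow] at htR
    exact (pow_lt_one_iff_of_nonneg (by positivity) two_ne_zero).1 htR
  have hne : t ≠ 1 := by rintro rfl; simp at ht
  have hne' : 1 - t ≠ 0 := sub_ne_zero.2 hne.symm
  have hne2 : 1 + t ≠ 0 := fun h => by
    have : t = -1 := by linear_combination h
    simp [this] at ht
  have hd1 : ∀ x : Fin m → ℂ, (∀ i, x i ∈ annulus ρ) →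
      DifferentiableAt ℂ (koornwinderDensity t (-t) s (-s) t) x := fun x hx =>
    differentiableAt_koornwinderDensity hρ hR htR1 (by rwa [norm_neg]) hsR (by rwa [norm_neg])
      htR hx
  have hd2 : ∀ x : Fin m → ℂ, (∀ i, x i ∈ annulus ρ) →
      DifferentiableAt ℂ (fun y : Fin m → ℂ => oMinusIntegrand (m + 1) lam t s α y) x :=
    fun x hx => differentiableAt_oMinusIntegrand hρ lam α hx (hd1 x hx)
  have hc1 := fun x hx =>
    (hd1 x hx).continuousAt.continuousWithinAt (s := {x | ∀ i, x i ∈ annulus ρ})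
  have hc2 := fun x hx =>
    (hd2 x hx).continuousAt.continuousWithinAt (s := {x | ∀ i, x i ∈ annulus ρ})
  set c : ℂ := 1 / (2 ^ m * (m.factorial : ℂ)) * ((1 + t) / 2) * (4 * (1 - t))⁻¹ ^ m *
    #(pairPerms m) * 2 ^ (2 * (m + 1)) with hc
  have hc0 : c ≠ 0 := by
    have h1 : (#(pairPerms m) : ℂ) ≠ 0 := by exact_mod_cast (pairPerms_card_pos m).ne'
    have h2 : (m.factorial : ℂ) ≠ 0 := by exact_mod_cast m.factorial_ne_zero
    have h3 : (4 * (1 - t))⁻¹ ≠ 0 := inv_ne_zero (mul_ne_zero (by norm_num) hne')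
    rw [hc]
    refine mul_ne_zero (mul_ne_zero (mul_ne_zero (mul_ne_zero ?_ ?_) (pow_ne_zero _ h3)) h1) ?_
    · exact one_div_ne_zero (mul_ne_zero (by simp) h2)
    · exact div_ne_zero hne2 two_ne_zero
    · simp
  -- the case of the zero partition and `α = 0`
  have hZ : 2 * (phiFactor (2 * (m + 1)) t / (1 - t) ^ (2 * (m + 1)) *
      torusMean (fun x : Fin m → ℂ => koornwinderDensity t (-t) s (-s) t x)) = c := by
    have h1 := integral_sum_termIntegrand hρ hR htR hs
      (lam := fun _ : Fin (2 * (m + 1)) => 0) antitone_const 0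
    have h2 : ∫ x, ∑ v : Letter m ≃ Fin (2 * (m + 1)),
        termIntegrand t s 0 (fun _ : Fin (2 * (m + 1)) => 0) v x
          ∂(Measure.pi fun _ => twoCircleMeasure ρ) =
        phiFactor (2 * (m + 1)) t / (1 - t) ^ (2 * (m + 1)) *
          torusMean (fun x : Fin m → ℂ => koornwinderDensity t (-t) s (-s) t x) := by
      rw [torusMean_eq_integral_pi hρ hc1, integral_pi_circleMeasure_one_eq hρ hd1,
        ← integral_const_mul]
      refine integral_congr_ae ?_
      filter_upwards [ae_isGeneric hρ] with x hx
      exact sum_termIntegrand_zero hρ hne s hx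
    have h3 : numOddParts (fun _ : Fin (2 * (m + 1)) => 0) = 0 := by simp [numOddParts]
    have h4 : numEvenParts (fun _ : Fin (2 * (m + 1)) => 0) = 2 * (m + 1) := by
      simp [numEvenParts]
    rw [h2, h3, h4, ← hc] at h1
    simpa using h1
  have hI : torusMean (fun x : Fin m → ℂ => oMinusIntegrand (m + 1) lam t s α x) =
      (vFactor lam t)⁻¹ * ∫ x, ∑ v : Letter m ≃ Fin (2 * (m + 1)), termIntegrand t s α lam v x
        ∂(Measure.pi fun _ => twoCircleMeasure ρ) := by
    rw [torusMean_eq_integral_pi hρ hc2, integral_pi_circleMeasure_one_eq hρ hd2,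
      ← integral_const_mul]
    refine integral_congr_ae ?_
    filter_upwards [ae_isGeneric hρ] with x hx
    exact oMinusIntegrand_eq lam t s α hx
  have hmain := integral_sum_termIntegrand hρ hR htR hs hlam α
  rw [← hc] at hmain
  set Z := torusMean (fun x : Fin m → ℂ => koornwinderDensity t (-t) s (-s) t x)
  have hZ0 : Z ≠ 0 := fun h => hc0 (by rw [← hZ, h]; ring)
  refine ⟨torusIntegrable_of_continuousOn hρ hc1, torusIntegrable_of_continuousOn hρ hc2, hZ0, ?_⟩
  rw [hI, div_mul_eq_mul_div, div_eq_iff hZ0, mul_comm (vFactor lam t), ← div_div,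
    div_eq_mul_inv _ (vFactor lam t)]
  rw [← hZ] at hmain
  linear_combination (vFactor lam t)⁻¹ / 2 * hmain
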